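/- **Setting.** Let $d\ge 2$, $s\ge 1$, $\mathbb T^d=\mathbb R^d/(2\pi\mathbb Z)^d$, and let $|\cdot|$ denote the $\ell^1$-norm of vectors and the induced operator norm $|T|=\max_j\sum_i|T_{ij}|$ of matrices. For a smooth $f:\mathbb T^d\to\mathbb R^d$ with Fourier coefficients $f_k$ ($f(x)=\sum_k f_ke^{ik\cdot x}$) put $$\|f\|_\rho=\sum_{k\in\mathbb Z^d}|f_k|e^{\rho|k|^{1/s}},\qquad \|f\|'_\rho=\sum_{k\in\mathbb Z^d}(1+|k|)|f_k|e^{\rho|k|^{1/s}},$$ and let $\mathcal F_\rho$, $\mathcal F'_\rho$ be the spaces of those $f$ for which the respective norm is finite. Put $\psi^*X=(D\psi)^{-1}X\circ\psi$. We write $\operatorname{Rot}X=\omega$ if every orbit $x(t)$ of the lifted flow of $X$ satisfies $(x(t)-x(0))/t\to\omega$ as $t\to+\infty$. For $\sigma>0$ and $w\in\mathbb R^d$ let $I^-_{\sigma,w}=\{k\in\mathbb Z^d:|w\cdot k|>\sigma|k|\}$, $I^+_{\sigma,w}=\mathbb Z^d\setminus I^-_{\sigma,w}$, and let $\mathbb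 I^\pm_{\sigma,w}$ be the corresponding projections on Fourier modes. Put $\beta=d^{(s-1)/s}s$, $C_\nu=\sum_{k\in\mathbb Z^d}e^{-\nu|k|^{1/s}}$ and $$\varepsilon(\sigma,\nu,|w|,s,d)=\frac{\sigma}{8(C_\nu-1)}\min\left\{\frac{\nu^s}{(2\beta)^s},\ \frac{\sigma}{8|w|C_\nu}\Big(\frac{2^s}{\nu^s}+7\Big)^{-1}\right\}.$$ **Continued fraction.** Let $\omega=(\alpha,1)\in\mathbb R^d$ be rationally independent. Let $0=t_0<t_1<t_2<\dots$ be unbounded, let $M_0=\begin{pmatrix}I&\alpha\\0&1\end{pmatrix}$ and $E^t=\operatorname{diag}(e^{-t},\dots,e^{-t},e^{(d-1)t})$, fix a fundamental domain of $SL(d,\mathbb R)$ for the left action of $SL(d,\mathbb Z)$, and let $P_0=I$ and, for $n\ge1$, $P_n\in SL(d,\mathbb Z)$ be such that $M_n=P_nM_0E^{t_n}$ lies in the fundamental domain. Put $\omega_n=M_ne_d$ (so $\omega_0=\omega$), $\lambda_n=e^{(d-1)t_n}$, and for $n\ge 1$ put $\eta_n=\lambda_n/\lambda_{n-1}$ and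 $T_n=P_nP_{n-1}^{-1}$. **Renormalization scheme.** Fix $\rho\in\mathbb R$, constants $\nu,\delta>0$, and sequences $0<\sigma_n<|\omega_n|$ ($n\ge0$) and $0<\theta_n\le1$ ($n\ge1$). Put $\varepsilon_n=\varepsilon(\sigma_n,\nu,|\omega_n|,s,d)$ and, for $n\ge1$, $$A_n=\sup_{k\in I^+_{\sigma_{n-1},\omega_{n-1}}\setminus\{0\}}\frac{|T_n^{-\top}k|}{|k|},\qquad \phi_n=\max\Big\{7(d+1)|\eta_n||T_n|\Big(1+\frac{s^s}{\delta^s}\Big)\frac{\varepsilon_{n-1}}{\varepsilon_n\theta_n},\,1\Big\},$$ $$\rho_0=\rho,\qquad \rho_n=\frac{\rho_{n-1}-\nu(1+\beta+\beta^2)}{\beta^2A_n^{1/s}}-\delta-\log\phi_n,$$ $$\mathcal B_n=\sum_{i=1}^n\beta^{2i}A_1^{1/s}\cdots A_i^{1/s}\Big(\delta+\frac{\nu(1+\beta+\beta^2)}{\beta^2A_i^{1/s}}+\log\phi_i\Big).$$ For $n\ge1$ write $\mathbb I^\pm=\mathbb I^\pm_{\sigma_{n-1},\omega_{n-1}}$,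 $\rho'=(\rho_{n-1}-\nu)/\beta$ and $\rho''=(\rho'-\nu)/\beta-\nu$. The operator $\mathcal R_n$ is $\mathcal R_n(X)=\eta_n\,(T_n^{-1})^*\,\mathcal U_n(X)$, with $\mathcal U_n(X)=(\mathrm{id}+u)^*X$, where $u=\mathfrak U_n(X)\in\mathbb I^-\mathcal F'_{\rho'}$ is a displacement with $\|u\|'_{\rho'}\le\frac{8(C_\nu-1)}{\sigma_{n-1}}\|\mathbb I^-X\|_{\rho_{n-1}}$ that eliminates the far from resonance modes, i.e. $(\mathrm{id}+u)^*X\in\mathbb I^+\mathcal F_{\rho''}$. A vector field $X$ is in the domain of $\mathcal R_n$ if $\nu<\rho_{n-1}/(1+\beta+\beta^2)$, $X\in\mathcal F'_{\rho_{n-1}}$, $\|X-\omega_{n-1}\|'_{\rho_{n-1}}<\varepsilon_{n-1}$, and such a $u$ exists. Put $X_0=X$ and $X_n=\mathcal R_n(X_{n-1})$. We call $X$ *infinitely renormalizable* if for every $n\ge1$ the field $X_{n-1}$ is in the domain of $\mathcal R_n$. **Theorem.** Suppose that $X\in\mathcal F'_\rho$, $\operatorname{Rot}X=\omega$, $\|X-\omega\|'_\rho<\varepsilon_0$,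 and $\rho>\lim_{n\to\infty}\mathcal B_n$ (in particular the limit is finite). Then $X$ is infinitely renormalizable, and for all $n\ge1$ $$X_n\in\mathcal F'_{\rho_n},\qquad \|X_n-\omega_n\|'_{\rho_n}<\varepsilon_n\theta_n .$$ -/

import Mathlib

namespace GevreyRenorm

/-! ### Norms, periodic vector fields and Gevrey-type spaces -/

/-- The `ℓ¹` norm `|v| = ∑ |v_i|` of a real vector. -/
noncomputable def l1 {d : ℕ} (v : Fin d → ℝ) : ℝ := ∑ i, |v i|

/-- The `ℓ¹` norm `|k| = ∑ |k_i|` of an integer vector. -/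
noncomputable def l1Z {d : ℕ} (k : Fin d → ℤ) : ℝ := ∑ i, |(k i : ℝ)|

/-- The operator norm `|T| = max_j ∑_i |T_{ij}|` induced by the `ℓ¹` norm. -/
noncomputable def matNorm {d : ℕ} (T : Matrix (Fin d) (Fin d) ℤ) : ℝ :=
  ⨆ j, ∑ i, |(T i j : ℝ)|

/-- `k ⬝ x` for an integer vector `k` and a real vector `x`. -/
noncomputable def dotZ {d : ℕ} (k : Fin d → ℤ) (x : Fin d → ℝ) : ℝ := ∑ i, (k i : ℝ) * x i

/-- `(2πℤ)^d`-periodicity, i.e. `f` is a map from `𝕋^d = ℝ^d / (2πℤ)^d` to `ℝ^d`. -/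
def IsPeriodic {d : ℕ} (f : (Fin d → ℝ) → (Fin d → ℝ)) : Prop :=
  ∀ (x : Fin d → ℝ) (m : Fin d → ℤ), f (fun i => x i + 2 * Real.pi * (m i : ℝ)) = f x

/-- The Fourier coefficient `f_k = (2π)^{-d} ∫_{[0,2π]^d} f(x) e^{-i k·x} dx ∈ ℂ^d`. -/
noncomputable def fourierCoef {d : ℕ} (f : (Fin d → ℝ) → (Fin d → ℝ)) (k : Fin d → ℤ) :
    Fin d → ℂ := fun i =>
  ((2 * Real.pi : ℝ) ^ d : ℂ)⁻¹ *
    ∫ x in Set.Icc (0 : Fin d → ℝ) (fun _ => 2 * Real.pi),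
      (f x i : ℂ) * Complex.exp (-Complex.I * (dotZ k x : ℂ))

/-- `|f_k|`, the `ℓ¹` norm of the Fourier coefficient. -/
noncomputable def coefNorm {d : ℕ} (f : (Fin d → ℝ) → (Fin d → ℝ)) (k : Fin d → ℤ) : ℝ :=
  ∑ i, ‖fourierCoef f k i‖

/-- The `k`-th term `|f_k| e^{ρ |k|^{1/s}}` of the norm of `𝓕_{s,ρ}`. -/
noncomputable def termF {d : ℕ} (s ρ : ℝ) (f : (Fin d → ℝ) → (Fin d → ℝ))
    (k : Fin d → ℤ) : ℝ :=
  coefNorm f k * Real.exp (ρ * l1Z k ^ (1 / s))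

/-- The `k`-th term `(1 + |k|) |f_k| e^{ρ |k|^{1/s}}` of the norm of `𝓕'_{s,ρ}`. -/
noncomputable def termF' {d : ℕ} (s ρ : ℝ) (f : (Fin d → ℝ) → (Fin d → ℝ))
    (k : Fin d → ℤ) : ℝ :=
  (1 + l1Z k) * termF s ρ f k

/-- `f ∈ 𝓕_{s,ρ}(𝕋^d, ℝ^d)`. -/
def MemF {d : ℕ} (s ρ : ℝ) (f : (Fin d → ℝ) → (Fin d → ℝ)) : Prop :=
  ContDiff ℝ ((⊤ : ℕ∞) : WithTop ℕ∞) f ∧ IsPeriodic f ∧ Summable (termF s ρ f)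

/-- `f ∈ 𝓕'_{s,ρ}(𝕋^d, ℝ^d)`. -/
def MemF' {d : ℕ} (s ρ : ℝ) (f : (Fin d → ℝ) → (Fin d → ℝ)) : Prop :=
  ContDiff ℝ ((⊤ : ℕ∞) : WithTop ℕ∞) f ∧ IsPeriodic f ∧ Summable (termF' s ρ f)

/-- `‖f‖'_ρ`, the norm of `𝓕'_{s,ρ}`. -/
noncomputable def normF' {d : ℕ} (s ρ : ℝ) (f : (Fin d → ℝ) → (Fin d → ℝ)) : ℝ :=
  ∑' k, termF' s ρ f k

/-- The far from resonance modes `I^-_{σ,w} = {k : |w·k| > σ|k|}`. -/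
def farModes {d : ℕ} (σ : ℝ) (w : Fin d → ℝ) : Set (Fin d → ℤ) :=
  {k | σ * l1Z k < |dotZ k w|}

/-- The resonant modes `I^+_{σ,w}`, the complement of `I^-_{σ,w}`. -/
def resModes {d : ℕ} (σ : ℝ) (w : Fin d → ℝ) : Set (Fin d → ℤ) := (farModes σ w)ᶜ

/-- `‖𝕀^-_{σ,w} f‖_ρ`: the `𝓕_{s,ρ}` norm of the projection of `f` to the far from resonance
modes. -/
noncomputable def normFar {d : ℕ} (s ρ σ : ℝ) (w : Fin d → ℝ)
    (f : (Fin d → ℝ) → (Fin d → ℝ)) : ℝ :=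
  ∑' k, (farModes σ w).indicator (termF s ρ f) k

/-- All Fourier modes of `f` are indexed by `S`. -/
def ModesIn {d : ℕ} (S : Set (Fin d → ℤ)) (f : (Fin d → ℝ) → (Fin d → ℝ)) : Prop :=
  ∀ k ∉ S, fourierCoef f k = 0

/-- `X` has the rotation vector `ω`: every orbit `γ` of the (lifted) flow of `X` satisfies
`(γ(t) - γ(0)) / t → ω` as `t → +∞`. -/
def HasRot {d : ℕ} (X : (Fin d → ℝ) → (Fin d → ℝ)) (ω : Fin d → ℝ) : Prop :=
  ∀ x : Fin d → ℝ, ∃ γ : ℝ → (Fin d → ℝ), γ 0 = x ∧ (∀ t, HasDerivAt γ (X (γ t)) t) ∧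
    Filter.Tendsto (fun t => t⁻¹ • (γ t - x)) Filter.atTop (nhds ω)

/-- The vector field `X` in the coordinates `ψ`: `ψ^* X = (Dψ)⁻¹ X ∘ ψ`. -/
noncomputable def pullback {d : ℕ} (ψ X : (Fin d → ℝ) → (Fin d → ℝ)) :
    (Fin d → ℝ) → (Fin d → ℝ) :=
  fun x => (fderiv ℝ ψ x).inverse (X (ψ x))

/-! ### Constants -/

/-- `β = d^{(s-1)/s} s`. -/
noncomputable def beta (d : ℕ) (s : ℝ) : ℝ := (d : ℝ) ^ ((s - 1) / s) * s

/-- `C_ν = ∑_{k ∈ ℤ^d} e^{-ν |k|^{1/s}}`. -/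
noncomputable def Cnu (d : ℕ) (s ν : ℝ) : ℝ :=
  ∑' k : Fin d → ℤ, Real.exp (-ν * l1Z k ^ (1 / s))

/-- The radius `ε(σ, ν, a, s, d)`, where `a` stands for `|w|`. -/
noncomputable def epsRadius (d : ℕ) (s ν σ a : ℝ) : ℝ :=
  σ / (8 * (Cnu d s ν - 1)) *
    min (ν ^ s / (2 * beta d s) ^ s)
      (σ / (8 * a * Cnu d s ν) * ((2 : ℝ) ^ s / ν ^ s + 7)⁻¹)

/-- `ρ' = (ρ - ν) / β`. -/
noncomputable def radius1 (d : ℕ) (s ν ρ : ℝ) : ℝ := (ρ - ν) / beta d s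

/-- `ρ'' = (ρ' - ν) / β - ν`. -/
noncomputable def radius2 (d : ℕ) (s ν ρ : ℝ) : ℝ :=
  (radius1 d s ν ρ - ν) / beta d s - ν

/-! ### Elimination of the far from resonance modes, rescaling -/

/-- The open ball `𝓥_ε ⊆ 𝓕'_{s,ρ}` of radius `ε` around the constant vector field `w`. -/
def ballV {d : ℕ} (s ρ ε : ℝ) (w : Fin d → ℝ) : Set ((Fin d → ℝ) → (Fin d → ℝ)) :=
  {X | MemF' s ρ X ∧ normF' s ρ (fun x => X x - w) < ε}

/-- `u = 𝔘(X)`: the displacement of the (small) change of coordinates `id + u` which eliminates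
the far from resonance modes of `X`. That is, `u ∈ 𝕀^- 𝓕'_{ρ'}`,
`‖u‖'_{ρ'} ≤ (8 (C_ν - 1) / σ) ‖𝕀^- X‖_ρ`, and `(id + u)^* X ∈ 𝕀^+ 𝓕_{ρ''}`. -/
structure Eliminates {d : ℕ} (s ρ ν σ : ℝ) (w : Fin d → ℝ)
    (X u : (Fin d → ℝ) → (Fin d → ℝ)) : Prop where
  mem : MemF' s (radius1 d s ν ρ) u
  modes : ModesIn (farModes σ w) u
  bound : normF' s (radius1 d s ν ρ) u ≤ 8 * (Cnu d s ν - 1) / σ * normFar s ρ σ w X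
  mem_pullback : MemF s (radius2 d s ν ρ) (pullback (fun x => x + u x) X)
  modes_pullback : ModesIn (resModes σ w) (pullback (fun x => x + u x) X)

open Classical in
/-- The map `X ↦ 𝔘(X)`; it is used only at those `X` for which `𝔘(X)` exists (see
`InDomain`). -/
noncomputable def elimU {d : ℕ} (s ρ ν σ : ℝ) (w : Fin d → ℝ)
    (X : (Fin d → ℝ) → (Fin d → ℝ)) : (Fin d → ℝ) → (Fin d → ℝ) :=
  if h : ∃ u, Eliminates s ρ ν σ w X u then h.choose else 0

/-- The operator `𝓤(X) = (id + 𝔘(X))^* X`. -/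
noncomputable def opU {d : ℕ} (s ρ ν σ : ℝ) (w : Fin d → ℝ)
    (X : (Fin d → ℝ) → (Fin d → ℝ)) : (Fin d → ℝ) → (Fin d → ℝ) :=
  pullback (fun x => x + elimU s ρ ν σ w X x) X

/-- The linear change of coordinates and time `𝓣(X) = η (T⁻¹)^* X`. -/
noncomputable def opT {d : ℕ} (η : ℝ) (T : Matrix.SpecialLinearGroup (Fin d) ℤ)
    (X : (Fin d → ℝ) → (Fin d → ℝ)) : (Fin d → ℝ) → (Fin d → ℝ) :=
  fun x => η • pullback
    (fun y => ((T⁻¹).1.map (Int.cast : ℤ → ℝ)).mulVec y) X x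

/-! ### Multidimensional continued fractions

Throughout, `d = m + 1` and vectors of `ℝ^d` are written `(v̂, v_d)` with `v̂ ∈ ℝ^m`. -/

/-- `ω = (α, 1)`. -/
def freq {m : ℕ} (α : Fin m → ℝ) : Fin (m + 1) → ℝ := Fin.snoc α 1

/-- `ω` is rationally independent. -/
def RatIndep {d : ℕ} (ω : Fin d → ℝ) : Prop := ∀ k : Fin d → ℤ, k ≠ 0 → dotZ k ω ≠ 0

/-- `M₀`: the identity matrix with its last column replaced by `ω = (α, 1)`. -/
noncomputable def M0mat {m : ℕ} (α : Fin m → ℝ) : Matrix (Fin (m + 1)) (Fin (m + 1)) ℝ :=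
  (1 : Matrix (Fin (m + 1)) (Fin (m + 1)) ℝ).updateCol (Fin.last m) (freq α)

theorem M0mat_det {m : ℕ} (α : Fin m → ℝ) : (M0mat α).det = 1 := by
  have h : (M0mat α).BlockTriangular id := by
    intro i j hij
    have hij' : j < i := hij
    have hj : j ≠ Fin.last m := fun h => absurd (Fin.le_last i) (by rw [← h]; exact not_le.mpr hij')
    rw [M0mat, Matrix.updateCol_ne hj, Matrix.one_apply_ne (ne_of_gt hij')]
  rw [Matrix.det_of_isUpperTriangular h]
  apply Finset.prod_eq_one
  intro i _
  by_cases hi : i = Fin.last m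
  · subst hi
    simp [M0mat, freq]
  · rw [M0mat, Matrix.updateCol_ne hi, Matrix.one_apply_eq]

/-- `M₀ ∈ SL(d, ℝ)`. -/
noncomputable def M0 {m : ℕ} (α : Fin m → ℝ) : Matrix.SpecialLinearGroup (Fin (m + 1)) ℝ :=
  ⟨M0mat α, M0mat_det α⟩

/-- The diagonal of `E^t`: `(e^{-t}, …, e^{-t}, e^{(d-1)t})`. -/
noncomputable def flowDiag (m : ℕ) (t : ℝ) : Fin (m + 1) → ℝ :=
  Fin.snoc (fun _ : Fin m => Real.exp (-t)) (Real.exp ((m : ℝ) * t))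

theorem flowDiag_det (m : ℕ) (t : ℝ) : (Matrix.diagonal (flowDiag m t)).det = 1 := by
  rw [Matrix.det_diagonal, Fin.prod_univ_castSucc]
  simp only [flowDiag, Fin.snoc_castSucc, Fin.snoc_last, Finset.prod_const, Finset.card_univ,
    Fintype.card_fin]
  rw [← Real.exp_nat_mul, ← Real.exp_add]
  simp

/-- `E^t = diag(e^{-t}, …, e^{-t}, e^{(d-1)t}) ∈ SL(d, ℝ)`. -/
noncomputable def flowE (m : ℕ) (t : ℝ) : Matrix.SpecialLinearGroup (Fin (m + 1)) ℝ :=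
  ⟨Matrix.diagonal (flowDiag m t), flowDiag_det m t⟩

/-- The inclusion `SL(d, ℤ) → SL(d, ℝ)`. -/
noncomputable def toReal {d : ℕ} (P : Matrix.SpecialLinearGroup (Fin d) ℤ) :
    Matrix.SpecialLinearGroup (Fin d) ℝ :=
  Matrix.SpecialLinearGroup.map (Int.castRingHom ℝ) P

/-- `𝓕 ⊆ SL(d, ℝ)` is a fundamental domain for the action of `SL(d, ℤ)` by left
multiplication: its translates cover, and their interiors do not overlap. -/
structure IsFundDomain {d : ℕ} (F : Set (Matrix.SpecialLinearGroup (Fin d) ℝ)) : Prop where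
  covers : ∀ M, ∃ P : Matrix.SpecialLinearGroup (Fin d) ℤ, toReal P * M ∈ F
  disjoint : ∀ P : Matrix.SpecialLinearGroup (Fin d) ℤ, P ≠ 1 →
    ∀ M ∈ interior F, toReal P * M ∉ interior F

/-- The data of a renormalization scheme in dimension `d = m + 1`: the vector `α` with
`ω = (α, 1)`, the times `t_n`, the matrices `P_n`, the Gevrey exponent `s`, the width `ρ`, and the
chosen constants `ν`, `δ` and sequences `σ_n`, `θ_n`. -/
structure Scheme (m : ℕ) where
  α : Fin m → ℝ
  t : ℕ → ℝ
  P : ℕ → Matrix.SpecialLinearGroup (Fin (m + 1)) ℤ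
  s : ℝ
  ρ : ℝ
  ν : ℝ
  δ : ℝ
  σ : ℕ → ℝ
  θ : ℕ → ℝ

namespace Scheme

variable {m : ℕ} (S : Scheme m)

/-- `M_n = P_n M₀ E^{t_n}`. -/
noncomputable def M (n : ℕ) : Matrix.SpecialLinearGroup (Fin (m + 1)) ℝ :=
  toReal (S.P n) * M0 S.α * flowE m (S.t n)

/-- The times `t_n` and the matrices `P_n` form a multidimensional continued fraction expansion of
`ω = (α, 1)` with respect to the fundamental domain `F`. -/
structure IsMCF (F : Set (Matrix.SpecialLinearGroup (Fin (m + 1)) ℝ)) : Prop where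
  t_zero : S.t 0 = 0
  t_strictMono : StrictMono S.t
  t_unbounded : Filter.Tendsto S.t Filter.atTop Filter.atTop
  P_zero : S.P 0 = 1
  mem : ∀ n, 1 ≤ n → S.M n ∈ F

/-- `ω_n = M_n e_d`, the last column of `M_n`. -/
noncomputable def omega (n : ℕ) : Fin (m + 1) → ℝ := fun i => (S.M n).1 i (Fin.last m)

/-- `λ_n = e^{(d-1) t_n}`. -/
noncomputable def lam (n : ℕ) : ℝ := Real.exp ((m : ℝ) * S.t n)

/-- `η_n = λ_n / λ_{n-1}`, for `n ≥ 1`. -/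
noncomputable def eta (n : ℕ) : ℝ := S.lam n / S.lam (n - 1)

/-- `T_n = P_n P_{n-1}⁻¹`, for `n ≥ 1`. -/
noncomputable def T (n : ℕ) : Matrix.SpecialLinearGroup (Fin (m + 1)) ℤ :=
  S.P n * (S.P (n - 1))⁻¹

/-- `A_n = sup { |T_n^{-⊤} k| / |k| : k ∈ I^+_{n-1} ∖ {0} }`, for `n ≥ 1`. -/
noncomputable def A (n : ℕ) : ℝ :=
  sSup ((fun k => l1Z ((S.T n)⁻¹.1.transpose.mulVec k) / l1Z k) ''
    {k | k ∈ resModes (S.σ (n - 1)) (S.omega (n - 1)) ∧ k ≠ 0})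

/-- The constant `β`. -/
noncomputable def b : ℝ := beta (m + 1) S.s

/-- `ε_n = ε(σ_n, ν, |ω_n|, s, d)`. -/
noncomputable def eps (n : ℕ) : ℝ := epsRadius (m + 1) S.s S.ν (S.σ n) (l1 (S.omega n))

/-- `φ_n = max {7 (d+1) |η_n| |T_n| (1 + s^s/δ^s) ε_{n-1} / (ε_n θ_n), 1}`, for `n ≥ 1`. -/
noncomputable def phi (n : ℕ) : ℝ :=
  max (7 * ((m + 1 : ℝ) + 1) * |S.eta n| * matNorm (S.T n).1 *
    (1 + S.s ^ S.s / S.δ ^ S.s) * (S.eps (n - 1) / (S.eps n * S.θ n))) 1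

/-- The widths: `ρ_0 = ρ` and
`ρ_n = (ρ_{n-1} - ν (1 + β + β²)) / (β² A_n^{1/s}) - δ - log φ_n`. -/
noncomputable def rho : ℕ → ℝ
  | 0 => S.ρ
  | n + 1 => (rho n - S.ν * (1 + S.b + S.b ^ 2)) / (S.b ^ 2 * S.A (n + 1) ^ (1 / S.s)) -
      S.δ - Real.log (S.phi (n + 1))

/-- `𝓑_n = ∑_{i=1}^n β^{2i} A_1^{1/s} ⋯ A_i^{1/s} (δ + ν(1+β+β²)/(β² A_i^{1/s}) + log φ_i)`. -/
noncomputable def B (n : ℕ) : ℝ :=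
  ∑ i ∈ Finset.Icc 1 n, S.b ^ (2 * i) * (∏ j ∈ Finset.Icc 1 i, S.A j ^ (1 / S.s)) *
    (S.δ + S.ν * (1 + S.b + S.b ^ 2) / (S.b ^ 2 * S.A i ^ (1 / S.s)) + Real.log (S.phi i))

/-- The renormalization operator `𝓡_n = 𝓣_n ∘ 𝓤_n`, for `n ≥ 1`. -/
noncomputable def R (n : ℕ) (X : (Fin (m + 1) → ℝ) → (Fin (m + 1) → ℝ)) :
    (Fin (m + 1) → ℝ) → (Fin (m + 1) → ℝ) :=
  opT (S.eta n) (S.T n)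
    (opU S.s (S.rho (n - 1)) S.ν (S.σ (n - 1)) (S.omega (n - 1)) X)

/-- `X` belongs to the domain `𝓥_{ε_{n-1}} ⊆ 𝓕'_{ρ_{n-1}}` of `𝓡_n` (for `n ≥ 1`), and
`𝓡_n(X)` is actually defined: the width `ρ_{n-1}` is large enough with respect to `ν`, and
the change of coordinates eliminating the far from resonance modes of `X` exists. -/
def InDomain (n : ℕ) (X : (Fin (m + 1) → ℝ) → (Fin (m + 1) → ℝ)) : Prop :=
  S.ν < S.rho (n - 1) / (1 + S.b + S.b ^ 2) ∧
  X ∈ ballV S.s (S.rho (n - 1)) (S.eps (n - 1)) (S.omega (n - 1)) ∧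
  ∃ u, Eliminates S.s (S.rho (n - 1)) S.ν (S.σ (n - 1)) (S.omega (n - 1)) X u

/-- The renormalized vector fields: `X_0 = X` and `X_n = 𝓡_n(X_{n-1})`. -/
noncomputable def renorm (X : (Fin (m + 1) → ℝ) → (Fin (m + 1) → ℝ)) :
    ℕ → (Fin (m + 1) → ℝ) → (Fin (m + 1) → ℝ)
  | 0 => X
  | n + 1 => S.R (n + 1) (renorm X n)

/-- `X` is infinitely renormalizable: it is in the domain of `𝓡_n ∘ ⋯ ∘ 𝓡_1` for all `n ≥ 1`. -/
def InfinitelyRenormalizable (X : (Fin (m + 1) → ℝ) → (Fin (m + 1) → ℝ)) : Prop :=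
  ∀ n, 1 ≤ n → S.InDomain n (S.renorm X (n - 1))

end Scheme

end GevreyRenorm

/-! Write X = ω + f. Three estimates, iterated along an induction that also carries the rotation
vector, give the theorem.

Rotation. If Rot X = ω, no component of f can stay above a positive or below a negative constant,
since every orbit would drift away from ω. Hence |f_0| ≤ ∑_{k≠0} |f_k| (`HasRot.coefNorm_zero_le`):
the constant mode, which no change of coordinates contracts, is slaved to the others. As |k| ≥ 1 on
the latter, it is at most e^{-ν}‖f‖'. Rotation vectors are unchanged by id + u with u bounded and Du
small, and are mapped linearly by T and by the change of time (`HasRot.pullback_id_add`,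
`HasRot.opT`), so the argument is available at every step.

Elimination. With (id + u)^*X = ω + z one needs f∘(id + u) = z + Du·ω + Du·z. If z is resonant and u
is far from resonance, g = z + Du·ω determines both: z is the resonant part of g, and u is the far
part divided by i k·ω, where |k·ω| > σ|k|. So u comes from a fixed point of g ↦ f∘(id + u(g)) −
Du(g)·z(g), a contraction on a ball of radius 4e^{-ν}‖f‖' (`SmallField.exists_fixedPoint`). The crux
is the composition: the norm of e^{ik·u} must grow like e^{c|k|^{1/s}}, while submultiplicativity
only gives e^{c|k|}. For real h = k·u, the function v = e^{ih} has coefficients bounded by 1, and ∂v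
= i(∂h)v gives |l||v_l| ≤ ∑_n |n||h_n||v_{l-n}|. A maximum argument at the small width ν, then a
differential inequality in the width, yield C_ν e^{(s+1/2)K^{1/s}}, with K a bound for
∑|n||h_n|e^{r|n|^{1/s}} at the width r of the norm (`norm_exp_real_le`). The radius ε is so small
that the passage from ρ to ρ' pays for this (`StepParams.exponent_le`).

Rescaling. On resonant modes T^{-⊤} stretches indices by at most A_n, so the width is divided by
A_n^{1/s}. Giving up δ pays for the derivative in the primed norm, and giving up log φ_n gains 1/φ_n
on nonzero modes; the constant mode follows by the rotation argument (`linearChange_bound`). The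
choice of φ_n makes the result smaller than ε_n θ_n.

Widths. Multiplied by β^{2n}A_1^{1/s}⋯A_n^{1/s}, the recursion for ρ_n telescopes to ρ − 𝓑_n
(`prod_mul_rho`). Since 𝓑_n increases to a limit below ρ, all ρ_n are positive, and positivity of
ρ_{n+1} is what the elimination at step n requires of ρ_n. -/

namespace GevreyRenorm

/-! ### Fourier series of functions on the torus -/

open MeasureTheory
open scoped Pointwise

/-- The character `e^{i k·x}`. -/
noncomputable def chi {d : ℕ} (k : Fin d → ℤ) (x : Fin d → ℝ) : ℂ :=
  Complex.exp (Complex.I * (dotZ k x : ℂ))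

/-- The Fourier coefficient of a scalar function. -/
noncomputable def fc {d : ℕ} (f : (Fin d → ℝ) → ℂ) (k : Fin d → ℤ) : ℂ :=
  ((2 * Real.pi : ℝ) ^ d : ℂ)⁻¹ *
    ∫ x in Set.Icc (0 : Fin d → ℝ) (fun _ => 2 * Real.pi),
      f x * Complex.exp (-Complex.I * (dotZ k x : ℂ))

theorem fourierCoef_eq_fc {d : ℕ} (f : (Fin d → ℝ) → (Fin d → ℝ)) (k : Fin d → ℤ) (i : Fin d) :
    fourierCoef f k i = fc (fun x => (f x i : ℂ)) k := rfl

variable {d : ℕ}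

theorem dotZ_add_left (k l : Fin d → ℤ) (x : Fin d → ℝ) :
    dotZ (k + l) x = dotZ k x + dotZ l x := by
  simp [dotZ, add_mul, Finset.sum_add_distrib]

theorem dotZ_neg_left (k : Fin d → ℤ) (x : Fin d → ℝ) : dotZ (-k) x = -dotZ k x := by
  simp [dotZ]

theorem dotZ_add_right (k : Fin d → ℤ) (x y : Fin d → ℝ) :
    dotZ k (x + y) = dotZ k x + dotZ k y := by
  simp [dotZ, mul_add, Finset.sum_add_distrib]

@[simp] theorem dotZ_zero_left (x : Fin d → ℝ) : dotZ 0 x = 0 := by simp [dotZ]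

@[simp] theorem chi_zero (x : Fin d → ℝ) : chi 0 x = 1 := by simp [chi]

theorem chi_add (k l : Fin d → ℤ) (x : Fin d → ℝ) : chi (k + l) x = chi k x * chi l x := by
  rw [chi, chi, chi, ← Complex.exp_add, dotZ_add_left]
  push_cast
  ring_nf

theorem chi_add_right (k : Fin d → ℤ) (x y : Fin d → ℝ) :
    chi k (x + y) = chi k x * chi k y := by
  rw [chi, chi, chi, ← Complex.exp_add, dotZ_add_right]
  push_cast
  ring_nf

@[simp] theorem norm_chi (k : Fin d → ℤ) (x : Fin d → ℝ) : ‖chi k x‖ = 1 := by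
  rw [chi, mul_comm, Complex.norm_exp_ofReal_mul_I]

theorem chi_neg_left (k : Fin d → ℤ) (x : Fin d → ℝ) :
    chi (-k) x = (starRingEnd ℂ) (chi k x) := by
  rw [chi, chi, ← Complex.exp_conj, dotZ_neg_left]
  simp

theorem exp_neg_eq_chi (k : Fin d → ℤ) (x : Fin d → ℝ) :
    Complex.exp (-Complex.I * (dotZ k x : ℂ)) = chi (-k) x := by
  rw [chi, dotZ_neg_left]; push_cast; ring_nf

theorem contDiff_dotZ (k : Fin d → ℤ) {n : WithTop ℕ∞} : ContDiff ℝ n (dotZ k) := by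
  unfold dotZ; fun_prop

theorem contDiff_chi (k : Fin d → ℤ) {n : WithTop ℕ∞} : ContDiff ℝ n (chi k) := by
  unfold chi
  exact (contDiff_const.mul (Complex.ofRealCLM.contDiff.comp (contDiff_dotZ k))).cexp

theorem continuous_chi (k : Fin d → ℤ) : Continuous (chi k) :=
  (contDiff_chi k (n := 0)).continuous

/-- `(2πℤ)^d`-periodicity of a function with arbitrary values. -/
def PeriodicFun {E : Type*} (f : (Fin d → ℝ) → E) : Prop :=
  ∀ (x : Fin d → ℝ) (m : Fin d → ℤ), f (fun i => x i + 2 * Real.pi * (m i : ℝ)) = f x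

theorem chi_periodic (k : Fin d → ℤ) : PeriodicFun (chi k) := by
  intro x m
  have h : dotZ k (fun i => x i + 2 * Real.pi * (m i : ℝ))
      = dotZ k x + ((∑ i, k i * m i : ℤ) : ℝ) * (2 * Real.pi) := by
    simp only [dotZ, mul_add, Finset.sum_add_distrib]
    push_cast
    rw [Finset.sum_mul]
    congr 1
    exact Finset.sum_congr rfl fun i _ => by ring
  rw [chi, chi, h]
  push_cast
  rw [mul_add, Complex.exp_add]
  have : Complex.exp (Complex.I * ((∑ i, (k i : ℂ) * (m i : ℂ)) * (2 * Real.pi))) = 1 := by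
    have := Complex.exp_int_mul_two_pi_mul_I (∑ i, k i * m i)
    rw [← this]
    push_cast
    ring_nf
  rw [this, mul_one]

/-- Fourier coefficients on the box are Fourier coefficients on the unit torus. -/
theorem fc_eq_unit (f : (Fin d → ℝ) → ℂ) (k : Fin d → ℤ) :
    fc f k = ∫ y in {y : Fin d → ℝ | ∀ i, y i ∈ Set.Ioc (0 : ℝ) (0 + 1)},
      chi (-k) ((2 * Real.pi) • y) * f ((2 * Real.pi) • y) := by
  have h2 : (0 : ℝ) < 2 * Real.pi := by positivity
  have hset : {y : Fin d → ℝ | ∀ i, y i ∈ Set.Ioc (0 : ℝ) (0 + 1)}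
      = Set.pi Set.univ fun i : Fin d => Set.Ioc ((0 : Fin d → ℝ) i) ((1 : Fin d → ℝ) i) := by
    ext y; simp
  have hae : (Set.pi Set.univ fun i : Fin d => Set.Ioc ((0 : Fin d → ℝ) i) ((1 : Fin d → ℝ) i))
      =ᵐ[volume] Set.Icc (0 : Fin d → ℝ) 1 :=
    Measure.univ_pi_Ioc_ae_eq_Icc (μ := fun _ : Fin d => (volume : Measure ℝ))
  rw [hset, setIntegral_congr_set hae,
    Measure.setIntegral_comp_smul_of_pos (μ := volume)
      (fun x => chi (-k) x * f x) (Set.Icc (0 : Fin d → ℝ) 1) h2]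
  have himg : (2 * Real.pi) • Set.Icc (0 : Fin d → ℝ) 1
      = Set.Icc (0 : Fin d → ℝ) (fun _ => 2 * Real.pi) := by
    ext x
    rw [Set.mem_smul_set_iff_inv_smul_mem₀ h2.ne']
    simp only [Set.mem_Icc, Pi.le_def, Pi.smul_apply, Pi.zero_apply, Pi.one_apply, smul_eq_mul]
    refine and_congr (forall_congr' fun i => ?_) (forall_congr' fun i => ?_)
    · rw [mul_nonneg_iff_of_pos_left (by positivity)]
    · rw [inv_mul_le_iff₀ h2, mul_one]
  rw [himg, fc, Module.finrank_fin_fun]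
  simp only [exp_neg_eq_chi, mul_comm (f _)]
  rw [Complex.real_smul]
  push_cast
  rfl

theorem chi_two_pi_smul (k : Fin d → ℤ) (y : Fin d → ℝ) :
    chi k ((2 * Real.pi) • y) = UnitAddTorus.mFourier k (fun i => ((y i : ℝ) : UnitAddCircle)) := by
  simp only [UnitAddTorus.mFourier, ContinuousMap.coe_mk, fourier_coe_apply, chi, dotZ]
  rw [← Complex.exp_sum]
  congr 1
  push_cast
  rw [Finset.mul_sum]
  refine Finset.sum_congr rfl fun i _ => ?_
  simp
  ring

/-- The function on the unit torus induced by a continuous periodic function. -/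
theorem exists_torus_fun {f : (Fin d → ℝ) → ℂ} (hf : Continuous f) (hp : PeriodicFun f) :
    ∃ F : C(UnitAddTorus (Fin d), ℂ),
      ∀ y : Fin d → ℝ, F (fun i => ((y i : ℝ) : UnitAddCircle)) = f ((2 * Real.pi) • y) := by
  let q : C(Fin d → ℝ, UnitAddTorus (Fin d)) :=
    ⟨fun y i => ((y i : ℝ) : UnitAddCircle), by fun_prop⟩
  have hq : Topology.IsQuotientMap q :=
    (IsOpenQuotientMap.piMap (fun _ : Fin d => QuotientAddGroup.isOpenQuotientMap_mk
      (N := AddSubgroup.zmultiples (1 : ℝ)))).isQuotientMap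
  let g : C(Fin d → ℝ, ℂ) := ⟨fun y => f ((2 * Real.pi) • y), by fun_prop⟩
  have hfac : Function.FactorsThrough g q := by
    intro a b hab
    have h : ∀ i, ∃ n : ℤ, a i = b i + n := by
      intro i
      have hi : ((a i : ℝ) : UnitAddCircle) = (b i : ℝ) := congrFun hab i
      rw [← sub_eq_zero, ← AddCircle.coe_sub, AddCircle.coe_eq_zero_iff] at hi
      obtain ⟨n, hn⟩ := hi
      refine ⟨n, ?_⟩
      rw [zsmul_eq_mul, mul_one] at hn
      linarith
    choose n hn using h
    have := hp ((2 * Real.pi) • b) n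
    change f _ = f _
    rw [← this]
    congr 1
    ext i
    simp [hn i, mul_add]
  exact ⟨hq.lift g hfac, fun y => ContinuousMap.congr_fun (hq.lift_comp g hfac) y⟩

theorem fc_eq_mFourierCoeff {f : (Fin d → ℝ) → ℂ} {F : C(UnitAddTorus (Fin d), ℂ)}
    (hF : ∀ y : Fin d → ℝ, F (fun i => ((y i : ℝ) : UnitAddCircle)) = f ((2 * Real.pi) • y))
    (k : Fin d → ℤ) : fc f k = UnitAddTorus.mFourierCoeff F k := by
  rw [fc_eq_unit, UnitAddTorus.mFourierCoeff_eq_integral F k 0]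
  simp only [chi_two_pi_smul, hF, smul_eq_mul, Pi.zero_apply]

/-- A continuous periodic function with summable Fourier coefficients is the sum of its Fourier
series. -/
theorem hasSum_fourier {f : (Fin d → ℝ) → ℂ} (hf : Continuous f) (hp : PeriodicFun f)
    (hs : Summable (fc f)) (x : Fin d → ℝ) : HasSum (fun k => fc f k * chi k x) (f x) := by
  obtain ⟨F, hF⟩ := exists_torus_fun hf hp
  have hs' : Summable (UnitAddTorus.mFourierCoeff F) := by
    convert hs using 1
    exact funext fun k => (fc_eq_mFourierCoeff hF k).symm
  have := UnitAddTorus.hasSum_mFourier_series_apply_of_summable hs'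
    (fun i => (((2 * Real.pi)⁻¹ * x i : ℝ) : UnitAddCircle))
  have hx : (2 * Real.pi) • (fun i => (2 * Real.pi)⁻¹ * x i) = x := by
    ext i
    rw [Pi.smul_apply, smul_eq_mul, ← mul_assoc, mul_inv_cancel₀ (by positivity), one_mul]
  simp only [smul_eq_mul] at this
  rw [hF (fun i => (2 * Real.pi)⁻¹ * x i), hx] at this
  convert this using 2 with k
  rw [fc_eq_mFourierCoeff hF, ← chi_two_pi_smul k (fun i => (2 * Real.pi)⁻¹ * x i), hx]

theorem fc_chi (m k : Fin d → ℤ) : fc (chi m) k = if m = k then 1 else 0 := by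
  have hF : ∀ y : Fin d → ℝ, UnitAddTorus.mFourier m (fun i => ((y i : ℝ) : UnitAddCircle))
      = chi m ((2 * Real.pi) • y) := fun y => (chi_two_pi_smul m y).symm
  rw [fc_eq_mFourierCoeff hF k]
  have := orthonormal_iff_ite.mp (UnitAddTorus.orthonormal_mFourier (d := Fin d)) k m
  rw [← UnitAddTorus.mFourierCoeff_toLp, ← UnitAddTorus.mFourierBasis_repr,
    HilbertBasis.repr_apply_apply, UnitAddTorus.coe_mFourierBasis]
  simpa only [eq_comm (a := m)] using this

/-- Absolute convergence allows integration term by term against a character. This uniqueness makes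
evaluation of the algebras below injective, and it computes coefficients after linear changes of
coordinates. -/
theorem fc_tsum {c : (Fin d → ℤ) → ℂ} (hc : Summable fun k => ‖c k‖) (l : Fin d → ℤ) :
    fc (fun x => ∑' k, c k * chi k x) l = c l := by
  set μ := volume.restrict (Set.Icc (0 : Fin d → ℝ) (fun _ => 2 * Real.pi)) with hμ
  have hfin : IsFiniteMeasure μ := ⟨by
    rw [hμ, Measure.restrict_apply_univ]; exact isCompact_Icc.measure_lt_top⟩
  have hn : ∀ (k : Fin d → ℤ) (x : Fin d → ℝ), ‖c k * chi k x * chi (-l) x‖ = ‖c k‖ := by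
    intro k x; simp
  have hint : ∀ k, Integrable (fun x => c k * chi k x * chi (-l) x) μ := fun k =>
    Integrable.of_bound (((continuous_const.mul (continuous_chi k)).mul
      (continuous_chi (-l))).aestronglyMeasurable) ‖c k‖ (Filter.Eventually.of_forall fun x =>
        (hn k x).le)
  have key := hasSum_integral_of_summable_integral_norm hint (by
    simp only [hn, integral_const, smul_eq_mul]
    exact hc.mul_left _)
  have h1 : fc (fun x => ∑' k, c k * chi k x) l
      = ((2 * Real.pi : ℝ) ^ d : ℂ)⁻¹ * ∫ x, ∑' k, c k * chi k x * chi (-l) x ∂μ := by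
    simp only [fc, exp_neg_eq_chi, tsum_mul_right, hμ]
  rw [h1, ← (key.mul_left (((2 * Real.pi : ℝ) ^ d : ℂ)⁻¹)).tsum_eq]
  have h2 : ∀ k, ((2 * Real.pi : ℝ) ^ d : ℂ)⁻¹ * ∫ x, c k * chi k x * chi (-l) x ∂μ
      = c k * fc (chi k) l := by
    intro k
    simp only [fc, exp_neg_eq_chi, mul_assoc]
    rw [integral_const_mul]
    ring
  simp only [h2, fc_chi]
  rw [tsum_eq_single l (fun k hk => by simp [hk])]
  simp

theorem fc_congr {f g : (Fin d → ℝ) → ℂ} (h : ∀ x, f x = g x) (k : Fin d → ℤ) :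
    fc f k = fc g k := by rw [funext h]

/-- Applied to e^{ig} with g real: a bound on the coefficients that does not depend on the size of
g. -/
theorem norm_fc_le_one {f : (Fin d → ℝ) → ℂ} (hf : ∀ x, ‖f x‖ ≤ 1) (k : Fin d → ℤ) :
    ‖fc f k‖ ≤ 1 := by
  have hp : (0 : ℝ) < (2 * Real.pi) ^ d := by positivity
  have hvol : volume.real (Set.Icc (0 : Fin d → ℝ) (fun _ => 2 * Real.pi)) = (2 * Real.pi) ^ d := by
    rw [Measure.real, Real.volume_Icc_pi_toReal (fun _ => by simp; positivity)]
    simp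
  have h := norm_setIntegral_le_of_norm_le_const (μ := volume)
    (s := Set.Icc (0 : Fin d → ℝ) (fun _ => 2 * Real.pi)) (C := 1)
    (f := fun x => f x * Complex.exp (-Complex.I * (dotZ k x : ℂ)))
    isCompact_Icc.measure_lt_top (fun x _ => by
      rw [norm_mul, exp_neg_eq_chi, norm_chi, mul_one]; exact hf x)
  rw [hvol, one_mul] at h
  rw [fc, norm_mul, norm_inv, ← Complex.ofReal_pow, Complex.norm_real, Real.norm_of_nonneg hp.le,
    inv_mul_le_iff₀ hp, mul_one]
  exact h

theorem fc_ofReal_neg (f : (Fin d → ℝ) → ℝ) (k : Fin d → ℤ) :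
    fc (fun x => (f x : ℂ)) (-k) = (starRingEnd ℂ) (fc (fun x => (f x : ℂ)) k) := by
  simp only [fc, exp_neg_eq_chi, neg_neg, map_mul, map_inv₀, map_pow, Complex.conj_ofReal]
  rw [← integral_conj]
  simp only [map_mul, Complex.conj_ofReal, chi_neg_left]
  simp

end GevreyRenorm

/-! ### Weighted Wiener algebras -/

namespace GevreyRenorm

/-- A submultiplicative weight on `ℤ^d`. -/
structure Weight (d : ℕ) where
  toFun : (Fin d → ℤ) → ℝ
  one_le : ∀ k, 1 ≤ toFun k
  map_zero : toFun 0 = 1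
  add_le : ∀ k l, toFun (k + l) ≤ toFun k * toFun l

instance {d : ℕ} : CoeFun (Weight d) fun _ => (Fin d → ℤ) → ℝ := ⟨Weight.toFun⟩

/-- The Banach space of Fourier series `∑ c_k e^{ik·x}` with `∑ |c_k| w_k < ∞`; its elements are
stored as the sequences `c_k w_k`. -/
def WAlg {d : ℕ} (_w : Weight d) : Type := lp (fun _ : Fin d → ℤ => ℂ) 1

namespace WAlg

variable {d : ℕ} {w : Weight d}

noncomputable instance : NormedAddCommGroup (WAlg w) :=
  inferInstanceAs (NormedAddCommGroup (lp (fun _ : Fin d → ℤ => ℂ) 1))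

noncomputable instance : NormedSpace ℂ (WAlg w) :=
  inferInstanceAs (NormedSpace ℂ (lp (fun _ : Fin d → ℤ => ℂ) 1))

instance : CompleteSpace (WAlg w) :=
  inferInstanceAs (CompleteSpace (lp (fun _ : Fin d → ℤ => ℂ) 1))

theorem weight_pos (w : Weight d) (k : Fin d → ℤ) : 0 < w k := one_pos.trans_le (w.one_le k)

/-- The `k`-th Fourier coefficient. -/
noncomputable def coef (a : WAlg w) (k : Fin d → ℤ) : ℂ :=
  (show lp (fun _ : Fin d → ℤ => ℂ) 1 from a) k / (w k : ℂ)

theorem norm_coef_mul (a : WAlg w) (k : Fin d → ℤ) :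
    ‖coef a k‖ * w k = ‖(show lp (fun _ : Fin d → ℤ => ℂ) 1 from a) k‖ := by
  have := weight_pos w k
  rw [coef, norm_div, Complex.norm_real, Real.norm_of_nonneg this.le, div_mul_cancel₀ _ this.ne']

theorem hasSum_norm (a : WAlg w) : HasSum (fun k => ‖coef a k‖ * w k) ‖a‖ := by
  have h := lp.hasSum_norm (p := 1) (by simp) (show lp (fun _ : Fin d → ℤ => ℂ) 1 from a)
  simp only [ENNReal.toReal_one, Real.rpow_one] at h
  simp only [norm_coef_mul]
  exact h

theorem summable_norm (a : WAlg w) : Summable fun k => ‖coef a k‖ * w k := (hasSum_norm a).summable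

theorem norm_eq (a : WAlg w) : ‖a‖ = ∑' k, ‖coef a k‖ * w k := (hasSum_norm a).tsum_eq.symm

/-- The series with prescribed Fourier coefficients. -/
noncomputable def mk (c : (Fin d → ℤ) → ℂ) (hc : Summable fun k => ‖c k‖ * w k) : WAlg w :=
  (⟨fun k => c k * (w k : ℂ), memℓp_gen (by
    simp only [ENNReal.toReal_one, Real.rpow_one, norm_mul, Complex.norm_real]
    refine hc.congr fun k => ?_
    rw [Real.norm_of_nonneg (weight_pos w k).le])⟩ : lp (fun _ : Fin d → ℤ => ℂ) 1)

@[simp] theorem coef_mk (c : (Fin d → ℤ) → ℂ) (hc : Summable fun k => ‖c k‖ * w k)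
    (k : Fin d → ℤ) : coef (mk c hc) k = c k :=
  mul_div_cancel_right₀ _ (Complex.ofReal_ne_zero.mpr (weight_pos w k).ne')

theorem ext {a b : WAlg w} (h : ∀ k, coef a k = coef b k) : a = b := by
  refine lp.ext (funext fun k => ?_)
  exact (div_left_inj' (Complex.ofReal_ne_zero.mpr (weight_pos w k).ne')).mp (h k)

@[simp] theorem coef_zero (k : Fin d → ℤ) : coef (0 : WAlg w) k = 0 := zero_div _

@[simp] theorem coef_add (a b : WAlg w) (k : Fin d → ℤ) :
    coef (a + b) k = coef a k + coef b k := add_div _ _ _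

@[simp] theorem coef_sub (a b : WAlg w) (k : Fin d → ℤ) :
    coef (a - b) k = coef a k - coef b k := sub_div _ _ _

@[simp] theorem coef_smul (c : ℂ) (a : WAlg w) (k : Fin d → ℤ) :
    coef (c • a) k = c * coef a k := mul_div_assoc _ _ _

theorem norm_coef_mul_le (a : WAlg w) (k : Fin d → ℤ) : ‖coef a k‖ * w k ≤ ‖a‖ :=
  le_hasSum (hasSum_norm a) k fun j _ => mul_nonneg (norm_nonneg _) (weight_pos w j).le

theorem norm_coef_le (a : WAlg w) (k : Fin d → ℤ) : ‖coef a k‖ ≤ ‖a‖ :=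
  (le_mul_of_one_le_right (norm_nonneg _) (w.one_le k)).trans (norm_coef_mul_le a k)

theorem summable_coef (a : WAlg w) : Summable fun k => ‖coef a k‖ :=
  (summable_norm a).of_nonneg_of_le (fun _ => norm_nonneg _)
    fun k => le_mul_of_one_le_right (norm_nonneg _) (w.one_le k)

theorem tsum_coef_le (a : WAlg w) : ∑' k, ‖coef a k‖ ≤ ‖a‖ := by
  rw [norm_eq]
  exact (summable_coef a).tsum_le_tsum
    (fun k => le_mul_of_one_le_right (norm_nonneg _) (w.one_le k)) (summable_norm a)

/-- The `k`-th Fourier coefficient as a continuous linear functional. -/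
noncomputable def coefCLM (w : Weight d) (k : Fin d → ℤ) : WAlg w →L[ℂ] ℂ :=
  LinearMap.mkContinuous
    { toFun := fun a => coef a k
      map_add' := fun a b => coef_add a b k
      map_smul' := fun c a => coef_smul c a k } 1
    fun a => by simpa using norm_coef_le a k

@[simp] theorem coefCLM_apply (k : Fin d → ℤ) (a : WAlg w) : coefCLM w k a = coef a k := rfl

/-- The value of the Fourier series at a point. -/
noncomputable def ev (a : WAlg w) (x : Fin d → ℝ) : ℂ := ∑' k, coef a k * chi k x

theorem summable_ev (a : WAlg w) (x : Fin d → ℝ) : Summable fun k => ‖coef a k * chi k x‖ := by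
  simpa using summable_coef a

theorem hasSum_ev (a : WAlg w) (x : Fin d → ℝ) : HasSum (fun k => coef a k * chi k x) (ev a x) :=
  (summable_ev a x).of_norm.hasSum

theorem fc_ev (a : WAlg w) (k : Fin d → ℤ) : fc (ev a) k = coef a k :=
  fc_tsum (summable_coef a) k

theorem ev_injective {a b : WAlg w} (h : ∀ x, ev a x = ev b x) : a = b :=
  ext fun k => by rw [← fc_ev, ← fc_ev, fc_congr h]

theorem ev_congr_coef {w' : Weight d} {a : WAlg w} {b : WAlg w'} (h : ∀ k, coef a k = coef b k)
    (x : Fin d → ℝ) : ev a x = ev b x := by simp only [ev, h]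

theorem norm_ev_le (a : WAlg w) (x : Fin d → ℝ) : ‖ev a x‖ ≤ ‖a‖ := by
  refine (norm_tsum_le_tsum_norm (summable_ev a x)).trans ?_
  simpa using tsum_coef_le a

@[simp] theorem ev_zero (x : Fin d → ℝ) : ev (0 : WAlg w) x = 0 := by simp [ev]

theorem ev_add (a b : WAlg w) (x : Fin d → ℝ) : ev (a + b) x = ev a x + ev b x := by
  refine HasSum.tsum_eq ?_
  simpa [add_mul] using (hasSum_ev a x).add (hasSum_ev b x)

theorem ev_smul (c : ℂ) (a : WAlg w) (x : Fin d → ℝ) : ev (c • a) x = c * ev a x := by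
  simp only [ev, coef_smul, mul_assoc, tsum_mul_left]

/-- The shear `(l, n) ↦ (n, l - n)`. -/
def shear (d : ℕ) : (Fin d → ℤ) × (Fin d → ℤ) ≃ (Fin d → ℤ) × (Fin d → ℤ) where
  toFun q := (q.2, q.1 - q.2)
  invFun q := (q.1 + q.2, q.1)
  left_inv q := by simp
  right_inv q := by simp

/-- A convolution is the product double series read along a shear of the index lattice, so its sums
reduce to the product of two norms. -/
theorem summable_conv_norm (a b : WAlg w) :
    Summable fun q : (Fin d → ℤ) × (Fin d → ℤ) =>
      (‖coef a q.2‖ * w q.2) * (‖coef b (q.1 - q.2)‖ * w (q.1 - q.2)) :=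
  ((shear d).summable_iff (f := fun q : (Fin d → ℤ) × (Fin d → ℤ) =>
    (‖coef a q.1‖ * w q.1) * (‖coef b q.2‖ * w q.2))).mpr
    ((summable_norm a).mul_of_nonneg (summable_norm b)
      (fun k => mul_nonneg (norm_nonneg _) (weight_pos w k).le)
      (fun k => mul_nonneg (norm_nonneg _) (weight_pos w k).le))

theorem tsum_conv_norm (a b : WAlg w) :
    ∑' l, ∑' n, (‖coef a n‖ * w n) * (‖coef b (l - n)‖ * w (l - n)) = ‖a‖ * ‖b‖ := by
  have h := summable_conv_norm a b
  have e := (shear d).tsum_eq (fun q : (Fin d → ℤ) × (Fin d → ℤ) =>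
      (‖coef a q.1‖ * w q.1) * (‖coef b q.2‖ * w q.2))
  rw [norm_eq a, norm_eq b, (summable_norm a).tsum_mul_tsum (summable_norm b)]
  · exact (h.tsum_prod).symm.trans e
  exact (summable_norm a).mul_of_nonneg (summable_norm b)
    (fun k => mul_nonneg (norm_nonneg _) (weight_pos w k).le)
    (fun k => mul_nonneg (norm_nonneg _) (weight_pos w k).le)

theorem weight_le_split (w : Weight d) (l n : Fin d → ℤ) : w l ≤ w n * w (l - n) := by
  simpa using w.add_le n (l - n)

theorem summable_conv (a b : WAlg w) (l : Fin d → ℤ) :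
    Summable fun n => ‖coef a n * coef b (l - n)‖ := by
  refine ((summable_conv_norm a b).prod_factor l).of_nonneg_of_le (fun _ => norm_nonneg _)
    fun n => ?_
  rw [norm_mul]
  exact mul_le_mul (le_mul_of_one_le_right (norm_nonneg _) (w.one_le _))
    (le_mul_of_one_le_right (norm_nonneg _) (w.one_le _)) (norm_nonneg _)
    (mul_nonneg (norm_nonneg _) (weight_pos w _).le)

theorem norm_conv_mul_le (a b : WAlg w) (l : Fin d → ℤ) :
    ‖∑' n, coef a n * coef b (l - n)‖ * w l
      ≤ ∑' n, (‖coef a n‖ * w n) * (‖coef b (l - n)‖ * w (l - n)) := by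
  calc ‖∑' n, coef a n * coef b (l - n)‖ * w l
      ≤ (∑' n, ‖coef a n * coef b (l - n)‖) * w l :=
        mul_le_mul_of_nonneg_right (norm_tsum_le_tsum_norm (summable_conv a b l))
          (weight_pos w l).le
    _ = ∑' n, ‖coef a n * coef b (l - n)‖ * w l := by rw [tsum_mul_right]
    _ ≤ _ := by
        refine ((summable_conv a b l).mul_right _).tsum_le_tsum (fun n => ?_)
          ((summable_conv_norm a b).prod_factor l)
        rw [norm_mul]
        calc ‖coef a n‖ * ‖coef b (l - n)‖ * w l
            ≤ ‖coef a n‖ * ‖coef b (l - n)‖ * (w n * w (l - n)) :=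
              mul_le_mul_of_nonneg_left (weight_le_split w l n) (by positivity)
          _ = _ := by ring

theorem summable_conv_coef (a b : WAlg w) :
    Summable fun l => ‖∑' n, coef a n * coef b (l - n)‖ * w l :=
  (summable_conv_norm a b).prod.of_nonneg_of_le
    (fun l => mul_nonneg (norm_nonneg _) (weight_pos w l).le) (norm_conv_mul_le a b)

noncomputable instance : Mul (WAlg w) := ⟨fun a b => mk _ (summable_conv_coef a b)⟩

theorem coef_mul (a b : WAlg w) (l : Fin d → ℤ) :
    coef (a * b) l = ∑' n, coef a n * coef b (l - n) := coef_mk _ _ l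

theorem norm_mul_le' (a b : WAlg w) : ‖a * b‖ ≤ ‖a‖ * ‖b‖ := by
  rw [norm_eq (a * b), ← tsum_conv_norm]
  refine (summable_norm _).tsum_le_tsum (fun l => ?_) (summable_conv_norm a b).prod
  rw [coef_mul]
  exact norm_conv_mul_le a b l

theorem ev_mul (a b : WAlg w) (x : Fin d → ℝ) : ev (a * b) x = ev a x * ev b x := by
  set f : (Fin d → ℤ) → ℂ := fun k => coef a k * chi k x with hf
  set g : (Fin d → ℤ) → ℂ := fun k => coef b k * chi k x with hg
  have hs : Summable fun q : (Fin d → ℤ) × (Fin d → ℤ) => f q.1 * g q.2 :=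
    summable_mul_of_summable_norm (f := f) (g := g) (summable_ev a x) (summable_ev b x)
  have hs' : Summable fun q : (Fin d → ℤ) × (Fin d → ℤ) => f q.2 * g (q.1 - q.2) :=
    ((shear d).summable_iff (f := fun q : (Fin d → ℤ) × (Fin d → ℤ) => f q.1 * g q.2)).mpr hs
  have e := (shear d).tsum_eq (fun q : (Fin d → ℤ) × (Fin d → ℤ) => f q.1 * g q.2)
  have e2 := tsum_mul_tsum_of_summable_norm (f := f) (g := g) (summable_ev a x) (summable_ev b x)
  refine Eq.trans ?_ ((hs'.tsum_prod).symm.trans (e.trans e2.symm))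
  refine tsum_congr fun l => ?_
  rw [coef_mul, ← tsum_mul_right]
  refine tsum_congr fun n => ?_
  change _ = (coef a n * chi n x) * (coef b (l - n) * chi (l - n) x)
  have : chi l x = chi n x * chi (l - n) x := by rw [← chi_add]; simp
  rw [this]; ring

/-- The character `e^{ik·x}` as an element of the algebra. -/
noncomputable def char (w : Weight d) (k : Fin d → ℤ) : WAlg w :=
  mk (Pi.single k 1) (summable_of_ne_finset_zero (s := {k}) fun l hl => by
    simp [Pi.single_eq_of_ne (Finset.notMem_singleton.mp hl)])

theorem coef_char (k l : Fin d → ℤ) : coef (char w k) l = (Pi.single k 1 : (Fin d → ℤ) → ℂ) l :=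
  coef_mk _ _ l

theorem ev_char (k : Fin d → ℤ) (x : Fin d → ℝ) : ev (char w k) x = chi k x := by
  rw [ev, tsum_eq_single k fun l hl => by rw [coef_char, Pi.single_eq_of_ne hl, zero_mul]]
  rw [coef_char, Pi.single_eq_same, one_mul]

theorem norm_char (k : Fin d → ℤ) : ‖char w k‖ = w k := by
  rw [norm_eq, tsum_eq_single k fun l hl => by
    rw [coef_char, Pi.single_eq_of_ne hl, norm_zero, zero_mul]]
  rw [coef_char, Pi.single_eq_same, norm_one, one_mul]

noncomputable instance : One (WAlg w) := ⟨char w 0⟩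

@[simp] theorem ev_one (x : Fin d → ℝ) : ev (1 : WAlg w) x = 1 := by
  rw [show (1 : WAlg w) = char w 0 from rfl, ev_char, chi_zero]

theorem coef_one (l : Fin d → ℤ) :
    coef (1 : WAlg w) l = (Pi.single 0 1 : (Fin d → ℤ) → ℂ) l := coef_char 0 l

/-- Evaluation at points is jointly injective and multiplicative, so the ring axioms are inherited
from ℂ pointwise and no triple convolution has to be rearranged. -/
noncomputable instance : NormedCommRing (WAlg w) :=
  { (inferInstance : NormedAddCommGroup (WAlg w)) with
    mul := (· * ·)
    one := 1
    mul_assoc := fun a b c => ev_injective fun x => by simp only [ev_mul, mul_assoc]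
    mul_comm := fun a b => ev_injective fun x => by simp only [ev_mul, mul_comm]
    one_mul := fun a => ev_injective fun x => by simp only [ev_mul, ev_one, one_mul]
    mul_one := fun a => ev_injective fun x => by simp only [ev_mul, ev_one, mul_one]
    zero_mul := fun a => ev_injective fun x => by simp only [ev_mul, ev_zero, zero_mul]
    mul_zero := fun a => ev_injective fun x => by simp only [ev_mul, ev_zero, mul_zero]
    left_distrib := fun a b c => ev_injective fun x => by simp only [ev_mul, ev_add, mul_add]
    right_distrib := fun a b c => ev_injective fun x => by simp only [ev_mul, ev_add, add_mul]
    norm_mul_le := norm_mul_le' }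

instance : NormOneClass (WAlg w) := ⟨by
  rw [show (1 : WAlg w) = char w 0 from rfl, norm_char, w.map_zero]⟩

noncomputable instance : NormedAlgebra ℂ (WAlg w) :=
  { Algebra.ofModule
      (fun c a b => ev_injective fun x => by simp only [ev_mul, ev_smul, mul_assoc])
      (fun c a b => ev_injective fun x => by simp only [ev_mul, ev_smul]; ring) with
    norm_smul_le := fun c a => norm_smul_le c a }

noncomputable instance : NormedAlgebra ℚ (WAlg w) := NormedAlgebra.restrictScalars ℚ ℂ (WAlg w)

/-- Evaluation at a point as a continuous algebra homomorphism. -/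
noncomputable def evHom (w : Weight d) (x : Fin d → ℝ) : WAlg w →ₐ[ℂ] ℂ :=
  AlgHom.ofLinearMap
    { toFun := fun a => ev a x
      map_add' := fun a b => ev_add a b x
      map_smul' := fun c a => ev_smul c a x } (ev_one x) fun a b => ev_mul a b x

@[simp] theorem evHom_apply (x : Fin d → ℝ) (a : WAlg w) : evHom w x a = ev a x := rfl

theorem continuous_evHom (x : Fin d → ℝ) : Continuous (evHom w x) :=
  AddMonoidHomClass.continuous_of_bound (evHom w x) 1 fun a => by simpa using norm_ev_le a x

theorem ev_sub (a b : WAlg w) (x : Fin d → ℝ) : ev (a - b) x = ev a x - ev b x :=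
  map_sub (evHom w x) a b

theorem ev_sum {ι : Type*} (s : Finset ι) (f : ι → WAlg w) (x : Fin d → ℝ) :
    ev (∑ i ∈ s, f i) x = ∑ i ∈ s, ev (f i) x := map_sum (evHom w x) f s

theorem coef_sum {ι : Type*} (s : Finset ι) (f : ι → WAlg w) (k : Fin d → ℤ) :
    coef (∑ i ∈ s, f i) k = ∑ i ∈ s, coef (f i) k := map_sum (coefCLM w k) f s

theorem ev_exp (a : WAlg w) (x : Fin d → ℝ) :
    ev (NormedSpace.exp a) x = Complex.exp (ev a x) := by
  have := NormedSpace.map_exp (evHom w x) (continuous_evHom x) a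
  rw [evHom_apply, evHom_apply, ← Complex.exp_eq_exp_ℂ] at this
  exact this

theorem continuous_ev (a : WAlg w) : Continuous (ev a) :=
  continuous_tsum (fun k => continuous_const.mul (continuous_chi k)) (summable_coef a)
    fun k x => by simp

theorem ev_periodic (a : WAlg w) : PeriodicFun (ev a) := fun x m => by
  simp only [ev]
  exact tsum_congr fun k => by rw [chi_periodic k x m]

end WAlg

end GevreyRenorm

namespace GevreyRenorm

variable {d : ℕ}

/-! ### The `ℓ¹` norm on `ℤ^d` and Gevrey weights -/

theorem l1Z_nonneg (k : Fin d → ℤ) : 0 ≤ l1Z k := Finset.sum_nonneg fun _ _ => abs_nonneg _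

@[simp] theorem l1Z_zero : l1Z (0 : Fin d → ℤ) = 0 := by simp [l1Z]

@[simp] theorem l1Z_neg (k : Fin d → ℤ) : l1Z (-k) = l1Z k := by simp [l1Z]

theorem l1Z_add_le (k l : Fin d → ℤ) : l1Z (k + l) ≤ l1Z k + l1Z l := by
  rw [l1Z, l1Z, l1Z, ← Finset.sum_add_distrib]
  refine Finset.sum_le_sum fun i _ => ?_
  rw [Pi.add_apply, Int.cast_add]
  exact abs_add_le _ _

theorem abs_le_l1Z (k : Fin d → ℤ) (i : Fin d) : |(k i : ℝ)| ≤ l1Z k :=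
  Finset.single_le_sum (f := fun i => |(k i : ℝ)|) (fun _ _ => abs_nonneg _) (Finset.mem_univ i)

theorem one_le_l1Z {k : Fin d → ℤ} (hk : k ≠ 0) : 1 ≤ l1Z k := by
  obtain ⟨i, hi⟩ := Function.ne_iff.mp hk
  refine le_trans ?_ (abs_le_l1Z k i)
  rw [← Int.cast_abs]
  exact_mod_cast Int.one_le_abs hi

/-- `|k|^{1/s}`. -/
noncomputable def gexp (s : ℝ) (k : Fin d → ℤ) : ℝ := l1Z k ^ (1 / s)

theorem gexp_nonneg (s : ℝ) (k : Fin d → ℤ) : 0 ≤ gexp s k := Real.rpow_nonneg (l1Z_nonneg k) _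

theorem gexp_zero {s : ℝ} (hs : 1 ≤ s) : gexp s (0 : Fin d → ℤ) = 0 := by
  rw [gexp, l1Z_zero, Real.zero_rpow]
  positivity

/-- The lattice gap: lowering the width by τ ≥ 0 gains a factor e^{-τ} on every nonzero mode. All
factors e^{-ν} below come from here. -/
theorem one_le_gexp {s : ℝ} (hs : 1 ≤ s) {k : Fin d → ℤ} (hk : k ≠ 0) : 1 ≤ gexp s k :=
  Real.one_le_rpow (one_le_l1Z hk) (by positivity)

theorem gexp_add_le {s : ℝ} (hs : 1 ≤ s) (k l : Fin d → ℤ) :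
    gexp s (k + l) ≤ gexp s k + gexp s l := by
  have hp : 0 ≤ 1 / s := by positivity
  refine (Real.rpow_le_rpow (l1Z_nonneg _) (l1Z_add_le k l) hp).trans ?_
  exact Real.rpow_add_le_add_rpow (l1Z_nonneg k) (l1Z_nonneg l) hp
    ((div_le_one (by positivity)).mpr hs)

theorem gexp_le_one_add {s : ℝ} (hs : 1 ≤ s) (k : Fin d → ℤ) : gexp s k ≤ l1Z k := by
  by_cases hk : k = 0
  · simp [hk, gexp_zero hs]
  · exact Real.rpow_le_self_of_one_le (one_le_l1Z hk) ((div_le_one (by positivity)).mpr hs)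

/-- The weight `e^{ρ|k|^{1/s}}`. -/
noncomputable def gev (d : ℕ) (s ρ : ℝ) (hs : 1 ≤ s) (hρ : 0 ≤ ρ) : Weight d where
  toFun k := Real.exp (ρ * gexp s k)
  one_le k := Real.one_le_exp (mul_nonneg hρ (gexp_nonneg s k))
  map_zero := by rw [gexp_zero hs]; simp
  add_le k l := by
    rw [← Real.exp_add, ← mul_add]
    exact Real.exp_le_exp.mpr (mul_le_mul_of_nonneg_left (gexp_add_le hs k l) hρ)

theorem gev_apply {s ρ : ℝ} (hs : 1 ≤ s) (hρ : 0 ≤ ρ) (k : Fin d → ℤ) :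
    gev d s ρ hs hρ k = Real.exp (ρ * gexp s k) := rfl

theorem summable_prod_apply {f : ℤ → ℝ} (hf0 : ∀ n, 0 ≤ f n) (hf : Summable f) :
    Summable fun k : Fin d → ℤ => ∏ i, f (k i) := by
  refine summable_of_sum_le (c := ∏ _i : Fin d, ∑' n, f n)
    (fun k => Finset.prod_nonneg fun i _ => hf0 _) fun u => ?_
  classical
  calc ∑ k ∈ u, ∏ i, f (k i)
      ≤ ∑ k ∈ Fintype.piFinset (fun i => u.image fun k => k i), ∏ i, f (k i) := by
        refine Finset.sum_le_sum_of_subset_of_nonneg (fun k hk => ?_)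
          fun k _ _ => Finset.prod_nonneg fun i _ => hf0 _
        rw [Fintype.mem_piFinset]
        exact fun i => Finset.mem_image_of_mem _ hk
    _ = ∏ i, ∑ n ∈ u.image fun k => k i, f n := (Finset.prod_univ_sum _ _).symm
    _ ≤ ∏ _i : Fin d, ∑' n, f n := Finset.prod_le_prod
        (fun i _ => Finset.sum_nonneg fun n _ => hf0 n)
        fun i _ => hf.sum_le_tsum _ fun n _ => hf0 n

theorem summable_exp_neg_abs_rpow {c p : ℝ} (hc : 0 < c) (hp : 0 < p) :
    Summable fun n : ℤ => Real.exp (-c * |(n : ℝ)| ^ p) := by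
  have hnat : Summable fun n : ℕ => Real.exp (-c * (n : ℝ) ^ p) := by
    refine summable_of_isBigO_nat (g := fun n : ℕ => (n : ℝ) ^ (-2 : ℝ))
      (Real.summable_nat_rpow.mpr (by norm_num)) ?_
    -- The exponent -2/p becomes -2 after the substitution x = n^p.
    have h := (isLittleO_exp_neg_mul_rpow_atTop hc (-2 / p)).comp_tendsto
      ((tendsto_rpow_atTop hp).comp tendsto_natCast_atTop_atTop)
    refine h.isBigO.congr_right fun n => ?_
    simp only [Function.comp]
    rw [← Real.rpow_mul (Nat.cast_nonneg n), mul_div_cancel₀ _ hp.ne']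
  refine Summable.of_nat_of_neg ?_ ?_ <;> simpa using hnat

/-- From |k_i| ≤ |k| one gets ν|k|^{1/s} ≥ (ν/d) ∑_i |k_i|^{1/s}, so the series is dominated by a
product of one-dimensional ones. Dimension zero is separate because of the division by d. -/
theorem summable_gevrey {s ν : ℝ} (hs : 1 ≤ s) (hν : 0 < ν) :
    Summable fun k : Fin d → ℤ => Real.exp (-ν * gexp s k) := by
  have hp : 0 < 1 / s := by positivity
  rcases Nat.eq_zero_or_pos d with rfl | hd
  · exact (hasSum_fintype _).summable
  have hd' : (0 : ℝ) < d := Nat.cast_pos.mpr hd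
  refine (summable_prod_apply (d := d) (fun n => (Real.exp_pos _).le)
    (summable_exp_neg_abs_rpow (c := ν / d) (by positivity) hp)).of_nonneg_of_le
    (fun _ => (Real.exp_pos _).le) fun k => ?_
  rw [← Real.exp_sum, Real.exp_le_exp, ← Finset.mul_sum]
  have : ∑ i, |(k i : ℝ)| ^ (1 / s) ≤ d * gexp s k := by
    refine (Finset.sum_le_sum fun i _ =>
      Real.rpow_le_rpow (abs_nonneg _) (abs_le_l1Z k i) hp.le).trans ?_
    simp [gexp]
  have h2 : ν / d * ∑ i, |(k i : ℝ)| ^ (1 / s) ≤ ν * gexp s k := by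
    calc ν / d * ∑ i, |(k i : ℝ)| ^ (1 / s) ≤ ν / d * (d * gexp s k) := by gcongr
      _ = ν * gexp s k := by field_simp
  linarith

theorem Cnu_eq (s ν : ℝ) : Cnu d s ν = ∑' k : Fin d → ℤ, Real.exp (-ν * gexp s k) := rfl

/-- `C_ν - 1` is at least the contribution of the `2d` unit vectors. -/
theorem Cnu_sub_one_ge {s ν : ℝ} (hs : 1 ≤ s) (hν : 0 < ν) (hd : 2 ≤ d) :
    4 * Real.exp (-ν) ≤ Cnu d s ν - 1 := by
  let i : Fin d := ⟨0, by omega⟩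
  let j : Fin d := ⟨1, by omega⟩
  have hij : i ≠ j := by simp [i, j]
  -- Two coordinate directions suffice. The resulting 4 turns the 8 in the definition of ε into the
  -- 32 of `SmallField.mu_le`.
  let u : Finset (Fin d → ℤ) :=
    {0, Pi.single i 1, Pi.single i (-1), Pi.single j 1, Pi.single j (-1)}
  have h := (summable_gevrey (d := d) hs hν).sum_le_tsum u fun _ _ => (Real.exp_pos _).le
  have hl : ∀ (a : Fin d) (n : ℤ), |(n : ℝ)| = 1 → gexp s (Pi.single a n : Fin d → ℤ) = 1 := by
    intro a n hn
    have : l1Z (Pi.single a n : Fin d → ℤ) = 1 := by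
      rw [l1Z, Finset.sum_eq_single a]
      · simpa using hn
      · intro b _ hb; simp [hb]
      · simp
    rw [gexp, this, Real.one_rpow]
  have e1 : ∀ (a : Fin d) (n m : ℤ), n ≠ m →
      (Pi.single a n : Fin d → ℤ) ≠ Pi.single a m := fun a n m h h' =>
    h (by simpa using congrFun h' a)
  have e2 : ∀ (n m : ℤ), n ≠ 0 → (Pi.single i n : Fin d → ℤ) ≠ Pi.single j m := fun n m h h' =>
    h (by simpa [Pi.single_eq_of_ne hij] using congrFun h' i)
  have e0 : ∀ (a : Fin d) (n : ℤ), n ≠ 0 → (0 : Fin d → ℤ) ≠ Pi.single a n := fun a n h h' =>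
    h (by simpa using (congrFun h' a).symm)
  rw [Finset.sum_insert, Finset.sum_insert, Finset.sum_insert, Finset.sum_insert,
    Finset.sum_singleton, gexp_zero hs, hl i 1 (by simp), hl i (-1) (by simp), hl j 1 (by simp),
    hl j (-1) (by simp)] at h
  · rw [Cnu_eq]
    simp only [mul_zero, Real.exp_zero, mul_one] at h
    linarith
  · simp only [Finset.mem_singleton]; exact e1 j 1 (-1) (by norm_num)
  · simp only [Finset.mem_insert, Finset.mem_singleton, not_or]
    exact ⟨e2 _ _ (by norm_num), e2 _ _ (by norm_num)⟩
  · simp only [Finset.mem_insert, Finset.mem_singleton, not_or]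
    exact ⟨e1 i 1 (-1) (by norm_num), e2 _ _ (by norm_num), e2 _ _ (by norm_num)⟩
  · simp only [Finset.mem_insert, Finset.mem_singleton, not_or]
    exact ⟨e0 _ _ (by norm_num), e0 _ _ (by norm_num), e0 _ _ (by norm_num), e0 _ _ (by norm_num)⟩

/-! ### Derivations -/

namespace WAlg

variable {w : Weight d}

/-- `a' = ∂_j a`, in terms of Fourier coefficients. -/
def IsDer (j : Fin d) (a a' : WAlg w) : Prop :=
  ∀ k, coef a' k = Complex.I * (k j : ℂ) * coef a k

theorem IsDer.smul {j : Fin d} {a a' : WAlg w} (h : IsDer j a a') (c : ℂ) :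
    IsDer j (c • a) (c • a') := fun k => by
  rw [coef_smul, coef_smul, h k]; ring

/-- The Leibniz rule is the splitting k_j = n_j + (k - n)_j inside the convolution. -/
theorem IsDer.mul {j : Fin d} {a a' b b' : WAlg w} (ha : IsDer j a a') (hb : IsDer j b b') :
    IsDer j (a * b) (a' * b + a * b') := fun k => by
  rw [coef_add, coef_mul, coef_mul, coef_mul,
    ← (summable_conv a' b k).of_norm.tsum_add (summable_conv a b' k).of_norm, ← tsum_mul_left]
  refine tsum_congr fun n => ?_
  rw [ha n, hb (k - n), Pi.sub_apply]
  push_cast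
  ring

theorem isDer_one (j : Fin d) : IsDer j (1 : WAlg w) 0 := fun k => by
  rw [coef_zero, coef_one]
  by_cases hk : k = 0
  · simp [hk]
  · rw [Pi.single_eq_of_ne hk, mul_zero]

theorem IsDer.pow {j : Fin d} {a a' : WAlg w} (h : IsDer j a a') (n : ℕ) :
    -- At n = 0 the truncated exponent n - 1 is harmless, because the factor n vanishes.
    IsDer j (a ^ n) ((n : ℂ) • (a ^ (n - 1) * a')) := by
  induction n with
  | zero => simpa using isDer_one j
  | succ n ih =>
    have := h.mul ih
    rw [← pow_succ'] at this
    convert this using 1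
    rcases n with _ | n
    · simp
    · rw [mul_smul_comm, Nat.add_sub_cancel, Nat.add_sub_cancel]
      push_cast
      simp only [add_smul, one_smul, pow_succ]
      ring_nf

/-- `IsDer` is a relation between individual coefficients, each of which is a continuous functional.
It therefore passes to the limit of the exponential series, and the unbounded operator ∂_j needs no
domain. -/
theorem IsDer.exp {j : Fin d} {a a' : WAlg w} (h : IsDer j a a') :
    IsDer j (NormedSpace.exp a) (a' * NormedSpace.exp a) := fun k => by
  have h1 : HasSum (fun n : ℕ => ((n.factorial : ℂ)⁻¹) • a ^ n) (NormedSpace.exp a) :=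
    NormedSpace.exp_series_hasSum_exp' (𝕂 := ℂ) a
  have h2 : HasSum (fun n : ℕ => ((n.factorial : ℂ)⁻¹) • ((n : ℂ) • (a ^ (n - 1) * a')))
      (a' * NormedSpace.exp a) := by
    -- The differentiated series has no term of order zero; the shifted one is a' times the
    -- exponential series.
    rw [← hasSum_nat_add_iff' 1]
    simp only [Finset.range_one, Finset.sum_singleton, Nat.cast_zero, zero_smul, smul_zero,
      sub_zero]
    refine (h1.mul_left a').congr_fun ?_
    intro n
    rw [Nat.add_sub_cancel, smul_smul, mul_smul_comm, mul_comm a']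
    congr 1
    rw [Nat.factorial_succ]
    have : (n.factorial : ℂ) ≠ 0 := Nat.cast_ne_zero.mpr n.factorial_ne_zero
    have h' : ((n : ℂ) + 1) ≠ 0 := by exact_mod_cast n.succ_ne_zero
    push_cast
    field_simp
  have e1 := (coefCLM w k).hasSum h1
  have e2 := (coefCLM w k).hasSum h2
  refine e2.unique ((e1.mul_left (Complex.I * (k j : ℂ))).congr_fun ?_)
  intro n
  exact ((h.pow n).smul ((n.factorial : ℂ)⁻¹)) k

/-- The partial derivative of an element with summable derivative. -/
noncomputable def der (j : Fin d) (a : WAlg w) (ha : Summable fun k => l1Z k * ‖coef a k‖ * w k) :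
    WAlg w :=
  mk (fun k => Complex.I * (k j : ℂ) * coef a k) <| ha.of_nonneg_of_le
    (fun k => mul_nonneg (norm_nonneg _) (weight_pos w k).le) fun k => by
      rw [norm_mul, norm_mul, Complex.norm_I, one_mul, Complex.norm_intCast]
      gcongr
      · exact (weight_pos w k).le
      · exact abs_le_l1Z k j

theorem isDer_der (j : Fin d) (a : WAlg w) (ha : Summable fun k => l1Z k * ‖coef a k‖ * w k) :
    IsDer j a (der j a ha) := fun k => coef_mk _ _ k

/-- The coefficients of `v = e^{ig}` satisfy `|l| |v_l| ≤ ∑ |n| |g_n| |v_{l-n}|`. -/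
theorem l1Z_mul_coef_exp_le (g : WAlg w) (hg : Summable fun k => l1Z k * ‖coef g k‖ * w k)
    (l : Fin d → ℤ) :
    l1Z l * ‖coef (NormedSpace.exp (Complex.I • g)) l‖ ≤
      ∑' n, l1Z n * ‖coef g n‖ * ‖coef (NormedSpace.exp (Complex.I • g)) (l - n)‖ := by
  set v := NormedSpace.exp (Complex.I • g) with hv
  have hj : ∀ j : Fin d, |(l j : ℝ)| * ‖coef v l‖
      ≤ ∑' n, |(n j : ℝ)| * ‖coef g n‖ * ‖coef v (l - n)‖ := by
    intro j
    have h := ((isDer_der j g hg).smul Complex.I).exp l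
    rw [← hv, coef_mul] at h
    have hn := congrArg norm h
    rw [norm_mul, norm_mul, Complex.norm_I, one_mul, Complex.norm_intCast] at hn
    rw [← hn]
    refine (norm_tsum_le_tsum_norm (summable_conv _ v l)).trans (le_of_eq ?_)
    refine tsum_congr fun n => ?_
    rw [coef_smul, isDer_der j g hg n]
    simp [Complex.norm_intCast]
  have hs : ∀ j : Fin d, Summable fun n => |(n j : ℝ)| * ‖coef g n‖ * ‖coef v (l - n)‖ := by
    intro j
    refine (summable_conv (der j g hg) v l).congr fun n => ?_
    rw [isDer_der j g hg n]
    simp [Complex.norm_intCast]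
  calc l1Z l * ‖coef v l‖ = ∑ j, |(l j : ℝ)| * ‖coef v l‖ := by rw [l1Z, Finset.sum_mul]
    _ ≤ ∑ j, ∑' n, |(n j : ℝ)| * ‖coef g n‖ * ‖coef v (l - n)‖ :=
        Finset.sum_le_sum fun j _ => hj j
    _ = ∑' n, ∑ j, |(n j : ℝ)| * ‖coef g n‖ * ‖coef v (l - n)‖ :=
        (Summable.tsum_finsetSum fun j _ => hs j).symm
    _ = _ := by
        refine tsum_congr fun n => ?_
        rw [l1Z, Finset.sum_mul, Finset.sum_mul]

end WAlg

end GevreyRenorm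

namespace GevreyRenorm

variable {d : ℕ}

/-! ### Decay of a nonnegative sequence dominated by its convolution -/

section Decay

variable {s : ℝ} {V G : (Fin d → ℤ) → ℝ}

theorem exp_gexp_split (hs : 1 ≤ s) {r : ℝ} (hr : 0 ≤ r) (l n : Fin d → ℤ) :
    Real.exp (r * gexp s l) ≤ Real.exp (r * gexp s n) * Real.exp (r * gexp s (l - n)) :=
  WAlg.weight_le_split (gev d s r hs hr) l n

/-- Nonnegative sequences are viewed as elements of the weighted algebra, where the convolution
bound is submultiplicativity of the norm. -/
theorem conv_weight (hs : 1 ≤ s) {r : ℝ} (hr : 0 ≤ r) (hV0 : ∀ k, 0 ≤ V k) (hG0 : ∀ k, 0 ≤ G k)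
    (hG : Summable fun k => G k * Real.exp (r * gexp s k))
    (hV : Summable fun k => V k * Real.exp (r * gexp s k)) :
    (∀ l, Summable fun n => G n * V (l - n)) ∧
    (Summable fun l => (∑' n, G n * V (l - n)) * Real.exp (r * gexp s l)) ∧
    ∑' l, (∑' n, G n * V (l - n)) * Real.exp (r * gexp s l) ≤
      (∑' k, G k * Real.exp (r * gexp s k)) * ∑' k, V k * Real.exp (r * gexp s k) := by
  have hnG : ∀ k, ‖(G k : ℂ)‖ = G k := fun k => by
    rw [Complex.norm_real, Real.norm_of_nonneg (hG0 k)]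
  have hnV : ∀ k, ‖(V k : ℂ)‖ = V k := fun k => by
    rw [Complex.norm_real, Real.norm_of_nonneg (hV0 k)]
  let a : WAlg (gev d s r hs hr) := WAlg.mk (fun k => (G k : ℂ)) (by simpa only [hnG, gev_apply] using hG)
  let b : WAlg (gev d s r hs hr) := WAlg.mk (fun k => (V k : ℂ)) (by simpa only [hnV, gev_apply] using hV)
  have ha : ∀ k, WAlg.coef a k = (G k : ℂ) := fun k => WAlg.coef_mk _ _ k
  have hb : ∀ k, WAlg.coef b k = (V k : ℂ) := fun k => WAlg.coef_mk _ _ k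
  have hc : ∀ l, ‖WAlg.coef (a * b) l‖ = ∑' n, G n * V (l - n) := by
    intro l
    rw [WAlg.coef_mul]
    simp only [ha, hb]
    have : ∑' n, (G n : ℂ) * (V (l - n) : ℂ) = ((∑' n, G n * V (l - n) : ℝ) : ℂ) := by
      push_cast; rfl
    rw [this, Complex.norm_real, Real.norm_of_nonneg
      (tsum_nonneg fun n => mul_nonneg (hG0 _) (hV0 _))]
  refine ⟨fun l => ?_, ?_, ?_⟩
  · refine (WAlg.summable_conv a b l).congr fun n => ?_
    rw [norm_mul, ha, hb, hnG, hnV]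
  · refine (WAlg.summable_norm (a * b)).congr fun l => ?_
    rw [hc]; rfl
  · have h := norm_mul_le a b
    rw [WAlg.norm_eq, WAlg.norm_eq a, WAlg.norm_eq b] at h
    simpa only [hc, ha, hb, hnG, hnV, gev_apply] using h

/-- Sup-norm decay: the maximum of `V_l e^{r|l|^{1/s}}` is attained at some `|l| ≤ N`. -/
theorem decay_sup (hs : 1 ≤ s) {r : ℝ} (hr : 0 ≤ r) (hV0 : ∀ k, 0 ≤ V k) (hG0 : ∀ k, 0 ≤ G k)
    (hV1 : ∀ k, V k ≤ 1)
    (hG : Summable fun k => G k * Real.exp (r * gexp s k))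
    (hV : Summable fun k => V k * Real.exp (r * gexp s k))
    (hkey : ∀ l, l1Z l * V l ≤ ∑' n, G n * V (l - n)) (l : Fin d → ℤ) :
    V l * Real.exp (r * gexp s l) ≤
      Real.exp (r * (∑' k, G k * Real.exp (r * gexp s k)) ^ (1 / s)) := by
  set f : (Fin d → ℤ) → ℝ := fun k => V k * Real.exp (r * gexp s k) with hf
  set N := ∑' k, G k * Real.exp (r * gexp s k) with hN
  rcases le_or_gt (f l) 0 with hl | hl
  · exact hl.trans (Real.exp_pos _).le
  -- Summability makes superlevel sets finite, so the weighted sequence attains its maximum.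
  have hfin : {k | f l ≤ f k}.Finite := by
    have := (hV.tendsto_cofinite_zero.eventually (gt_mem_nhds hl))
    simpa [Filter.eventually_cofinite] using this
  obtain ⟨m, hm, hmax⟩ := Set.exists_max_image {k | f l ≤ f k} f hfin ⟨l, le_refl (f l)⟩
  have hmaxall : ∀ k, f k ≤ f m := by
    intro k
    by_cases hk : f l ≤ f k
    · exact hmax k hk
    · exact (not_le.mp hk).le.trans hm
  have hmpos : 0 < f m := hl.trans_le hm
  obtain ⟨hc, -, -⟩ := conv_weight hs hr hV0 hG0 hG hV
  -- At the maximiser m every f(m - n) is at most f(m), so the convolution inequality forces |m| ≤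
  -- N. There the weight is explicit and V ≤ 1.
  have hNm : l1Z m * f m ≤ N * f m := by
    calc l1Z m * f m = l1Z m * V m * Real.exp (r * gexp s m) := by rw [hf]; ring
      _ ≤ (∑' n, G n * V (m - n)) * Real.exp (r * gexp s m) :=
          mul_le_mul_of_nonneg_right (hkey m) (Real.exp_pos _).le
      _ = ∑' n, G n * V (m - n) * Real.exp (r * gexp s m) := by rw [tsum_mul_right]
      _ ≤ ∑' n, G n * Real.exp (r * gexp s n) * f m := by
          refine ((hc m).mul_right _).tsum_le_tsum (fun n => ?_) (hG.mul_right _)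
          calc G n * V (m - n) * Real.exp (r * gexp s m)
              ≤ G n * V (m - n) * (Real.exp (r * gexp s n) * Real.exp (r * gexp s (m - n))) :=
                mul_le_mul_of_nonneg_left (exp_gexp_split hs hr m n)
                  (mul_nonneg (hG0 _) (hV0 _))
            _ = G n * Real.exp (r * gexp s n) * f (m - n) := by rw [hf]; ring
            _ ≤ _ := mul_le_mul_of_nonneg_left (hmaxall _)
                  (mul_nonneg (hG0 _) (Real.exp_pos _).le)
      _ = N * f m := by rw [tsum_mul_right]
  have hmN : l1Z m ≤ N := le_of_mul_le_mul_right hNm hmpos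
  calc f l ≤ f m := hm
    _ ≤ 1 * Real.exp (r * gexp s m) := mul_le_mul_of_nonneg_right (hV1 m) (Real.exp_pos _).le
    _ ≤ _ := by
        rw [one_mul, Real.exp_le_exp]
        exact mul_le_mul_of_nonneg_left
          (Real.rpow_le_rpow (l1Z_nonneg m) hmN (by positivity)) hr

/-- Concavity: x^p lies below its tangent at c. With c a bound for the mean of |k|, this is Jensen's
inequality for |k|^{1/s}. -/
theorem rpow_le_tangent {p x c : ℝ} (hp0 : 0 ≤ p) (hp1 : p ≤ 1) (hx : 0 ≤ x) (hc : 0 < c) :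
    x ^ p ≤ c ^ p * (p * (x / c) + (1 - p)) := by
  have h := Real.geom_mean_le_arith_mean2_weighted hp0 (sub_nonneg.mpr hp1)
    (div_nonneg hx hc.le) zero_le_one (by ring)
  rw [Real.one_rpow, mul_one, mul_one, Real.div_rpow hx hc.le] at h
  have hcp : 0 < c ^ p := Real.rpow_pos_of_pos hc p
  calc x ^ p = c ^ p * (x ^ p / c ^ p) := by field_simp
    _ ≤ _ := mul_le_mul_of_nonneg_left h hcp.le

/-- Growth of `∑ V_l e^{r|l|^{1/s}}` as a function of the width `r`. -/
theorem decay_sum (hs : 1 ≤ s) {ρ K : ℝ} (hρ : 0 ≤ ρ) (hK : 0 < K)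
    (hV0 : ∀ k, 0 ≤ V k) (hG0 : ∀ k, 0 ≤ G k) (hGz : G 0 = 0)
    (hG : Summable fun k => G k * Real.exp (ρ * gexp s k))
    (hGK : ∑' k, G k * Real.exp (ρ * gexp s k) ≤ K)
    (hV : Summable fun k => V k * Real.exp (ρ * gexp s k))
    (hkey : ∀ l, l1Z l * V l ≤ ∑' n, G n * V (l - n)) :
    ∑' k, V k * Real.exp (ρ * gexp s k) ≤ (∑' k, V k) * Real.exp (s * K ^ (1 / s)) := by
  have hs0 : 0 < s := by linarith
  set p := 1 / s with hp
  have hp0 : 0 < p := by positivity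
  have hp1 : p ≤ 1 := (div_le_one hs0).mpr hs
  have hmono : ∀ r ≤ ρ, ∀ k : Fin d → ℤ, Real.exp (r * gexp s k) ≤ Real.exp (ρ * gexp s k) :=
    fun r hr k => Real.exp_le_exp.mpr (mul_le_mul_of_nonneg_right hr (gexp_nonneg s k))
  have hVr : ∀ r ≤ ρ, Summable fun k => V k * Real.exp (r * gexp s k) := fun r hr =>
    hV.of_nonneg_of_le (fun k => mul_nonneg (hV0 k) (Real.exp_pos _).le)
      fun k => mul_le_mul_of_nonneg_left (hmono r hr k) (hV0 k)
  have hGr : ∀ r ≤ ρ, Summable fun k => G k * Real.exp (r * gexp s k) := fun r hr =>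
    hG.of_nonneg_of_le (fun k => mul_nonneg (hG0 k) (Real.exp_pos _).le)
      fun k => mul_le_mul_of_nonneg_left (hmono r hr k) (hG0 k)
  -- Since G has no zero mode, lowering the width from ρ to r gains e^{-(ρ-r)}. This decay makes the
  -- differential inequality integrable with a constant independent of ρ.
  have hGrK : ∀ r ≤ ρ, ∑' k, G k * Real.exp (r * gexp s k) ≤ K * Real.exp (-(ρ - r)) := by
    intro r hr
    have h1 : ∑' k, G k * Real.exp (r * gexp s k)
        ≤ ∑' k, G k * Real.exp (ρ * gexp s k) * Real.exp (-(ρ - r)) := by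
      refine (hGr r hr).tsum_le_tsum (fun k => ?_) (hG.mul_right _)
      by_cases hk : k = 0
      · simp [hk, hGz]
      · rw [mul_assoc, ← Real.exp_add]
        refine mul_le_mul_of_nonneg_left (Real.exp_le_exp.mpr ?_) (hG0 k)
        nlinarith [one_le_gexp hs hk]
    rw [tsum_mul_right] at h1
    exact h1.trans (mul_le_mul_of_nonneg_right hGK (Real.exp_pos _).le)
  have hlV : ∀ r, 0 ≤ r → r ≤ ρ → Summable (fun k => l1Z k * V k * Real.exp (r * gexp s k)) ∧
      ∑' k, l1Z k * V k * Real.exp (r * gexp s k) ≤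
        K * Real.exp (-(ρ - r)) * ∑' k, V k * Real.exp (r * gexp s k) := by
    intro r h0 hr
    obtain ⟨-, h2, h3⟩ := conv_weight hs h0 hV0 hG0 (hGr r hr) (hVr r hr)
    have hle : ∀ k, l1Z k * V k * Real.exp (r * gexp s k)
        ≤ (∑' n, G n * V (k - n)) * Real.exp (r * gexp s k) := fun k =>
      mul_le_mul_of_nonneg_right (hkey k) (Real.exp_pos _).le
    have hsum := h2.of_nonneg_of_le (fun k => mul_nonneg (mul_nonneg (l1Z_nonneg k) (hV0 k))
      (Real.exp_pos _).le) hle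
    exact ⟨hsum, (hsum.tsum_le_tsum hle h2).trans (h3.trans
      (mul_le_mul_of_nonneg_right (hGrK r hr)
        (tsum_nonneg fun k => mul_nonneg (hV0 k) (Real.exp_pos _).le)))⟩
  have hgV : ∀ r, 0 ≤ r → r ≤ ρ → Summable fun k => V k * (gexp s k * Real.exp (r * gexp s k)) := by
    intro r h0 hr
    refine (hlV r h0 hr).1.of_nonneg_of_le (fun k => mul_nonneg (hV0 k)
      (mul_nonneg (gexp_nonneg s k) (Real.exp_pos _).le)) fun k => ?_
    have := mul_le_mul_of_nonneg_right (gexp_le_one_add hs k)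
      (mul_nonneg (hV0 k) (Real.exp_pos (r * gexp s k)).le)
    linarith
  -- The mean of |k| with respect to V_k e^{r|k|^{1/s}} is at most c, by the convolution inequality;
  -- the tangent at c then bounds the mean of |k|^{1/s} by c^{1/s}. The left side is the derivative
  -- in r of the sum being estimated.
  have hbound : ∀ r, 0 ≤ r → r ≤ ρ → ∑' k, V k * (gexp s k * Real.exp (r * gexp s k)) ≤
      (K * Real.exp (-(ρ - r))) ^ p * ∑' k, V k * Real.exp (r * gexp s k) := by
    intro r h0 hr
    set c := K * Real.exp (-(ρ - r)) with hc
    have hcpos : 0 < c := mul_pos hK (Real.exp_pos _)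
    have hpt : ∀ k, V k * (gexp s k * Real.exp (r * gexp s k)) ≤
        c ^ p * (p / c) * (l1Z k * V k * Real.exp (r * gexp s k)) +
          c ^ p * (1 - p) * (V k * Real.exp (r * gexp s k)) := by
      intro k
      have := mul_le_mul_of_nonneg_right (rpow_le_tangent hp0.le hp1 (l1Z_nonneg k) hcpos)
        (mul_nonneg (hV0 k) (Real.exp_pos (r * gexp s k)).le)
      calc V k * (gexp s k * Real.exp (r * gexp s k))
          = l1Z k ^ p * (V k * Real.exp (r * gexp s k)) := by rw [gexp]; ring
        _ ≤ _ := this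
        _ = _ := by ring
    have hA := (hlV r h0 hr).1.mul_left (c ^ p * (p / c))
    have hB := (hVr r hr).mul_left (c ^ p * (1 - p))
    refine ((hgV r h0 hr).tsum_le_tsum hpt (hA.add hB)).trans ?_
    rw [hA.tsum_add hB, tsum_mul_left, tsum_mul_left]
    have h3 := mul_le_mul_of_nonneg_left (hlV r h0 hr).2
      (show 0 ≤ c ^ p * (p / c) by positivity)
    refine (add_le_add_left h3 _).trans (le_of_eq ?_)
    rw [← hc]
    field_simp
    ring
  -- the function `M(r) e^{-φ(r)}` is antitone
  set M : ℝ → ℝ := fun r => ∑' k, V k * Real.exp (r * gexp s k) with hM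
  -- A primitive of the logarithmic growth rate (K e^{-(ρ-r)})^p. Its value s K^p at r = ρ is the
  -- exponent in the conclusion.
  set φ : ℝ → ℝ := fun r => s * K ^ p * Real.exp (-p * (ρ - r)) with hφ
  have hφd : ∀ r, HasDerivAt φ ((K * Real.exp (-(ρ - r))) ^ p) r := by
    intro r
    have h1 : HasDerivAt (fun r => -p * (ρ - r)) p r := by
      simpa using ((hasDerivAt_id r).const_sub ρ).const_mul (-p)
    have h2 := h1.exp.const_mul (s * K ^ p)
    refine h2.congr_deriv ?_
    rw [Real.mul_rpow hK.le (Real.exp_pos _).le, ← Real.exp_mul,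
      show -(ρ - r) * p = -p * (ρ - r) by ring]
    rw [hp]
    field_simp
  have hMd : ∀ r ∈ Set.Ioo 0 ρ,
      HasDerivAt M (∑' k, V k * (gexp s k * Real.exp (r * gexp s k))) r := by
    intro r hr
    refine hasDerivAt_tsum_of_isPreconnected (t := Set.Ioo 0 ρ) (hgV ρ hρ le_rfl) isOpen_Ioo
      isPreconnected_Ioo (g := fun k r => V k * Real.exp (r * gexp s k))
      (g' := fun k r => V k * (gexp s k * Real.exp (r * gexp s k))) ?_ ?_ hr
      (hVr r hr.2.le) hr
    · intro k y _
      have := ((hasDerivAt_id y).mul_const (gexp s k)).exp.const_mul (V k)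
      refine this.congr_deriv ?_
      simp only [id_eq]
      ring
    · intro k y hy
      rw [Real.norm_of_nonneg (mul_nonneg (hV0 k)
        (mul_nonneg (gexp_nonneg s k) (Real.exp_pos _).le))]
      exact mul_le_mul_of_nonneg_left (mul_le_mul_of_nonneg_left (hmono y hy.2.le k)
        (gexp_nonneg s k)) (hV0 k)
  have hMc : ContinuousOn M (Set.Icc 0 ρ) := by
    refine continuousOn_tsum (u := fun k => V k * Real.exp (ρ * gexp s k)) (fun k => ?_) hV ?_
    · fun_prop
    · intro k y hy
      rw [Real.norm_of_nonneg (mul_nonneg (hV0 k) (Real.exp_pos _).le)]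
      exact mul_le_mul_of_nonneg_left (hmono y hy.2 k) (hV0 k)
  have hφc : Continuous φ := by fun_prop
  have hanti : AntitoneOn (fun r => M r * Real.exp (-φ r)) (Set.Icc 0 ρ) := by
    have hD : ∀ r ∈ Set.Ioo 0 ρ, HasDerivAt (fun r => M r * Real.exp (-φ r))
        ((∑' k, V k * (gexp s k * Real.exp (r * gexp s k))) * Real.exp (-φ r) +
          M r * (Real.exp (-φ r) * -((K * Real.exp (-(ρ - r))) ^ p))) r := fun r hr =>
      (hMd r hr).mul (hφd r).neg.exp
    refine antitoneOn_of_deriv_nonpos (convex_Icc 0 ρ) (hMc.mul (by fun_prop)) ?_ ?_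
    · rw [interior_Icc]
      exact fun r hr => (hD r hr).differentiableAt.differentiableWithinAt
    · rw [interior_Icc]
      intro r hr
      rw [(hD r hr).deriv]
      have := mul_le_mul_of_nonneg_right (hbound r hr.1.le hr.2.le) (Real.exp_pos (-φ r)).le
      linarith
  have h := hanti (Set.left_mem_Icc.mpr hρ) (Set.right_mem_Icc.mpr hρ) hρ
  simp only at h
  have hM0 : M 0 = ∑' k, V k := by simp [hM]
  have hφρ : φ ρ = s * K ^ p := by simp [hφ]
  have hφ0 : 0 ≤ φ 0 := by positivity
  have hM0nn : 0 ≤ M 0 := by rw [hM0]; exact tsum_nonneg hV0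
  rw [hφρ, Real.exp_neg, ← div_eq_mul_inv, div_le_iff₀ (Real.exp_pos _)] at h
  rw [← hM0]
  refine h.trans (mul_le_mul_of_nonneg_right ?_ (Real.exp_pos _).le)
  exact mul_le_of_le_one_right hM0nn (Real.exp_le_one_iff.mpr (neg_nonpos.mpr hφ0))

end Decay

end GevreyRenorm

namespace GevreyRenorm

variable {d : ℕ}

/-! ### Constants -/

theorem le_beta {s : ℝ} (hs : 1 ≤ s) (hd : 1 ≤ d) : s ≤ beta d s := by
  have h1 : (1 : ℝ) ≤ (d : ℝ) ^ ((s - 1) / s) :=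
    Real.one_le_rpow (by exact_mod_cast hd) (div_nonneg (by linarith) (by linarith))
  rw [beta]
  nlinarith

theorem one_le_Cnu {s ν : ℝ} (hs : 1 ≤ s) (hν : 0 < ν) : 1 ≤ Cnu d s ν := by
  have h := (summable_gevrey (d := d) hs hν).le_tsum 0 fun _ _ => (Real.exp_pos _).le
  rw [gexp_zero hs] at h
  simpa [Cnu_eq] using h

/-- The radius of the ball of displacements. -/
noncomputable def dispRadius (d : ℕ) (s ν σ a : ℝ) : ℝ :=
  min (ν ^ s / (2 * beta d s) ^ s) (σ / (8 * a * Cnu d s ν) * ((2 : ℝ) ^ s / ν ^ s + 7)⁻¹)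

/-- The two radii correspond: displacements bounded by 8(C_ν - 1)/σ times a field of size ε have
size at most `dispRadius`. -/
theorem epsRadius_eq (s ν σ a : ℝ) :
    epsRadius d s ν σ a = σ / (8 * (Cnu d s ν - 1)) * dispRadius d s ν σ a := rfl

/-- The standing assumptions on the parameters of one elimination step. -/
structure StepParams (d : ℕ) (s ρ ν σ a : ℝ) : Prop where
  hd : 2 ≤ d
  hs : 1 ≤ s
  hν : 0 < ν
  hσ : 0 < σ
  hσa : σ < a
  hρ : ν * (1 + beta d s + beta d s ^ 2) < ρ

namespace StepParams

variable {s ρ ν σ a : ℝ} (P : StepParams d s ρ ν σ a)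
include P

theorem s_pos : 0 < s := one_pos.trans_le P.hs

theorem s_le_beta : s ≤ beta d s := le_beta P.hs (by have := P.hd; omega)

theorem one_le_beta : 1 ≤ beta d s := P.hs.trans P.s_le_beta

theorem beta_pos : 0 < beta d s := one_pos.trans_le P.one_le_beta

theorem one_le_C : 1 ≤ Cnu d s ν := one_le_Cnu P.hs P.hν

theorem C_sub_one_ge : 4 * Real.exp (-ν) ≤ Cnu d s ν - 1 := Cnu_sub_one_ge P.hs P.hν P.hd

theorem C_sub_one_pos : 0 < Cnu d s ν - 1 :=
  (by positivity : (0 : ℝ) < 4 * Real.exp (-ν)).trans_le P.C_sub_one_ge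

theorem dispRadius_pos : 0 < dispRadius d s ν σ a := by
  have h1 := P.beta_pos
  have h2 := P.one_le_C
  have h3 := P.hν
  have h4 := P.hσ
  have h5 := P.hσ.trans P.hσa
  refine lt_min (by positivity) ?_
  have : (0 : ℝ) < 2 ^ s / ν ^ s + 7 := by positivity
  positivity

theorem eps_pos : 0 < epsRadius d s ν σ a := by
  rw [epsRadius_eq]
  have := P.C_sub_one_pos
  exact mul_pos (div_pos P.hσ (by positivity)) P.dispRadius_pos

/-- The bounds on the radius come from the second entry of the minimum, in which σ < a removes the
ratio σ/a. -/
theorem dispRadius_le_aux : dispRadius d s ν σ a ≤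
    1 / (8 * Cnu d s ν) * ((2 : ℝ) ^ s / ν ^ s + 7)⁻¹ := by
  refine (min_le_right _ _).trans ?_
  have h2 := P.one_le_C
  have h3 := P.hν
  have h5 := P.hσ.trans P.hσa
  have : (0 : ℝ) < 2 ^ s / ν ^ s + 7 := by positivity
  refine mul_le_mul_of_nonneg_right ?_ (by positivity)
  rw [div_le_div_iff₀ (by positivity) (by positivity)]
  have := P.hσa
  nlinarith

theorem dispRadius_le : dispRadius d s ν σ a ≤ 1 / 56 := by
  refine P.dispRadius_le_aux.trans ?_
  have h2 := P.one_le_C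
  have h3 := P.hν
  have h : (0 : ℝ) < 2 ^ s / ν ^ s := by positivity
  rw [one_div, ← mul_inv, one_div]
  refine inv_anti₀ (by norm_num) ?_
  nlinarith

theorem dispRadius_le' : dispRadius d s ν σ a ≤ (ν / 2) ^ s / (8 * Cnu d s ν) := by
  refine P.dispRadius_le_aux.trans ?_
  have h2 := P.one_le_C
  have h3 := P.hν
  have h : (0 : ℝ) < 2 ^ s / ν ^ s := by positivity
  have h4 : ((2 : ℝ) ^ s / ν ^ s + 7)⁻¹ ≤ (ν / 2) ^ s := by
    have e : (ν / 2) ^ s = ((2 : ℝ) ^ s / ν ^ s)⁻¹ := by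
      rw [Real.div_rpow h3.le (by norm_num), inv_div]
    rw [e]
    exact inv_anti₀ h (le_add_of_nonneg_right (by norm_num))
  calc 1 / (8 * Cnu d s ν) * ((2 : ℝ) ^ s / ν ^ s + 7)⁻¹
      ≤ 1 / (8 * Cnu d s ν) * (ν / 2) ^ s := mul_le_mul_of_nonneg_left h4 (by positivity)
    _ = _ := by ring

theorem radius1_ge : (1 + beta d s) * ν ≤ radius1 d s ν ρ := by
  rw [radius1, le_div_iff₀ P.beta_pos]
  have := P.hρ
  nlinarith

theorem radius1_pos : 0 < radius1 d s ν ρ :=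
  (mul_pos (by linarith [P.beta_pos]) P.hν).trans_le P.radius1_ge

/-- The budget for composition: β²ν of width is free for e^{ik·u}. From ρ = βρ' + ν and ρ' ≥ (1+β)ν
one has (β-1)ρ' ≥ (β²-1)ν. -/
theorem radius1_add_le : radius1 d s ν ρ + beta d s ^ 2 * ν ≤ ρ := by
  have h1 : ρ = beta d s * radius1 d s ν ρ + ν := by
    rw [radius1, mul_div_cancel₀ _ P.beta_pos.ne']; ring
  have h2 := P.radius1_ge
  have h3 := P.one_le_beta
  nlinarith [mul_nonneg (sub_nonneg.mpr h3) (sub_nonneg.mpr h2)]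

theorem rho_pos : 0 < ρ := by
  have := P.radius1_add_le
  have := P.radius1_pos
  have := mul_pos (pow_pos P.beta_pos 2) P.hν
  linarith

theorem radius2_eq : radius2 d s ν ρ =
    (ρ - ν * (1 + beta d s + beta d s ^ 2)) / beta d s ^ 2 := by
  have := P.beta_pos
  rw [radius2, radius1]
  field_simp
  ring

theorem radius2_pos : 0 < radius2 d s ν ρ := by
  rw [P.radius2_eq]
  exact div_pos (sub_pos.mpr P.hρ) (pow_pos P.beta_pos 2)

theorem radius2_le : radius2 d s ν ρ ≤ radius1 d s ν ρ := by
  have h1 := P.radius1_pos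
  have h2 := P.one_le_beta
  have h3 := P.hν
  have h4 : (radius1 d s ν ρ - ν) / beta d s ≤ radius1 d s ν ρ := by
    rw [div_le_iff₀ P.beta_pos]
    nlinarith
  rw [radius2]
  linarith

/-- The bound on the composition exponent for large frequencies. -/
theorem exponent_le {t : ℝ} (ht : 1 ≤ t * dispRadius d s ν σ a) :
    Real.log (Cnu d s ν) + (s + 1 / 2) * (t * dispRadius d s ν σ a) ^ (1 / s)
      ≤ 1 - ν + beta d s ^ 2 * ν * t ^ (1 / s) := by
  set R := dispRadius d s ν σ a with hR
  set C := Cnu d s ν with hC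
  set b := beta d s with hb
  have hs0 := P.s_pos
  have hs := P.hs
  have hν := P.hν
  have hC1 : 1 ≤ C := P.one_le_C
  have hRpos : 0 < R := P.dispRadius_pos
  have ht0 : 0 < t := by
    by_contra h
    nlinarith
  set p := 1 / s with hp
  have hp0 : 0 < p := by positivity
  have hsp : s * p = 1 := by rw [hp]; field_simp
  -- Writing x^p = e^{p log x} and using e^y ≥ 1 + y lets a power of 8C absorb the prefactor log C.
  have hlow : ∀ x : ℝ, 0 < x → 1 + p * Real.log x ≤ x ^ p := by
    intro x hx
    rw [Real.rpow_def_of_pos hx]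
    have := Real.add_one_le_exp (Real.log x * p)
    linarith
  set y := t ^ p with hy
  have hy0 : 0 < y := Real.rpow_pos_of_pos ht0 p
  -- `R^p ≤ (ν/2) (8C)^{-p}`
  have hRp : R ^ p * (8 * C) ^ p ≤ ν / 2 := by
    have h1 : R * (8 * C) ≤ (ν / 2) ^ s := by
      have := P.dispRadius_le'
      rwa [le_div_iff₀ (by positivity)] at this
    have h2 := Real.rpow_le_rpow (by positivity) h1 hp0.le
    rwa [← Real.rpow_mul (by positivity), hsp, Real.rpow_one,
      Real.mul_rpow hRpos.le (by positivity)] at h2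
  have hRy : 1 ≤ R ^ p * y := by
    have h2 := Real.rpow_le_rpow zero_le_one ht hp0.le
    rw [Real.one_rpow, Real.mul_rpow ht0.le hRpos.le] at h2
    linarith
  have hRp0 : 0 < R ^ p := Real.rpow_pos_of_pos hRpos p
  have hνy : 2 * (8 * C) ^ p ≤ ν * y := by
    have h8 : (0 : ℝ) < (8 * C) ^ p := by positivity
    nlinarith [mul_le_mul_of_nonneg_left hRy h8.le, mul_le_mul_of_nonneg_right hRp hy0.le]
  -- the three parts
  have hlog8 : (2 : ℝ) ≤ Real.log 8 := by
    rw [show (8 : ℝ) = 2 ^ (3 : ℕ) by norm_num, Real.log_pow]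
    have := Real.log_two_gt_d9
    push_cast
    linarith
  have hlogC : 0 ≤ Real.log C := Real.log_nonneg hC1
  have hlog8C : Real.log (8 * C) = Real.log 8 + Real.log C :=
    Real.log_mul (by norm_num) (by positivity)
  have hX : s + Real.log C ≤ s * (8 * C) ^ p := by
    have := mul_le_mul_of_nonneg_left (hlow (8 * C) (by positivity)) hs0.le
    rw [mul_add, ← mul_assoc, hsp, hlog8C] at this
    linarith
  have hsy : 2 * (s + Real.log C) ≤ s * (ν * y) := by
    have := mul_le_mul_of_nonneg_left hνy hs0.le
    linarith
  have hsb : s ^ 2 ≤ b ^ 2 := pow_le_pow_left₀ hs0.le P.s_le_beta 2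
  have hνy0 : 0 < ν * y := mul_pos hν hy0
  have hs2 : s * (ν * y) ≤ s ^ 2 * (ν * y) := by nlinarith
  have hb2 : s ^ 2 * (ν * y) ≤ b ^ 2 * (ν * y) := mul_le_mul_of_nonneg_right hsb hνy0.le
  -- The budget β²νy is split into 1/2 for log C, 1/4 for the composition exponent and 1/4 for the
  -- -ν on the right.
  have part1 : Real.log C ≤ 1 / 2 * (b ^ 2 * (ν * y)) := by linarith
  have part2 : (s + 1 / 2) * (t * R) ^ p ≤ 1 / 4 * (b ^ 2 * (ν * y)) := by
    rw [Real.mul_rpow ht0.le hRpos.le, ← hy]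
    have h8 : 1 + 2 * p ≤ (8 * C) ^ p := by
      have := hlow (8 * C) (by positivity)
      rw [hlog8C] at this
      nlinarith
    have h9 : (2 * s + 1) ≤ s ^ 2 * (8 * C) ^ p := by
      have := mul_le_mul_of_nonneg_left h8 (sq_nonneg s)
      have e : s ^ 2 * (1 + 2 * p) = s ^ 2 + 2 * s := by
        rw [mul_add, mul_one]
        linear_combination (2 * s) * hsp
      nlinarith
    have h10 : (2 * s + 1) * R ^ p ≤ s ^ 2 * (ν / 2) := by
      have := mul_le_mul_of_nonneg_right h9 hRp0.le
      have h11 := mul_le_mul_of_nonneg_left hRp (sq_nonneg s)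
      linarith
    have := mul_le_mul_of_nonneg_right h10 hy0.le
    linarith
  -- Here tR ≥ 1 and R ≤ 1/56 give t ≥ 56, hence log t ≥ 3 and y ≥ 1 + 3/s; then s²y ≥ s² + 3s ≥ 4.
  have part3 : 4 * ν ≤ b ^ 2 * (ν * y) := by
    have ht56 : 56 ≤ t := by
      have := P.dispRadius_le
      rw [← hR] at this
      nlinarith
    have hlog56 : 3 ≤ Real.log t := by
      have h1 : Real.log 8 ≤ Real.log t := Real.log_le_log (by norm_num) (by linarith)
      have h2 : Real.log 32 ≤ Real.log t := Real.log_le_log (by norm_num) (by linarith)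
      rw [show (32 : ℝ) = 2 ^ (5 : ℕ) by norm_num, Real.log_pow] at h2
      have := Real.log_two_gt_d9
      push_cast at h2
      linarith
    have h1 : 1 + 3 * p ≤ y := by
      have := hlow t ht0
      nlinarith
    have h2 : 4 ≤ s ^ 2 * y := by
      have := mul_le_mul_of_nonneg_left h1 (sq_nonneg s)
      have e : s ^ 2 * (1 + 3 * p) = s ^ 2 + 3 * s := by
        rw [mul_add, mul_one]
        linear_combination (3 * s) * hsp
      nlinarith
    have := mul_le_mul_of_nonneg_left h2 hν.le
    linarith
  linarith

end StepParams

/-! ### The exponential of a real periodic function -/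

namespace WAlg

/-- The function represented by `a` is real valued. -/
def RealValued {w : Weight d} (a : WAlg w) : Prop := ∀ x, (ev a x).im = 0

theorem norm_coef_exp_le_one {w : Weight d} {g : WAlg w} (hg : RealValued g) (l : Fin d → ℤ) :
    ‖coef (NormedSpace.exp (Complex.I • g)) l‖ ≤ 1 := by
  rw [← fc_ev]
  refine norm_fc_le_one (fun x => ?_) l
  rw [ev_exp, ev_smul, Complex.norm_exp]
  simp [hg x]

theorem norm_exp_le_norm {w : Weight d} (a : WAlg w) :
    ‖NormedSpace.exp a‖ ≤ Real.exp ‖a‖ := by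
  have h1 := NormedSpace.exp_series_hasSum_exp' (𝕂 := ℂ) a
  have h2 := NormedSpace.exp_series_hasSum_exp' (𝕂 := ℝ) ‖a‖
  rw [← Real.exp_eq_exp_ℝ] at h2
  refine h1.norm_le_of_bounded h2 fun n => ?_
  rw [norm_smul, norm_inv, Complex.norm_natCast, smul_eq_mul]
  exact mul_le_mul_of_nonneg_left (norm_pow_le a n) (by positivity)

/-- For real `g`, the norm of `e^{ig}` grows at most like `e^{c K^{1/s}}`, where `K` bounds
`∑ |n| |g_n| e^{r|n|^{1/s}}`. -/
theorem norm_exp_real_le {s r ν K : ℝ} (hs : 1 ≤ s) (hν : 0 < ν) (hr : (1 + s) * ν ≤ r)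
    (hr0 : 0 ≤ r) (hK : 0 < K) {g : WAlg (gev d s r hs hr0)} (hg : RealValued g)
    (hgs : Summable fun k => l1Z k * ‖coef g k‖ * Real.exp (r * gexp s k))
    (hgK : ∑' k, l1Z k * ‖coef g k‖ * Real.exp (r * gexp s k) ≤ K) :
    ‖NormedSpace.exp (Complex.I • g)‖ ≤ Cnu d s ν * Real.exp ((s + 1 / 2) * K ^ (1 / s)) := by
  have hs0 : 0 < s := by linarith
  set v := NormedSpace.exp (Complex.I • g) with hv
  set p := 1 / s with hp
  have hp0 : 0 < p := by positivity
  have hsp : s * p = 1 := by rw [hp]; field_simp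
  set V : (Fin d → ℤ) → ℝ := fun k => ‖coef v k‖ with hVdef
  set G : (Fin d → ℤ) → ℝ := fun k => l1Z k * ‖coef g k‖ with hGdef
  have hV0 : ∀ k, 0 ≤ V k := fun k => norm_nonneg _
  have hG0 : ∀ k, 0 ≤ G k := fun k => mul_nonneg (l1Z_nonneg k) (norm_nonneg _)
  have hVs : Summable fun k => V k * Real.exp (r * gexp s k) := summable_norm v
  have hkey : ∀ l, l1Z l * V l ≤ ∑' n, G n * V (l - n) := l1Z_mul_coef_exp_le g hgs
  have hνr : ν ≤ r := by nlinarith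
  have hexp : ∀ k : Fin d → ℤ, Real.exp (ν * gexp s k) ≤ Real.exp (r * gexp s k) := fun k =>
    Real.exp_le_exp.mpr (mul_le_mul_of_nonneg_right hνr (gexp_nonneg s k))
  have hGν : Summable fun k => G k * Real.exp (ν * gexp s k) :=
    hgs.of_nonneg_of_le (fun k => mul_nonneg (hG0 k) (Real.exp_pos _).le)
      fun k => mul_le_mul_of_nonneg_left (hexp k) (hG0 k)
  have hVν : Summable fun k => V k * Real.exp (ν * gexp s k) :=
    hVs.of_nonneg_of_le (fun k => mul_nonneg (hV0 k) (Real.exp_pos _).le)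
      fun k => mul_le_mul_of_nonneg_left (hexp k) (hV0 k)
  set N := ∑' k, G k * Real.exp (ν * gexp s k) with hN
  have hN0 : 0 ≤ N := tsum_nonneg fun k => mul_nonneg (hG0 k) (Real.exp_pos _).le
  -- Without a zero mode, passing from the width r ≥ (1+s)ν to ν gains e^{-sν}; the power 1/s turns
  -- this into e^{-ν}.
  have hNK : N ≤ K * Real.exp (-(s * ν)) := by
    have h1 : N ≤ ∑' k, G k * Real.exp (r * gexp s k) * Real.exp (-(s * ν)) := by
      refine hGν.tsum_le_tsum (fun k => ?_) (hgs.mul_right _)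
      by_cases hk : k = 0
      · simp [hk, hGdef]
      · rw [mul_assoc (G k), ← Real.exp_add]
        refine mul_le_mul_of_nonneg_left (Real.exp_le_exp.mpr ?_) (hG0 k)
        have := one_le_gexp hs hk
        nlinarith
    rw [tsum_mul_right] at h1
    exact h1.trans (mul_le_mul_of_nonneg_right hgK (Real.exp_pos _).le)
  -- The inequality νe^{-ν} ≤ 1/2 is the origin of the summand 1/2 in s + 1/2.
  have hNp : ν * N ^ p ≤ 1 / 2 * K ^ p := by
    have h1 : N ^ p ≤ K ^ p * Real.exp (-ν) := by
      have := Real.rpow_le_rpow hN0 hNK hp0.le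
      rw [Real.mul_rpow hK.le (Real.exp_pos _).le, ← Real.exp_mul] at this
      rwa [show -(s * ν) * p = -ν by linear_combination (-ν) * hsp] at this
    have h2 : ν * Real.exp (-ν) ≤ 1 / 2 := by
      rw [Real.exp_neg, ← div_eq_mul_inv, div_le_iff₀ (Real.exp_pos _)]
      have := Real.quadratic_le_exp_of_nonneg hν.le
      nlinarith [sq_nonneg (ν - 1)]
    have hKp : 0 < K ^ p := Real.rpow_pos_of_pos hK p
    nlinarith [mul_le_mul_of_nonneg_left h1 hν.le, mul_le_mul_of_nonneg_right h2 hKp.le]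
  have hsup : ∀ l, V l ≤ Real.exp (1 / 2 * K ^ p) * Real.exp (-ν * gexp s l) := by
    intro l
    have h := decay_sup hs hν.le hV0 hG0 (norm_coef_exp_le_one hg) hGν hVν hkey l
    have h2 := h.trans (Real.exp_le_exp.mpr hNp)
    rw [neg_mul, Real.exp_neg, ← div_eq_mul_inv, le_div_iff₀ (Real.exp_pos _)]
    exact h2
  -- The pointwise bound at width ν leaves the summable factor e^{-ν|l|^{1/s}}, hence C_ν at width
  -- 0. `decay_sum` then raises the width to r at the price e^{sK^p}.
  have hsumV : ∑' k, V k ≤ Real.exp (1 / 2 * K ^ p) * Cnu d s ν := by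
    rw [Cnu_eq, ← tsum_mul_left]
    exact (summable_coef v).tsum_le_tsum hsup ((summable_gevrey hs hν).mul_left _)
  have hfin := decay_sum hs hr0 hK hV0 hG0 (by simp [hGdef]) hgs hgK hVs hkey
  rw [norm_eq]
  refine hfin.trans ((mul_le_mul_of_nonneg_right hsumV (Real.exp_pos _).le).trans (le_of_eq ?_))
  rw [mul_comm (Real.exp _) (Cnu d s ν), mul_assoc, ← Real.exp_add, ← hp]
  congr 2
  ring

end WAlg

/-- The norm of `e^{ig}` for real `g` with `∑ (1+|n|) |g_n| e^{ρ'|n|^{1/s}} ≤ tR`. -/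
theorem StepParams.norm_exp_le {s ρ ν σ a : ℝ} (P : StepParams d s ρ ν σ a) {t : ℝ} (ht : 1 ≤ t)
    {g : WAlg (gev d s (radius1 d s ν ρ) P.hs P.radius1_pos.le)} (hg : WAlg.RealValued g)
    (hgs : Summable fun k =>
      (1 + l1Z k) * (‖WAlg.coef g k‖ * Real.exp (radius1 d s ν ρ * gexp s k)))
    (hgK : ∑' k, (1 + l1Z k) * (‖WAlg.coef g k‖ * Real.exp (radius1 d s ν ρ * gexp s k))
      ≤ t * dispRadius d s ν σ a) :
    ‖NormedSpace.exp (Complex.I • g)‖ ≤ Real.exp (1 - ν + beta d s ^ 2 * ν * t ^ (1 / s)) := by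
  have hpos : ∀ k, 0 ≤ ‖WAlg.coef g k‖ * Real.exp (radius1 d s ν ρ * gexp s k) := fun k =>
    mul_nonneg (norm_nonneg _) (Real.exp_pos _).le
  -- For tR ≤ 1 the power series of the exponential costs only e, which is affordable because
  -- β²t^{1/s} ≥ 1. The Gevrey estimate is needed only for high frequencies.
  rcases le_total (t * dispRadius d s ν σ a) 1 with h1 | h1
  · refine (WAlg.norm_exp_le_norm _).trans (Real.exp_le_exp.mpr ?_)
    rw [norm_smul, Complex.norm_I, one_mul]
    have h2 : ‖g‖ ≤ 1 := by
      rw [WAlg.norm_eq]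
      refine le_trans ?_ (hgK.trans h1)
      refine (WAlg.summable_norm g).tsum_le_tsum (fun k => ?_) hgs
      exact le_mul_of_one_le_left (hpos k) (by linarith [l1Z_nonneg k])
    have h3 : 1 ≤ beta d s ^ 2 * t ^ (1 / s) :=
      one_le_mul_of_one_le_of_one_le (one_le_pow₀ P.one_le_beta)
        (Real.one_le_rpow ht (by have := P.s_pos; positivity))
    have := mul_le_mul_of_nonneg_left h3 P.hν.le
    linarith
  · have hle : ∀ k, l1Z k * ‖WAlg.coef g k‖ * Real.exp (radius1 d s ν ρ * gexp s k) ≤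
        (1 + l1Z k) * (‖WAlg.coef g k‖ * Real.exp (radius1 d s ν ρ * gexp s k)) := fun k => by
      have := hpos k
      linarith
    have hs' := hgs.of_nonneg_of_le (fun k => mul_nonneg (mul_nonneg (l1Z_nonneg k)
      (norm_nonneg _)) (Real.exp_pos _).le) hle
    have hr : (1 + s) * ν ≤ radius1 d s ν ρ :=
      (mul_le_mul_of_nonneg_right (by linarith [P.s_le_beta]) P.hν.le).trans P.radius1_ge
    refine (WAlg.norm_exp_real_le P.hs P.hν hr P.radius1_pos.le (one_pos.trans_le h1) hg hs'
      ((hs'.tsum_le_tsum hle hgs).trans hgK)).trans ?_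
    have hC : 0 < Cnu d s ν := one_pos.trans_le P.one_le_C
    nth_rewrite 1 [← Real.exp_log hC]
    rw [← Real.exp_add, Real.exp_le_exp]
    exact P.exponent_le h1

end GevreyRenorm

namespace GevreyRenorm

variable {d : ℕ}

namespace WAlg

variable {w : Weight d}

/-! ### Real valued elements -/

theorem RealValued.coef_neg {a : WAlg w} (ha : RealValued a) (k : Fin d → ℤ) :
    coef a (-k) = (starRingEnd ℂ) (coef a k) := by
  have h : ∀ x, ev a x = ((ev a x).re : ℂ) := fun x => Complex.ext rfl (by simp [ha x])
  rw [← fc_ev, ← fc_ev, fc_congr h, fc_ofReal_neg, ← fc_congr h]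

theorem realValued_of_coef {a : WAlg w}
    (ha : ∀ k, coef a (-k) = (starRingEnd ℂ) (coef a k)) : RealValued a := fun x => by
  rw [← Complex.conj_eq_iff_im, ev, Complex.conj_tsum]
  rw [← (Equiv.neg (Fin d → ℤ)).tsum_eq]
  refine tsum_congr fun k => ?_
  rw [Equiv.neg_apply, map_mul, ha, Complex.conj_conj, chi_neg_left, Complex.conj_conj]

theorem RealValued.add {a b : WAlg w} (ha : RealValued a) (hb : RealValued b) :
    RealValued (a + b) := fun x => by rw [ev_add, Complex.add_im, ha x, hb x, add_zero]

theorem RealValued.sub {a b : WAlg w} (ha : RealValued a) (hb : RealValued b) :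
    RealValued (a - b) := fun x => by rw [ev_sub, Complex.sub_im, ha x, hb x, sub_zero]

theorem RealValued.mul {a b : WAlg w} (ha : RealValued a) (hb : RealValued b) :
    RealValued (a * b) := fun x => by rw [ev_mul, Complex.mul_im, ha x, hb x]; ring

theorem RealValued.real_smul {a : WAlg w} (ha : RealValued a) (c : ℝ) :
    RealValued ((c : ℂ) • a) := fun x => by rw [ev_smul, Complex.mul_im, ha x]; simp

theorem realValued_zero : RealValued (0 : WAlg w) := fun x => by simp

theorem realValued_sum {ι : Type*} {S : Finset ι} {f : ι → WAlg w}
    (h : ∀ i ∈ S, RealValued (f i)) : RealValued (∑ i ∈ S, f i) := fun x => by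
  rw [ev_sum, Complex.im_sum]
  exact Finset.sum_eq_zero fun i hi => h i hi x

theorem isClosed_realValued : IsClosed {a : WAlg w | RealValued a} := by
  have : {a : WAlg w | RealValued a} = ⋂ x, {a | (evHom w x a).im = 0} := by
    ext a; simp [RealValued]
  rw [this]
  exact isClosed_iInter fun x =>
    isClosed_eq (Complex.continuous_im.comp (continuous_evHom x)) continuous_const

/-! ### The weighted norm with one derivative -/

/-- The sum `∑ (1 + |n|) |u_n| w_n` over all components of `u` is finite and at most `B`. -/
def NPrimeLE (u : Fin d → WAlg w) (B : ℝ) : Prop :=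
  (∀ j, Summable fun n => (1 + l1Z n) * (‖coef (u j) n‖ * w n)) ∧
    ∑ j, ∑' n, (1 + l1Z n) * (‖coef (u j) n‖ * w n) ≤ B

theorem nPrime_term_nonneg (a : WAlg w) (n : Fin d → ℤ) :
    0 ≤ (1 + l1Z n) * (‖coef a n‖ * w n) :=
  mul_nonneg (by linarith [l1Z_nonneg n]) (mul_nonneg (norm_nonneg _) (weight_pos w n).le)

theorem nPrimeLE_zero {B : ℝ} (hB : 0 ≤ B) : NPrimeLE (0 : Fin d → WAlg w) B :=
  ⟨fun j => by simp, by simpa using hB⟩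

/-- A linear combination of a vector satisfying `NPrimeLE`. -/
theorem NPrimeLE.comb {u v : Fin d → WAlg w} {B C : ℝ} (hu : NPrimeLE u B) (hv : NPrimeLE v C)
    {x y : ℝ} (hx : 0 ≤ x) (hy : 0 ≤ y) :
    NPrimeLE (fun j => (x : ℂ) • u j + (y : ℂ) • v j) (x * B + y * C) := by
  have hle : ∀ j n, (1 + l1Z n) * (‖coef ((x : ℂ) • u j + (y : ℂ) • v j) n‖ * w n) ≤
      x * ((1 + l1Z n) * (‖coef (u j) n‖ * w n)) + y * ((1 + l1Z n) * (‖coef (v j) n‖ * w n)) := by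
    intro j n
    have h1 : ‖coef ((x : ℂ) • u j + (y : ℂ) • v j) n‖ ≤ x * ‖coef (u j) n‖ + y * ‖coef (v j) n‖ := by
      rw [coef_add, coef_smul, coef_smul]
      refine (norm_add_le _ _).trans (le_of_eq ?_)
      rw [norm_mul, norm_mul, Complex.norm_real, Complex.norm_real, Real.norm_of_nonneg hx,
        Real.norm_of_nonneg hy]
    have h2 : 0 ≤ (1 + l1Z n) * w n :=
      mul_nonneg (by linarith [l1Z_nonneg n]) (weight_pos w n).le
    have := mul_le_mul_of_nonneg_left h1 h2
    linarith
  have hs : ∀ j, Summable fun n => x * ((1 + l1Z n) * (‖coef (u j) n‖ * w n)) +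
      y * ((1 + l1Z n) * (‖coef (v j) n‖ * w n)) := fun j =>
    ((hu.1 j).mul_left x).add ((hv.1 j).mul_left y)
  have hs' : ∀ j, Summable fun n =>
      (1 + l1Z n) * (‖coef ((x : ℂ) • u j + (y : ℂ) • v j) n‖ * w n) := fun j =>
    (hs j).of_nonneg_of_le (nPrime_term_nonneg _) (hle j)
  refine ⟨hs', ?_⟩
  calc _ ≤ ∑ j, (x * ∑' n, (1 + l1Z n) * (‖coef (u j) n‖ * w n) +
        y * ∑' n, (1 + l1Z n) * (‖coef (v j) n‖ * w n)) := by
        refine Finset.sum_le_sum fun j _ => ((hs' j).tsum_le_tsum (hle j) (hs j)).trans ?_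
        rw [((hu.1 j).mul_left x).tsum_add ((hv.1 j).mul_left y), tsum_mul_left, tsum_mul_left]
    _ = x * ∑ j, ∑' n, (1 + l1Z n) * (‖coef (u j) n‖ * w n) +
        y * ∑ j, ∑' n, (1 + l1Z n) * (‖coef (v j) n‖ * w n) := by
        rw [Finset.sum_add_distrib, Finset.mul_sum, Finset.mul_sum]
    _ ≤ _ := add_le_add (mul_le_mul_of_nonneg_left hu.2 hx) (mul_le_mul_of_nonneg_left hv.2 hy)

/-! ### Composition with `id + u` -/

/-- `k · u`. -/
noncomputable def dotU (k : Fin d → ℤ) (u : Fin d → WAlg w) : WAlg w :=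
  ∑ j, (((k j : ℤ) : ℝ) : ℂ) • u j

theorem RealValued.dotU {u : Fin d → WAlg w} (hu : ∀ j, RealValued (u j)) (k : Fin d → ℤ) :
    RealValued (dotU k u) := realValued_sum fun j _ => (hu j).real_smul _

theorem norm_coef_dotU_le (k : Fin d → ℤ) (u : Fin d → WAlg w) (n : Fin d → ℤ) :
    ‖coef (dotU k u) n‖ ≤ l1Z k * ∑ j, ‖coef (u j) n‖ := by
  rw [dotU, coef_sum, Finset.mul_sum]
  refine (norm_sum_le _ _).trans (Finset.sum_le_sum fun j _ => ?_)
  rw [coef_smul, norm_mul, Complex.norm_real, Real.norm_eq_abs]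
  exact mul_le_mul_of_nonneg_right (abs_le_l1Z k j) (norm_nonneg _)

theorem norm_dotU_le (k : Fin d → ℤ) (u : Fin d → WAlg w) :
    ‖dotU k u‖ ≤ l1Z k * ∑ j, ‖u j‖ := by
  rw [dotU, Finset.mul_sum]
  refine (norm_sum_le _ _).trans (Finset.sum_le_sum fun j _ => ?_)
  rw [norm_smul, Complex.norm_real, Real.norm_eq_abs]
  exact mul_le_mul_of_nonneg_right (abs_le_l1Z k j) (norm_nonneg _)

/-- Prepares `norm_exp_le` for g = k·u, with t = |k| and B the radius of the ball of displacements.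
-/
theorem nPrime_dotU (k : Fin d → ℤ) {u : Fin d → WAlg w} {B : ℝ} (hu : NPrimeLE u B) :
    (Summable fun n => (1 + l1Z n) * (‖coef (dotU k u) n‖ * w n)) ∧
      ∑' n, (1 + l1Z n) * (‖coef (dotU k u) n‖ * w n) ≤ l1Z k * B := by
  have hle : ∀ n, (1 + l1Z n) * (‖coef (dotU k u) n‖ * w n) ≤
      l1Z k * ∑ j, (1 + l1Z n) * (‖coef (u j) n‖ * w n) := by
    intro n
    have h2 : 0 ≤ (1 + l1Z n) * w n :=
      mul_nonneg (by linarith [l1Z_nonneg n]) (weight_pos w n).le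
    have := mul_le_mul_of_nonneg_left (norm_coef_dotU_le k u n) h2
    rw [← Finset.mul_sum, ← Finset.sum_mul]
    linarith
  have hs : Summable fun n => l1Z k * ∑ j, (1 + l1Z n) * (‖coef (u j) n‖ * w n) :=
    (summable_sum fun j _ => hu.1 j).mul_left _
  have hs' := hs.of_nonneg_of_le (nPrime_term_nonneg _) hle
  refine ⟨hs', (hs'.tsum_le_tsum hle hs).trans ?_⟩
  rw [tsum_mul_left, Summable.tsum_finsetSum fun j _ => hu.1 j]
  exact mul_le_mul_of_nonneg_left hu.2 (l1Z_nonneg k)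

/-- `e^{ik·(x+u(x))}`. -/
noncomputable def wave (k : Fin d → ℤ) (u : Fin d → WAlg w) : WAlg w :=
  char w k * NormedSpace.exp (Complex.I • dotU k u)

theorem wave_zero_left (u : Fin d → WAlg w) : wave 0 u = 1 := by
  rw [wave, show dotU (0 : Fin d → ℤ) u = 0 by simp [dotU], smul_zero, NormedSpace.exp_zero, mul_one]
  rfl

theorem wave_zero_right (k : Fin d → ℤ) : wave k (0 : Fin d → WAlg w) = char w k := by
  rw [wave, show dotU k (0 : Fin d → WAlg w) = 0 by simp [dotU], smul_zero, NormedSpace.exp_zero,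
    mul_one]

/-- The displacement represented by `u`. -/
noncomputable def evVec (u : Fin d → WAlg w) (x : Fin d → ℝ) : Fin d → ℝ :=
  fun j => (ev (u j) x).re

/-- Reality of the components is what lets their real parts, used as the displacement, be
substituted in the exponent. -/
theorem ev_wave (k : Fin d → ℤ) {u : Fin d → WAlg w} (hu : ∀ j, RealValued (u j))
    (x : Fin d → ℝ) : ev (wave k u) x = chi k (x + evVec u x) := by
  rw [wave, ev_mul, ev_char, ev_exp, ev_smul, chi_add_right]
  congr 1
  rw [chi]
  congr 2
  rw [dotU, ev_sum, dotZ]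
  push_cast
  refine Finset.sum_congr rfl fun j _ => ?_
  rw [ev_smul]
  have : ev (u j) x = ((evVec u x j : ℝ) : ℂ) := Complex.ext rfl (by simp [hu j x])
  rw [this]

end WAlg

open WAlg

/-! ### Composition with small real displacements, from width ρ to width ρ' -/

namespace StepParams

variable {s ρ ν σ a : ℝ} (P : StepParams d s ρ ν σ a)

/-- The weight of the space `𝓕_{ρ'}`. -/
noncomputable abbrev W : Weight d := gev d s (radius1 d s ν ρ) P.hs P.radius1_pos.le

/-- Real displacements in the ball on which composition is controlled. -/
def Adm (u : Fin d → WAlg P.W) : Prop :=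
  (∀ j, RealValued (u j)) ∧ NPrimeLE u (dispRadius d s ν σ a)

include P in
theorem gexp_width_le (k : Fin d → ℤ) :
    radius1 d s ν ρ * gexp s k + beta d s ^ 2 * ν * gexp s k ≤ ρ * gexp s k := by
  rw [← add_mul]
  exact mul_le_mul_of_nonneg_right P.radius1_add_le (gexp_nonneg s k)

/-- The character costs e^{ρ'|k|^{1/s}} and the exponential e^{1-ν+β²ν|k|^{1/s}}; together these fit
in the width ρ. The factor e^{-ν} left over on nonzero modes is essential for the smallness
conditions that follow. -/
theorem norm_wave_le {u : Fin d → WAlg P.W} (hu : P.Adm u) {k : Fin d → ℤ} (hk : k ≠ 0) :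
    ‖wave k u‖ ≤ Real.exp (1 - ν) * Real.exp (ρ * gexp s k) := by
  obtain ⟨h1, h2⟩ := nPrime_dotU k hu.2
  have h3 := P.norm_exp_le (one_le_l1Z hk) (RealValued.dotU hu.1 k) h1 h2
  refine (norm_mul_le _ _).trans ?_
  rw [norm_char, gev_apply]
  refine (mul_le_mul_of_nonneg_left h3 (Real.exp_pos _).le).trans ?_
  rw [← Real.exp_add, ← Real.exp_add, Real.exp_le_exp]
  have := P.gexp_width_le k
  rw [gexp] at *
  linarith

theorem Adm.segment {P : StepParams d s ρ ν σ a} {u v : Fin d → WAlg P.W} (hu : P.Adm u)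
    (hv : P.Adm v) {θ : ℝ} (h0 : 0 ≤ θ) (h1 : θ ≤ 1) :
    P.Adm (fun j => (θ : ℂ) • u j + ((1 - θ : ℝ) : ℂ) • v j) := by
  refine ⟨fun j => ((hu.1 j).real_smul θ).add ((hv.1 j).real_smul (1 - θ)), ?_⟩
  have := hu.2.comb hv.2 h0 (sub_nonneg.mpr h1)
  rwa [← add_mul, add_sub_cancel, one_mul] at this

theorem adm_zero : P.Adm 0 := ⟨fun _ => realValued_zero, nPrimeLE_zero P.dispRadius_pos.le⟩

/-- Mean value inequality along the segment from v to u, which stays admissible by convexity. The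
derivative brings down one factor k·(u - v), and hence the |k| that the primed norm of the field
pays for. -/
theorem norm_wave_sub_le {u v : Fin d → WAlg P.W} (hu : P.Adm u) (hv : P.Adm v)
    (k : Fin d → ℤ) :
    ‖wave k u - wave k v‖ ≤
      Real.exp (1 - ν) * (l1Z k * Real.exp (ρ * gexp s k)) * ∑ j, ‖u j - v j‖ := by
  by_cases hk : k = 0
  · subst hk
    simp [wave_zero_left]
  set z : ℝ → Fin d → WAlg P.W := fun θ j => (θ : ℂ) • u j + ((1 - θ : ℝ) : ℂ) • v j with hz
  have hzθ : ∀ θ, dotU k (z θ) = dotU k v + (θ : ℂ) • dotU k (u - v) := by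
    intro θ
    simp only [dotU, hz, Finset.smul_sum, ← Finset.sum_add_distrib]
    refine Finset.sum_congr rfl fun j _ => ?_
    rw [Pi.sub_apply]
    push_cast
    module
  have hder : ∀ θ : ℝ, HasDerivAt (fun θ => wave k (z θ))
      (wave k (z θ) * (Complex.I • dotU k (u - v))) θ := by
    intro θ
    have h1 : HasDerivAt (fun θ : ℝ => Complex.I • dotU k (z θ)) (Complex.I • dotU k (u - v)) θ := by
      simp only [hzθ]
      have h2 : HasDerivAt (fun θ : ℝ => (θ : ℂ)) 1 θ := Complex.ofRealCLM.hasDerivAt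
      have h3 := ((h2.smul_const (dotU k (u - v))).const_add (dotU k v)).const_smul Complex.I
      exact h3.congr_deriv (by rw [one_smul])
    have h4 : HasFDerivAt (NormedSpace.exp : WAlg P.W → WAlg P.W)
        (NormedSpace.exp (Complex.I • dotU k (z θ)) • (1 : WAlg P.W →L[ℝ] WAlg P.W))
        (Complex.I • dotU k (z θ)) := hasFDerivAt_exp
    have h5 := (h4.comp_hasDerivAt θ h1).const_mul (char P.W k)
    refine h5.congr_deriv ?_
    simp only [_root_.smul_apply, one_apply_eq_self, smul_eq_mul, wave,
      mul_assoc]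
  have h := norm_image_sub_le_of_norm_deriv_le_segment_01' (f := fun θ => wave k (z θ))
    (C := Real.exp (1 - ν) * (l1Z k * Real.exp (ρ * gexp s k)) * ∑ j, ‖u j - v j‖)
    (fun θ _ => (hder θ).hasDerivWithinAt) (fun θ hθ => by
      refine (norm_mul_le _ _).trans ?_
      rw [norm_smul, Complex.norm_I, one_mul]
      have h6 := P.norm_wave_le (hu.segment hv hθ.1 hθ.2.le) hk
      have h7 := norm_dotU_le k (u - v)
      refine (mul_le_mul h6 h7 (norm_nonneg _) (by positivity)).trans (le_of_eq ?_)
      simp only [Pi.sub_apply]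
      ring)
  have e1 : z 1 = u := by ext1 j; simp [hz]
  have e0 : z 0 = v := by ext1 j; simp [hz]
  simpa only [e1, e0] using h

/-- Coefficients with `∑ (1+|k|) |c_k| e^{ρ|k|^{1/s}} < ∞`. -/
def Coefs (s ρ : ℝ) (c : (Fin d → ℤ) → ℂ) : Prop :=
  Summable fun k => (1 + l1Z k) * (‖c k‖ * Real.exp (ρ * gexp s k))

theorem Coefs.summable {c : (Fin d → ℤ) → ℂ} (hc : Coefs s ρ c) :
    Summable fun k => ‖c k‖ * Real.exp (ρ * gexp s k) :=
  Summable.of_nonneg_of_le (fun k => mul_nonneg (norm_nonneg _) (Real.exp_pos _).le)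
    (fun k => le_mul_of_one_le_left (mul_nonneg (norm_nonneg _) (Real.exp_pos _).le)
      (by linarith [l1Z_nonneg k])) hc

theorem Coefs.summable' {c : (Fin d → ℤ) → ℂ} (hc : Coefs s ρ c) :
    Summable fun k => ‖c k‖ * (l1Z k * Real.exp (ρ * gexp s k)) :=
  Summable.of_nonneg_of_le (fun k => mul_nonneg (norm_nonneg _)
      (mul_nonneg (l1Z_nonneg k) (Real.exp_pos _).le))
    (fun k => by
      have : 0 ≤ ‖c k‖ * Real.exp (ρ * gexp s k) := by positivity
      linarith) hc

/-- The composition of the Fourier series with coefficients `c` with `id + u`. -/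
noncomputable def comp (c : (Fin d → ℤ) → ℂ) (u : Fin d → WAlg P.W) : WAlg P.W :=
  ∑' k, c k • wave k u

/-- The zero mode stands apart: its wave is 1 and does not gain e^{-ν}. Its coefficient has to be
small for another reason, recorded in `SmallField.const_le`. -/
theorem norm_smul_wave_le (c : (Fin d → ℤ) → ℂ) {u : Fin d → WAlg P.W} (hu : P.Adm u)
    (k : Fin d → ℤ) : ‖c k • wave k u‖ ≤ (Pi.single 0 ‖c 0‖ : (Fin d → ℤ) → ℝ) k +
      Real.exp (1 - ν) * (‖c k‖ * Real.exp (ρ * gexp s k)) := by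
  rw [norm_smul]
  by_cases hk : k = 0
  · subst hk
    rw [wave_zero_left, norm_one, mul_one, Pi.single_eq_same]
    exact le_add_of_nonneg_right (by positivity)
  · rw [Pi.single_eq_of_ne hk, zero_add]
    have := mul_le_mul_of_nonneg_left (P.norm_wave_le hu hk) (norm_nonneg (c k))
    linarith

theorem summable_single_add {c : (Fin d → ℤ) → ℂ} (hc : Coefs s ρ c) :
    Summable fun k => (Pi.single 0 ‖c 0‖ : (Fin d → ℤ) → ℝ) k +
      Real.exp (1 - ν) * (‖c k‖ * Real.exp (ρ * gexp s k)) :=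
  (hasSum_pi_single 0 ‖c 0‖).summable.add (hc.summable.mul_left _)

theorem summable_comp {c : (Fin d → ℤ) → ℂ} (hc : Coefs s ρ c) {u : Fin d → WAlg P.W}
    (hu : P.Adm u) : Summable fun k => ‖c k • wave k u‖ :=
  (summable_single_add (ν := ν) hc).of_nonneg_of_le (fun _ => norm_nonneg _)
    (P.norm_smul_wave_le c hu)

theorem norm_comp_le {c : (Fin d → ℤ) → ℂ} (hc : Coefs s ρ c) {u : Fin d → WAlg P.W}
    (hu : P.Adm u) :
    ‖P.comp c u‖ ≤ ‖c 0‖ + Real.exp (1 - ν) * ∑' k, ‖c k‖ * Real.exp (ρ * gexp s k) := by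
  refine (norm_tsum_le_tsum_norm (P.summable_comp hc hu)).trans ?_
  refine ((P.summable_comp hc hu).tsum_le_tsum (P.norm_smul_wave_le c hu)
    (summable_single_add hc)).trans (le_of_eq ?_)
  rw [(hasSum_pi_single 0 ‖c 0‖).summable.tsum_add (hc.summable.mul_left _), tsum_mul_left,
    (hasSum_pi_single 0 ‖c 0‖).tsum_eq]

theorem norm_comp_sub_le {c : (Fin d → ℤ) → ℂ} (hc : Coefs s ρ c) {u v : Fin d → WAlg P.W}
    (hu : P.Adm u) (hv : P.Adm v) :
    ‖P.comp c u - P.comp c v‖ ≤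
      Real.exp (1 - ν) * (∑' k, ‖c k‖ * (l1Z k * Real.exp (ρ * gexp s k))) *
        ∑ j, ‖u j - v j‖ := by
  have hu' := (P.summable_comp hc hu).of_norm
  have hv' := (P.summable_comp hc hv).of_norm
  have hs := hc.summable'.mul_left (Real.exp (1 - ν) * ∑ j, ‖u j - v j‖)
  have hle : ∀ k, ‖c k • wave k u - c k • wave k v‖ ≤ Real.exp (1 - ν) * (∑ j, ‖u j - v j‖) *
      (‖c k‖ * (l1Z k * Real.exp (ρ * gexp s k))) := by
    intro k
    rw [← smul_sub, norm_smul]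
    have := mul_le_mul_of_nonneg_left (P.norm_wave_sub_le hu hv k) (norm_nonneg (c k))
    linarith
  rw [comp, comp, ← hu'.tsum_sub hv']
  have hs' := hs.of_nonneg_of_le (fun _ => norm_nonneg _) hle
  refine (norm_tsum_le_tsum_norm hs').trans ((hs'.tsum_le_tsum hle hs).trans (le_of_eq ?_))
  rw [tsum_mul_left]
  ring

theorem ev_comp {c : (Fin d → ℤ) → ℂ} (hc : Coefs s ρ c) {u : Fin d → WAlg P.W}
    (hu : P.Adm u) (x : Fin d → ℝ) :
    ev (P.comp c u) x = ∑' k, c k * chi k (x + evVec u x) := by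
  have h := (P.summable_comp hc hu).of_norm.hasSum
  have h2 := h.map (evHom P.W x) (continuous_evHom x)
  rw [comp, ← evHom_apply, ← h2.tsum_eq]
  refine tsum_congr fun k => ?_
  rw [Function.comp, evHom_apply, ev_smul, ev_wave k hu.1]

theorem coef_comp_zero {c : (Fin d → ℤ) → ℂ} (hc : Coefs s ρ c) (l : Fin d → ℤ) :
    coef (P.comp c 0) l = c l := by
  have h := (P.summable_comp hc P.adm_zero).of_norm.hasSum
  have h2 := (coefCLM P.W l).hasSum h
  rw [comp, ← coefCLM_apply, ← h2.tsum_eq, tsum_eq_single l]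
  · simp [wave_zero_right, coef_char]
  · intro k hk
    simp [wave_zero_right, coef_char, Pi.single_eq_of_ne hk.symm]

end StepParams

end GevreyRenorm

/-! ### Contractions in the sum norm -/

namespace GevreyRenorm

variable {d : ℕ}

/-- A contraction with respect to the sum of the norms of the components has a fixed point. -/
theorem exists_fixedPoint_sum {ι E : Type*} [Fintype ι] [NormedAddCommGroup E] [CompleteSpace E]
    {S : Set (ι → E)} (hS : IsClosed S) (Ψ : (ι → E) → (ι → E)) (hmaps : Set.MapsTo Ψ S S)
    (hlip : ∀ u ∈ S, ∀ v ∈ S, ∑ i, ‖Ψ u i - Ψ v i‖ ≤ 1 / 2 * ∑ i, ‖u i - v i‖)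
    {u₀ : ι → E} (h0 : u₀ ∈ S) : ∃ u ∈ S, Ψ u = u := by
  -- A finite product carries the sup norm, for which Ψ need not be a contraction with this
  -- constant, so the argument is moved to the ℓ¹ product.
  let s' : Set (PiLp 1 fun _ : ι => E) := {x | WithLp.ofLp x ∈ S}
  let f : PiLp 1 (fun _ : ι => E) → PiLp 1 (fun _ : ι => E) := fun x =>
    WithLp.toLp 1 (Ψ (WithLp.ofLp x))
  have hs' : IsClosed s' := hS.preimage (PiLp.continuous_ofLp 1 fun _ : ι => E)
  have hf : Set.MapsTo f s' s' := fun x hx => hmaps hx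
  have hc : ContractingWith (1 / 2) (hf.restrict f s' s') := by
    refine ⟨by rw [← NNReal.coe_lt_coe]; norm_num, LipschitzWith.of_dist_le_mul fun x y => ?_⟩
    rw [Subtype.dist_eq, Subtype.dist_eq, PiLp.dist_eq_of_L1, PiLp.dist_eq_of_L1]
    simp only [dist_eq_norm]
    simpa using hlip _ x.2 _ y.2
  obtain ⟨y, hy, hfy, -⟩ := hc.exists_fixedPoint' hs'.isComplete hf
    (x := WithLp.toLp 1 u₀) h0 (edist_ne_top _ _)
  exact ⟨WithLp.ofLp y, hy, congrArg WithLp.ofLp hfy⟩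

namespace WAlg

variable {w : Weight d}

/-! ### Fourier multipliers -/

/-- The Fourier multiplier with the bounded symbol `μ`. -/
noncomputable def mult (μ : (Fin d → ℤ) → ℂ) {B : ℝ} (hμ : ∀ k, ‖μ k‖ ≤ B) (a : WAlg w) : WAlg w :=
  mk (fun k => μ k * coef a k) <| ((summable_norm a).mul_left B).of_nonneg_of_le
    (fun k => mul_nonneg (norm_nonneg _) (weight_pos w k).le) fun k => by
      rw [norm_mul, mul_assoc]
      exact mul_le_mul_of_nonneg_right (hμ k) (mul_nonneg (norm_nonneg _) (weight_pos w k).le)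

variable {μ : (Fin d → ℤ) → ℂ} {B : ℝ} (hμ : ∀ k, ‖μ k‖ ≤ B)

@[simp] theorem coef_mult (a : WAlg w) (k : Fin d → ℤ) : coef (mult μ hμ a) k = μ k * coef a k :=
  coef_mk _ _ k

theorem norm_mult_le (a : WAlg w) : ‖mult μ hμ a‖ ≤ B * ‖a‖ := by
  rw [norm_eq, norm_eq a, ← tsum_mul_left]
  refine (summable_norm _).tsum_le_tsum (fun k => ?_) ((summable_norm a).mul_left B)
  rw [coef_mult, norm_mul, mul_assoc]
  exact mul_le_mul_of_nonneg_right (hμ k) (mul_nonneg (norm_nonneg _) (weight_pos w k).le)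

theorem mult_sub (a b : WAlg w) : mult μ hμ (a - b) = mult μ hμ a - mult μ hμ b :=
  ext fun k => by simp [mul_sub]

theorem RealValued.mult {a : WAlg w} (ha : RealValued a)
    (hherm : ∀ k, μ (-k) = (starRingEnd ℂ) (μ k)) : RealValued (mult μ hμ a) :=
  realValued_of_coef fun k => by rw [coef_mult, coef_mult, ha.coef_neg, hherm, map_mul]

theorem sum_norm_matVec_le {A : Fin d → Fin d → WAlg w} {K : ℝ} (hA : ∀ j, ∑ i, ‖A i j‖ ≤ K)
    (z : Fin d → WAlg w) : ∑ i, ‖∑ j, A i j * z j‖ ≤ K * ∑ j, ‖z j‖ := by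
  calc ∑ i, ‖∑ j, A i j * z j‖ ≤ ∑ i, ∑ j, ‖A i j‖ * ‖z j‖ :=
        Finset.sum_le_sum fun i _ => (norm_sum_le _ _).trans
          (Finset.sum_le_sum fun j _ => norm_mul_le _ _)
    _ = ∑ j, (∑ i, ‖A i j‖) * ‖z j‖ := by
        rw [Finset.sum_comm]; simp only [Finset.sum_mul]
    _ ≤ K * ∑ j, ‖z j‖ := by
        rw [Finset.mul_sum]
        exact Finset.sum_le_sum fun j _ => mul_le_mul_of_nonneg_right (hA j) (norm_nonneg _)

end WAlg

/-! ### Inversion of `D · w` on the far from resonance modes -/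

/-- The symbol of the projection to the far from resonance modes. -/
noncomputable def symFar (σ : ℝ) (ω : Fin d → ℝ) : (Fin d → ℤ) → ℂ :=
  (farModes σ ω).indicator 1

/-- The symbol of the projection to the resonant modes. -/
noncomputable def symRes (σ : ℝ) (ω : Fin d → ℝ) : (Fin d → ℤ) → ℂ :=
  (resModes σ ω).indicator 1

/-- The symbol of the inverse of `u ↦ Du · ω` on the far from resonance modes. -/
noncomputable def symInv (σ : ℝ) (ω : Fin d → ℝ) : (Fin d → ℤ) → ℂ :=
  (farModes σ ω).indicator fun k => (Complex.I * (dotZ k ω : ℂ))⁻¹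

/-- The symbol of `∂_j` composed with the inverse of `u ↦ Du · ω`. -/
noncomputable def symDer (σ : ℝ) (ω : Fin d → ℝ) (j : Fin d) : (Fin d → ℤ) → ℂ :=
  (farModes σ ω).indicator fun k => (k j : ℂ) / (dotZ k ω : ℂ)

section Symbols

variable {σ : ℝ} {ω : Fin d → ℝ}

theorem zero_notMem_farModes : (0 : Fin d → ℤ) ∉ farModes σ ω := by simp [farModes]

theorem neg_mem_farModes {k : Fin d → ℤ} : -k ∈ farModes σ ω ↔ k ∈ farModes σ ω := by
  simp [farModes, dotZ_neg_left]

theorem farModes_dotZ_pos (hσ : 0 < σ) {k : Fin d → ℤ} (hk : k ∈ farModes σ ω) :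
    0 < |dotZ k ω| := (mul_nonneg hσ.le (l1Z_nonneg k)).trans_lt hk

theorem norm_symFar_le (k : Fin d → ℤ) : ‖symFar σ ω k‖ ≤ 1 := by
  by_cases hk : k ∈ farModes σ ω <;> simp [symFar, hk]

theorem norm_symRes_le (k : Fin d → ℤ) : ‖symRes σ ω k‖ ≤ 1 := by
  by_cases hk : k ∈ resModes σ ω <;> simp [symRes, hk]

theorem symFar_add_symRes (k : Fin d → ℤ) : symFar σ ω k + symRes σ ω k = 1 := by
  by_cases hk : k ∈ farModes σ ω <;> simp [symFar, symRes, resModes, hk]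

/-- On far modes the divisor exceeds σ|k|: there are no small divisors, and the inverse even gains
one derivative. -/
theorem l1Z_mul_norm_symInv_le (hσ : 0 < σ) (k : Fin d → ℤ) :
    l1Z k * ‖symInv σ ω k‖ ≤ σ⁻¹ := by
  by_cases hk : k ∈ farModes σ ω
  · have h := farModes_dotZ_pos hσ hk
    rw [symInv, Set.indicator_of_mem hk, norm_inv, norm_mul, Complex.norm_I, one_mul,
      Complex.norm_real, Real.norm_eq_abs, ← div_eq_mul_inv, div_le_iff₀ h, inv_mul_eq_div,
      le_div_iff₀ hσ, mul_comm]
    exact le_of_lt hk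
  · rw [symInv, Set.indicator_of_notMem hk, norm_zero, mul_zero]
    positivity

theorem norm_symInv_le (hσ : 0 < σ) (k : Fin d → ℤ) : ‖symInv σ ω k‖ ≤ σ⁻¹ := by
  by_cases hk : k = 0
  · rw [symInv, hk, Set.indicator_of_notMem zero_notMem_farModes, norm_zero]
    positivity
  · refine le_trans ?_ (l1Z_mul_norm_symInv_le (ω := ω) hσ k)
    exact le_mul_of_one_le_left (norm_nonneg _) (one_le_l1Z hk)

theorem symDer_eq (hσ : 0 < σ) (j : Fin d) (k : Fin d → ℤ) :
    symDer σ ω j k = Complex.I * (k j : ℂ) * symInv σ ω k := by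
  by_cases hk : k ∈ farModes σ ω
  · have h : (dotZ k ω : ℂ) ≠ 0 :=
      Complex.ofReal_ne_zero.mpr (abs_pos.mp (farModes_dotZ_pos hσ hk))
    rw [symDer, symInv, Set.indicator_of_mem hk, Set.indicator_of_mem hk]
    field_simp
  · simp [symDer, symInv, hk]

theorem norm_symDer_le (hσ : 0 < σ) (j : Fin d) (k : Fin d → ℤ) : ‖symDer σ ω j k‖ ≤ σ⁻¹ := by
  rw [symDer_eq hσ, norm_mul, norm_mul, Complex.norm_I, one_mul, Complex.norm_intCast]
  exact (mul_le_mul_of_nonneg_right (abs_le_l1Z k j) (norm_nonneg _)).trans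
    (l1Z_mul_norm_symInv_le hσ k)

theorem symRes_neg (k : Fin d → ℤ) : symRes σ ω (-k) = (starRingEnd ℂ) (symRes σ ω k) := by
  by_cases hk : k ∈ farModes σ ω <;> simp [symRes, resModes, neg_mem_farModes, hk]

theorem symInv_neg (k : Fin d → ℤ) : symInv σ ω (-k) = (starRingEnd ℂ) (symInv σ ω k) := by
  by_cases hk : k ∈ farModes σ ω <;> simp [symInv, neg_mem_farModes, hk, dotZ_neg_left]

theorem symDer_neg (j : Fin d) (k : Fin d → ℤ) :
    symDer σ ω j (-k) = (starRingEnd ℂ) (symDer σ ω j k) := by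
  by_cases hk : k ∈ farModes σ ω <;> simp [symDer, neg_mem_farModes, hk, dotZ_neg_left]

end Symbols

namespace WAlg

variable {w : Weight d} {σ : ℝ} (hσ : 0 < σ) (ω : Fin d → ℝ)

/-- The projection to the far from resonance modes. -/
noncomputable def projFar (σ : ℝ) (ω : Fin d → ℝ) : WAlg w → WAlg w := mult (symFar σ ω) norm_symFar_le

/-- The projection to the resonant modes. -/
noncomputable def projRes (σ : ℝ) (ω : Fin d → ℝ) : WAlg w → WAlg w := mult (symRes σ ω) norm_symRes_le

/-- The inverse of `u ↦ Du · ω` on the far from resonance modes. -/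
noncomputable def invFar : WAlg w → WAlg w := mult (symInv σ ω) (norm_symInv_le hσ)

/-- The partial derivatives of `invFar`. -/
noncomputable def derFar (j : Fin d) : WAlg w → WAlg w := mult (symDer σ ω j) (norm_symDer_le hσ j)

theorem isDer_derFar (j : Fin d) (a : WAlg w) : IsDer j (invFar hσ ω a) (derFar hσ ω j a) :=
  fun k => by rw [invFar, derFar, coef_mult, coef_mult, symDer_eq hσ, mul_assoc]

theorem norm_projFar_le (a : WAlg w) : ‖projFar σ ω a‖ ≤ ‖a‖ := 
  (norm_mult_le norm_symFar_le a).trans_eq (one_mul _)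

theorem norm_projRes_le (a : WAlg w) : ‖projRes σ ω a‖ ≤ ‖a‖ := 
  (norm_mult_le norm_symRes_le a).trans_eq (one_mul _)

theorem symInv_mul_symFar (k : Fin d → ℤ) : symInv σ ω k * symFar σ ω k = symInv σ ω k := by
  by_cases hk : k ∈ farModes σ ω <;> simp [symInv, symFar, hk]

theorem invFar_projFar (a : WAlg w) : invFar hσ ω (projFar σ ω a) = invFar hσ ω a :=
  ext fun k => by
    rw [invFar, projFar, coef_mult, coef_mult, coef_mult, ← mul_assoc, symInv_mul_symFar]

theorem derFar_projFar (j : Fin d) (a : WAlg w) :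
    derFar hσ ω j (projFar σ ω a) = derFar hσ ω j a :=
  ext fun k => by
    rw [derFar, projFar, coef_mult, coef_mult, coef_mult, symDer_eq hσ, ← mul_assoc, mul_assoc _ _
      (symFar σ ω k), symInv_mul_symFar]

theorem norm_invFar_le (a : WAlg w) : ‖invFar hσ ω a‖ ≤ σ⁻¹ * ‖projFar σ ω a‖ := by
  rw [← invFar_projFar]; exact norm_mult_le _ _

theorem norm_derFar_le (j : Fin d) (a : WAlg w) : ‖derFar hσ ω j a‖ ≤ σ⁻¹ * ‖projFar σ ω a‖ := by
  rw [← derFar_projFar]; exact norm_mult_le _ _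

/-- The weight 1 + |n| costs σ⁻¹ twice, once for the function and once for its derivative. -/
theorem nPrimeLE_invFar (g : Fin d → WAlg w) :
    NPrimeLE (fun i => invFar hσ ω (g i)) (2 * σ⁻¹ * ∑ i, ‖projFar σ ω (g i)‖) := by
  have hle : ∀ i n, (1 + l1Z n) * (‖coef (invFar hσ ω (g i)) n‖ * w n) ≤
      2 * σ⁻¹ * (‖coef (projFar σ ω (g i)) n‖ * w n) := by
    intro i n
    rw [← invFar_projFar, invFar, coef_mult, norm_mul]
    have h1 := l1Z_mul_norm_symInv_le (ω := ω) hσ n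
    have h2 := norm_symInv_le (ω := ω) hσ n
    have h3 : 0 ≤ ‖coef (projFar σ ω (g i)) n‖ * w n :=
      mul_nonneg (norm_nonneg _) (weight_pos w n).le
    have := mul_le_mul_of_nonneg_right (add_le_add h2 h1) h3
    linarith
  have hs : ∀ i, Summable fun n => 2 * σ⁻¹ * (‖coef (projFar σ ω (g i)) n‖ * w n) := fun i =>
    (summable_norm _).mul_left _
  have hs' := fun i => (hs i).of_nonneg_of_le (nPrime_term_nonneg _) (hle i)
  refine ⟨hs', ?_⟩
  rw [Finset.mul_sum]
  refine Finset.sum_le_sum fun i _ => ((hs' i).tsum_le_tsum (hle i) (hs i)).trans (le_of_eq ?_)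
  rw [tsum_mul_left, norm_eq]

end WAlg

end GevreyRenorm

/-! ### The fixed point equation of the elimination -/

namespace GevreyRenorm

variable {d : ℕ}

open WAlg

namespace StepParams

variable {s ρ ν σ a : ℝ} (P : StepParams d s ρ ν σ a)

/-- The Fourier coefficients `c` of a small real vector field `f`, with `‖f‖'_ρ ≤ m`, whose
constant mode is dominated by the other modes. -/
structure SmallField (P : StepParams d s ρ ν σ a) (c : Fin d → (Fin d → ℤ) → ℂ) (m : ℝ) : Prop where
  coefs : ∀ i, Coefs s ρ (c i)
  herm : ∀ i k, c i (-k) = (starRingEnd ℂ) (c i k)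
  sum_le : ∑ i, ∑' k, (1 + l1Z k) * (‖c i k‖ * Real.exp (ρ * gexp s k)) ≤ m
  le_eps : m ≤ epsRadius d s ν σ a
  const_le : ∑ i, ‖c i 0‖ ≤ Real.exp (-ν) * m

variable {P} {c : Fin d → (Fin d → ℤ) → ℂ} {m : ℝ}

namespace SmallField

variable (hc : P.SmallField c m)
include hc

theorem nonneg : 0 ≤ m := by
  have h : 0 ≤ ∑ i, ‖c i 0‖ := Finset.sum_nonneg fun _ _ => norm_nonneg _
  exact nonneg_of_mul_nonneg_right (h.trans hc.const_le) (Real.exp_pos _)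

theorem mu_nonneg : 0 ≤ Real.exp (-ν) * m := mul_nonneg (Real.exp_pos _).le hc.nonneg

/-- The small parameter of the contraction is μ = e^{-ν}m rather than m. The definition of ε gives
8(C_ν - 1)m ≤ σR, and 4e^{-ν} ≤ C_ν - 1. -/
theorem mu_le : Real.exp (-ν) * m ≤ σ * dispRadius d s ν σ a / 32 := by
  have h1 := P.C_sub_one_ge
  have h2 := P.C_sub_one_pos
  have h3 := hc.le_eps
  have h4 := mul_nonneg P.hσ.le P.dispRadius_pos.le
  rw [epsRadius_eq, div_mul_eq_mul_div, le_div_iff₀ (by positivity)] at h3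
  have h5 := mul_le_mul_of_nonneg_left h1 hc.nonneg
  nlinarith

theorem inv_mul_mu_le : σ⁻¹ * (Real.exp (-ν) * m) ≤ dispRadius d s ν σ a / 32 := by
  rw [inv_mul_le_iff₀ P.hσ]
  linarith [hc.mu_le]

theorem inv_mul_mu_le' : σ⁻¹ * (Real.exp (-ν) * m) ≤ 1 / 1792 :=
  hc.inv_mul_mu_le.trans (by linarith [P.dispRadius_le])

theorem sum_norm_le : ∑ i, ∑' k, ‖c i k‖ * Real.exp (ρ * gexp s k) ≤ m := by
  refine le_trans (Finset.sum_le_sum fun i _ => ?_) hc.sum_le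
  refine (hc.coefs i).summable.tsum_le_tsum (fun k => ?_) (hc.coefs i)
  exact le_mul_of_one_le_left (by positivity) (by linarith [l1Z_nonneg k])

theorem sum_l1Z_le : ∑ i, ∑' k, ‖c i k‖ * (l1Z k * Real.exp (ρ * gexp s k)) ≤ m := by
  refine le_trans (Finset.sum_le_sum fun i _ => ?_) hc.sum_le
  refine (hc.coefs i).summable'.tsum_le_tsum (fun k => ?_) (hc.coefs i)
  have : 0 ≤ ‖c i k‖ * Real.exp (ρ * gexp s k) := by positivity
  linarith

/-- The constant mode contributes at most μ = e^{-ν}m, the other modes at most e^{1-ν}m = eμ, and 1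
+ e < 3.72. -/
theorem sum_norm_comp_le {u : Fin d → WAlg P.W} (hu : P.Adm u) :
    ∑ i, ‖P.comp (c i) u‖ ≤ 3.72 * (Real.exp (-ν) * m) := by
  calc ∑ i, ‖P.comp (c i) u‖
      ≤ ∑ i, (‖c i 0‖ + Real.exp (1 - ν) * ∑' k, ‖c i k‖ * Real.exp (ρ * gexp s k)) :=
        Finset.sum_le_sum fun i _ => P.norm_comp_le (hc.coefs i) hu
    _ = ∑ i, ‖c i 0‖ + Real.exp (1 - ν) * ∑ i, ∑' k, ‖c i k‖ * Real.exp (ρ * gexp s k) := by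
        rw [Finset.sum_add_distrib, Finset.mul_sum]
    _ ≤ Real.exp (-ν) * m + Real.exp (1 - ν) * m :=
        add_le_add hc.const_le (mul_le_mul_of_nonneg_left hc.sum_norm_le (Real.exp_pos _).le)
    _ = (1 + Real.exp 1) * (Real.exp (-ν) * m) := by
        rw [show 1 - ν = 1 + -ν by ring, Real.exp_add]; ring
    _ ≤ _ := mul_le_mul_of_nonneg_right (by linarith [Real.exp_one_lt_d9]) hc.mu_nonneg

theorem sum_norm_comp_sub_le {u v : Fin d → WAlg P.W} (hu : P.Adm u) (hv : P.Adm v) :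
    ∑ i, ‖P.comp (c i) u - P.comp (c i) v‖ ≤
      2.72 * (Real.exp (-ν) * m) * ∑ j, ‖u j - v j‖ := by
  have hS : 0 ≤ ∑ j, ‖u j - v j‖ := Finset.sum_nonneg fun _ _ => norm_nonneg _
  calc ∑ i, ‖P.comp (c i) u - P.comp (c i) v‖
      ≤ ∑ i, Real.exp (1 - ν) * (∑' k, ‖c i k‖ * (l1Z k * Real.exp (ρ * gexp s k))) *
          ∑ j, ‖u j - v j‖ := Finset.sum_le_sum fun i _ => P.norm_comp_sub_le (hc.coefs i) hu hv
    _ = Real.exp (1 - ν) * (∑ i, ∑' k, ‖c i k‖ * (l1Z k * Real.exp (ρ * gexp s k))) *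
          ∑ j, ‖u j - v j‖ := by
        rw [Finset.mul_sum _ _ (Real.exp (1 - ν)), Finset.sum_mul]
    _ ≤ Real.exp (1 - ν) * m * ∑ j, ‖u j - v j‖ :=
        mul_le_mul_of_nonneg_right
          (mul_le_mul_of_nonneg_left hc.sum_l1Z_le (Real.exp_pos _).le) hS
    _ = Real.exp 1 * (Real.exp (-ν) * m) * ∑ j, ‖u j - v j‖ := by
        rw [show 1 - ν = 1 + -ν by ring, Real.exp_add]; ring
    _ ≤ _ := mul_le_mul_of_nonneg_right
        (mul_le_mul_of_nonneg_right (by linarith [Real.exp_one_lt_d9]) hc.mu_nonneg) hS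

theorem realValued_comp (i : Fin d) {u : Fin d → WAlg P.W} (hu : P.Adm u) :
    RealValued (P.comp (c i) u) := fun x => by
  rw [← Complex.conj_eq_iff_im, P.ev_comp (hc.coefs i) hu, Complex.conj_tsum,
    ← (Equiv.neg (Fin d → ℤ)).tsum_eq]
  refine tsum_congr fun k => ?_
  rw [Equiv.neg_apply, map_mul, hc.herm, Complex.conj_conj, chi_neg_left, Complex.conj_conj]

end SmallField

/-- The displacement determined by `g`. -/
noncomputable def disp (P : StepParams d s ρ ν σ a) (ω : Fin d → ℝ) (g : Fin d → WAlg P.W) :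
    Fin d → WAlg P.W := fun i => invFar P.hσ ω (g i)

/-- The nonlinear map whose fixed points provide the elimination of the far from resonance
modes. -/
noncomputable def elimMap (P : StepParams d s ρ ν σ a) (ω : Fin d → ℝ)
    (c : Fin d → (Fin d → ℤ) → ℂ) (g : Fin d → WAlg P.W) : Fin d → WAlg P.W := fun i =>
  -- For a fixed point, g = z + Du·ω with z its resonant part and Du·ω its far part, so g + Du·z =
  -- f∘(id + u) is the conjugacy equation.
  P.comp (c i) (P.disp ω g) - ∑ j, derFar P.hσ ω j (g i) * projRes σ ω (g j)

/-- The real elements of the ball on which `elimMap` is a contraction. -/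
def elimBall (P : StepParams d s ρ ν σ a) (m : ℝ) : Set (Fin d → WAlg P.W) :=
  {g | (∀ i, RealValued (g i)) ∧ ∑ i, ‖g i‖ ≤ 4 * (Real.exp (-ν) * m)}

theorem isClosed_elimBall : IsClosed (P.elimBall m) := by
  have h : IsClosed (⋂ i, (fun g : Fin d → WAlg P.W => g i) ⁻¹' {a | RealValued a}) :=
    isClosed_iInter fun i => isClosed_realValued.preimage (continuous_apply i)
  have h2 : IsClosed {g : Fin d → WAlg P.W | ∑ i, ‖g i‖ ≤ 4 * (Real.exp (-ν) * m)} :=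
    isClosed_le (continuous_finsetSum _ fun i _ => (continuous_apply i).norm) continuous_const
  convert h.inter h2 using 1
  ext g
  simp [elimBall]

variable {ω : Fin d → ℝ}

theorem sum_norm_disp_le (g : Fin d → WAlg P.W) :
    ∑ i, ‖P.disp ω g i‖ ≤ σ⁻¹ * ∑ i, ‖projFar σ ω (g i)‖ := by
  rw [Finset.mul_sum]
  exact Finset.sum_le_sum fun i _ => norm_invFar_le P.hσ ω (g i)

theorem sum_norm_projFar_le (g : Fin d → WAlg P.W) :
    ∑ i, ‖projFar σ ω (g i)‖ ≤ ∑ i, ‖g i‖ :=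
  Finset.sum_le_sum fun i _ => norm_projFar_le ω (g i)

theorem sum_norm_projRes_le (g : Fin d → WAlg P.W) :
    ∑ i, ‖projRes σ ω (g i)‖ ≤ ∑ i, ‖g i‖ :=
  Finset.sum_le_sum fun i _ => norm_projRes_le ω (g i)

theorem sum_norm_derFar_mul_le (g z : Fin d → WAlg P.W) :
    ∑ i, ‖∑ j, derFar P.hσ ω j (g i) * z j‖ ≤
      σ⁻¹ * (∑ i, ‖projFar σ ω (g i)‖) * ∑ j, ‖z j‖ :=
  sum_norm_matVec_le (A := fun i j => derFar P.hσ ω j (g i)) (fun j => by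
    rw [Finset.mul_sum]
    exact Finset.sum_le_sum fun i _ => norm_derFar_le P.hσ ω j (g i)) z

/-- The displacement is at most 2σ⁻¹ · 4μ ≤ R/4, well inside the ball of radius R. -/
theorem SmallField.adm_disp (hc : P.SmallField c m) {g : Fin d → WAlg P.W}
    (hg : g ∈ P.elimBall m) : P.Adm (P.disp ω g) := by
  refine ⟨fun j => (hg.1 j).mult (norm_symInv_le P.hσ) symInv_neg, ?_⟩
  have h := nPrimeLE_invFar P.hσ ω g
  refine ⟨h.1, h.2.trans ?_⟩
  have h1 := (sum_norm_projFar_le (ω := ω) g).trans hg.2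
  have h2 := mul_le_mul_of_nonneg_left h1 (inv_nonneg.mpr P.hσ.le)
  have h3 := hc.inv_mul_mu_le
  have := P.dispRadius_pos
  linarith

theorem SmallField.mapsTo_elimMap (hc : P.SmallField c m) :
    Set.MapsTo (P.elimMap ω c) (P.elimBall m) (P.elimBall m) := by
  intro g hg
  have hadm := hc.adm_disp (ω := ω) hg
  refine ⟨fun i => (hc.realValued_comp i hadm).sub (realValued_sum fun j _ =>
    ((hg.1 i).mult _ (symDer_neg j)).mul ((hg.1 j).mult _ symRes_neg)), ?_⟩
  have h1 := hc.sum_norm_comp_le hadm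
  have h2 := sum_norm_derFar_mul_le (ω := ω) g fun j => projRes σ ω (g j)
  have h3 := (sum_norm_projFar_le (ω := ω) g).trans hg.2
  have h4 := (sum_norm_projRes_le (ω := ω) g).trans hg.2
  have hσ' := inv_nonneg.mpr P.hσ.le
  have hmu := hc.mu_nonneg
  have h5 : σ⁻¹ * (∑ i, ‖projFar σ ω (g i)‖) * ∑ j, ‖projRes σ ω (g j)‖ ≤
      σ⁻¹ * (4 * (Real.exp (-ν) * m)) * (4 * (Real.exp (-ν) * m)) := by
    gcongr
  have h6 := mul_le_mul_of_nonneg_right hc.inv_mul_mu_le' hmu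
  -- The total is 3.72μ + 16σ⁻¹μ², where σ⁻¹μ ≤ 1/1792, hence below 4μ.
  calc ∑ i, ‖P.elimMap ω c g i‖ ≤ ∑ i, (‖P.comp (c i) (P.disp ω g)‖ +
        ‖∑ j, derFar P.hσ ω j (g i) * projRes σ ω (g j)‖) :=
        Finset.sum_le_sum fun i _ => norm_sub_le _ _
    _ ≤ _ := by
        rw [Finset.sum_add_distrib]
        linarith

theorem SmallField.elimMap_contracts (hc : P.SmallField c m) {g h : Fin d → WAlg P.W}
    (hg : g ∈ P.elimBall m) (hh : h ∈ P.elimBall m) :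
    ∑ i, ‖P.elimMap ω c g i - P.elimMap ω c h i‖ ≤ 1 / 2 * ∑ i, ‖g i - h i‖ := by
  have hσ' := inv_nonneg.mpr P.hσ.le
  have hmu := hc.mu_nonneg
  set δ := ∑ i, ‖g i - h i‖ with hδ
  have hδ0 : 0 ≤ δ := Finset.sum_nonneg fun _ _ => norm_nonneg _
  have h1 := hc.sum_norm_comp_sub_le (hc.adm_disp (ω := ω) hg) (hc.adm_disp (ω := ω) hh)
  have h2 : ∑ j, ‖P.disp ω g j - P.disp ω h j‖ ≤ σ⁻¹ * δ := by
    have e : ∀ j, P.disp ω g j - P.disp ω h j = P.disp ω (g - h) j := fun j =>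
      (mult_sub (norm_symInv_le P.hσ) (g j) (h j)).symm
    simp only [e]
    exact (sum_norm_disp_le _).trans
      (mul_le_mul_of_nonneg_left (sum_norm_projFar_le (g - h)) hσ')
  have h3 := sum_norm_derFar_mul_le (ω := ω) (g - h) fun j => projRes σ ω (g j)
  have h4 := sum_norm_derFar_mul_le (ω := ω) h fun j => projRes σ ω ((g - h) j)
  have a1 : ∑ i, ‖projFar σ ω ((g - h) i)‖ ≤ δ := sum_norm_projFar_le (g - h)
  have a2 : ∑ i, ‖projRes σ ω ((g - h) i)‖ ≤ δ := sum_norm_projRes_le (g - h)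
  have a3 := (sum_norm_projFar_le (ω := ω) h).trans hh.2
  have a4 := (sum_norm_projRes_le (ω := ω) g).trans hg.2
  have h5 : σ⁻¹ * (∑ i, ‖projFar σ ω ((g - h) i)‖) * ∑ j, ‖projRes σ ω (g j)‖ ≤
      σ⁻¹ * δ * (4 * (Real.exp (-ν) * m)) := by gcongr
  have h6 : σ⁻¹ * (∑ i, ‖projFar σ ω (h i)‖) * ∑ j, ‖projRes σ ω ((g - h) j)‖ ≤
      σ⁻¹ * (4 * (Real.exp (-ν) * m)) * δ := by gcongr
  have h7 := mul_le_mul_of_nonneg_left h2 (by positivity : 0 ≤ 2.72 * (Real.exp (-ν) * m))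
  have h8 := mul_le_mul_of_nonneg_right hc.inv_mul_mu_le' hδ0
  -- The quadratic term is split bilinearly. With the composition, the Lipschitz constant is at most
  -- (2.72 + 4 + 4)/1792.
  have e : ∀ i, P.elimMap ω c g i - P.elimMap ω c h i =
      (P.comp (c i) (P.disp ω g) - P.comp (c i) (P.disp ω h)) -
      (∑ j, derFar P.hσ ω j ((g - h) i) * projRes σ ω (g j)) -
      ∑ j, derFar P.hσ ω j (h i) * projRes σ ω ((g - h) j) := by
    intro i
    have e1 : ∀ j, derFar P.hσ ω j ((g - h) i) = derFar P.hσ ω j (g i) - derFar P.hσ ω j (h i) :=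
      fun j => mult_sub _ _ _
    have e2 : ∀ j, (projRes σ ω ((g - h) j) : WAlg P.W) = projRes σ ω (g j) - projRes σ ω (h j) :=
      fun j => mult_sub _ _ _
    simp only [elimMap, e1, e2, sub_mul, mul_sub, Finset.sum_sub_distrib]
    ring
  calc ∑ i, ‖P.elimMap ω c g i - P.elimMap ω c h i‖
      ≤ ∑ i, (‖P.comp (c i) (P.disp ω g) - P.comp (c i) (P.disp ω h)‖ +
          ‖∑ j, derFar P.hσ ω j ((g - h) i) * projRes σ ω (g j)‖ +
          ‖∑ j, derFar P.hσ ω j (h i) * projRes σ ω ((g - h) j)‖) := by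
        refine Finset.sum_le_sum fun i _ => ?_
        rw [e]
        exact (norm_sub_le _ _).trans (add_le_add_left (norm_sub_le _ _) _)
    _ ≤ _ := by
        rw [Finset.sum_add_distrib, Finset.sum_add_distrib]
        linarith

theorem SmallField.exists_fixedPoint (hc : P.SmallField c m) (ω : Fin d → ℝ) :
    ∃ g ∈ P.elimBall m, P.elimMap ω c g = g :=
  exists_fixedPoint_sum isClosed_elimBall _ hc.mapsTo_elimMap
    (fun _ hg _ hh => hc.elimMap_contracts hg hh)
    (u₀ := 0) ⟨fun _ => realValued_zero, by simpa using hc.mu_nonneg⟩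

/-- The far from resonance modes of a fixed point are controlled by those of `c`. -/
theorem SmallField.sum_norm_projFar_le_of_fixed (hc : P.SmallField c m) {g : Fin d → WAlg P.W}
    (hg : g ∈ P.elimBall m) (hfix : P.elimMap ω c g = g) :
    ∑ i, ‖projFar σ ω (g i)‖ ≤ 1.02 * (Real.exp (-ν) *
      ∑ i, ∑' k, (farModes σ ω).indicator (fun k => ‖c i k‖ * Real.exp (ρ * gexp s k)) k) := by
  set η := ∑ i, ‖projFar σ ω (g i)‖ with hη
  set Φ := ∑ i, ∑' k, (farModes σ ω).indicator
    (fun k => ‖c i k‖ * Real.exp (ρ * gexp s k)) k with hΦ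
  have hη0 : 0 ≤ η := Finset.sum_nonneg fun _ _ => norm_nonneg _
  have hadm := hc.adm_disp (ω := ω) hg
  have hσ' := inv_nonneg.mpr P.hσ.le
  have hmu := hc.mu_nonneg
  -- Comparison with the zero displacement: the far part of f∘id is that of f, and each remaining
  -- term carries a factor η, to be absorbed on the left.
  have h1 := hc.sum_norm_comp_sub_le hadm P.adm_zero
  simp only [Pi.zero_apply, sub_zero] at h1
  have h2 := sum_norm_disp_le (ω := ω) g
  have h3 := sum_norm_derFar_mul_le (ω := ω) g fun j => projRes σ ω (g j)
  have h4 := (sum_norm_projRes_le (ω := ω) g).trans hg.2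
  have h5 : σ⁻¹ * η * ∑ j, ‖projRes σ ω (g j)‖ ≤ σ⁻¹ * η * (4 * (Real.exp (-ν) * m)) := by
    gcongr
  have h6 := mul_le_mul_of_nonneg_left h2 (by positivity : 0 ≤ 2.72 * (Real.exp (-ν) * m))
  have h7 := mul_le_mul_of_nonneg_right hc.inv_mul_mu_le' hη0
  -- Far modes are nonzero and ρ' ≤ ρ - β²ν, which yields the factor e^{-ν}.
  have hfar : ∀ i, ‖projFar σ ω (P.comp (c i) 0)‖ ≤ Real.exp (-ν) *
      ∑' k, (farModes σ ω).indicator (fun k => ‖c i k‖ * Real.exp (ρ * gexp s k)) k := by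
    intro i
    rw [norm_eq, ← tsum_mul_left]
    refine (summable_norm _).tsum_le_tsum (fun k => ?_)
      (((hc.coefs i).summable.indicator _).mul_left _)
    rw [projFar, coef_mult, P.coef_comp_zero (hc.coefs i), gev_apply]
    by_cases hk : k ∈ farModes σ ω
    · have hk0 : k ≠ 0 := fun h => zero_notMem_farModes (h ▸ hk)
      rw [symFar, Set.indicator_of_mem hk, Set.indicator_of_mem hk, Pi.one_apply, one_mul,
        mul_left_comm, ← Real.exp_add]
      refine mul_le_mul_of_nonneg_left (Real.exp_le_exp.mpr ?_) (norm_nonneg _)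
      have e1 := P.gexp_width_le k
      have e2 := one_le_gexp P.hs hk0
      have e3 : 1 ≤ beta d s ^ 2 := one_le_pow₀ P.one_le_beta
      have e4 := mul_le_mul e3 e2 zero_le_one (by positivity)
      nlinarith [P.hν]
    · rw [symFar, Set.indicator_of_notMem hk, Set.indicator_of_notMem hk]
      simp
  have e : ∀ i, projFar σ ω (g i) = projFar σ ω (P.comp (c i) 0) +
      (projFar σ ω (P.comp (c i) (P.disp ω g) - P.comp (c i) 0) -
        projFar σ ω (∑ j, derFar P.hσ ω j (g i) * projRes σ ω (g j))) := by
    intro i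
    conv_lhs => rw [← congrFun hfix i, elimMap]
    simp only [projFar, mult_sub]
    ring
  have hmain : η ≤ Real.exp (-ν) * Φ + (∑ i, ‖P.comp (c i) (P.disp ω g) - P.comp (c i) 0‖ +
      ∑ i, ‖∑ j, derFar P.hσ ω j (g i) * projRes σ ω (g j)‖) := by
    rw [hη, hΦ, Finset.mul_sum, ← Finset.sum_add_distrib, ← Finset.sum_add_distrib]
    refine Finset.sum_le_sum fun i _ => ?_
    rw [e]
    refine (norm_add_le _ _).trans (add_le_add (hfar i) ((norm_sub_le _ _).trans ?_))
    exact add_le_add (norm_projFar_le _ _) (norm_projFar_le _ _)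
  -- The coefficient of η on the right is at most (2.72 + 4)/1792, small enough for the constant
  -- 1.02.
  linarith

end StepParams

end GevreyRenorm

namespace GevreyRenorm

open MeasureTheory

variable {d : ℕ}

/-! ### Elementary facts on Fourier coefficients of vector fields -/

theorem integrableOn_mul_exp {f : (Fin d → ℝ) → ℂ} (hf : Continuous f) (k : Fin d → ℤ) :
    IntegrableOn (fun x => f x * Complex.exp (-Complex.I * (dotZ k x : ℂ)))
      (Set.Icc (0 : Fin d → ℝ) fun _ => 2 * Real.pi) := by
  refine ContinuousOn.integrableOn_compact isCompact_Icc (Continuous.continuousOn ?_)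
  simp only [exp_neg_eq_chi]
  exact hf.mul (continuous_chi _)

theorem fc_sub {f g : (Fin d → ℝ) → ℂ} (hf : Continuous f) (hg : Continuous g) (k : Fin d → ℤ) :
    fc (fun x => f x - g x) k = fc f k - fc g k := by
  rw [fc, fc, fc, ← mul_sub, ← integral_sub (integrableOn_mul_exp hf k) (integrableOn_mul_exp hg k)]
  simp only [sub_mul]

theorem fc_const (c : ℂ) (k : Fin d → ℤ) : fc (fun _ => c) k = if k = 0 then c else 0 := by
  have h := fc_tsum (c := fun l : Fin d → ℤ => if l = 0 then c else 0)
    (summable_of_ne_finset_zero (s := {0}) fun l hl => by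
      simp [Finset.notMem_singleton.mp hl]) k
  rw [← h]
  refine fc_congr (fun x => ?_) k
  rw [tsum_eq_single 0 fun l hl => by simp [hl]]
  simp

theorem fourierCoef_sub_const {f : (Fin d → ℝ) → (Fin d → ℝ)} (hf : Continuous f)
    (w : Fin d → ℝ) (k : Fin d → ℤ) (i : Fin d) :
    fourierCoef (fun x => f x - w) k i = fourierCoef f k i - if k = 0 then (w i : ℂ) else 0 := by
  have h := fc_sub (f := fun x => (f x i : ℂ)) (g := fun _ => (w i : ℂ)) (by fun_prop)
    continuous_const k
  rw [fc_const] at h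
  rw [fourierCoef_eq_fc, fourierCoef_eq_fc, ← h]
  exact fc_congr (fun x => by simp) k

theorem fourierCoef_neg (f : (Fin d → ℝ) → (Fin d → ℝ)) (k : Fin d → ℤ) (i : Fin d) :
    fourierCoef f (-k) i = (starRingEnd ℂ) (fourierCoef f k i) :=
  fc_ofReal_neg (fun x => f x i) k

theorem coefNorm_nonneg (f : (Fin d → ℝ) → (Fin d → ℝ)) (k : Fin d → ℤ) : 0 ≤ coefNorm f k :=
  Finset.sum_nonneg fun _ _ => norm_nonneg _

theorem termF_nonneg (s ρ : ℝ) (f : (Fin d → ℝ) → (Fin d → ℝ)) (k : Fin d → ℤ) :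
    0 ≤ termF s ρ f k := mul_nonneg (coefNorm_nonneg f k) (Real.exp_pos _).le

theorem termF'_nonneg (s ρ : ℝ) (f : (Fin d → ℝ) → (Fin d → ℝ)) (k : Fin d → ℤ) :
    0 ≤ termF' s ρ f k := mul_nonneg (by linarith [l1Z_nonneg k]) (termF_nonneg s ρ f k)

theorem termF_eq_sum (s ρ : ℝ) (f : (Fin d → ℝ) → (Fin d → ℝ)) (k : Fin d → ℤ) :
    termF s ρ f k = ∑ i, ‖fourierCoef f k i‖ * Real.exp (ρ * gexp s k) := by
  rw [termF, coefNorm, Finset.sum_mul]; rfl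

theorem termF'_eq_sum (s ρ : ℝ) (f : (Fin d → ℝ) → (Fin d → ℝ)) (k : Fin d → ℤ) :
    termF' s ρ f k = ∑ i, (1 + l1Z k) * (‖fourierCoef f k i‖ * Real.exp (ρ * gexp s k)) := by
  rw [termF', termF_eq_sum, Finset.mul_sum]

theorem termF_le_termF' (s ρ : ℝ) (f : (Fin d → ℝ) → (Fin d → ℝ)) (k : Fin d → ℤ) :
    termF s ρ f k ≤ termF' s ρ f k :=
  le_mul_of_one_le_left (termF_nonneg s ρ f k) (by linarith [l1Z_nonneg k])

theorem MemF'.memF {s ρ : ℝ} {f : (Fin d → ℝ) → (Fin d → ℝ)} (h : MemF' s ρ f) : MemF s ρ f :=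
  ⟨h.1, h.2.1, h.2.2.of_nonneg_of_le (termF_nonneg s ρ f) (termF_le_termF' s ρ f)⟩

theorem MemF'.sub_const {s ρ : ℝ} {f : (Fin d → ℝ) → (Fin d → ℝ)} (h : MemF' s ρ f)
    (w : Fin d → ℝ) : MemF' s ρ fun x => f x - w := by
  refine ⟨h.1.sub contDiff_const, fun x m => by simp only [h.2.1 x m], ?_⟩
  refine h.2.2.congr_cofinite ?_
  have : {(0 : Fin d → ℤ)}ᶜ ∈ (Filter.cofinite : Filter (Fin d → ℤ)) :=
    (Set.finite_singleton 0).compl_mem_cofinite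
  filter_upwards [this] with k hk
  have hk' : k ≠ 0 := hk
  simp only [termF'_eq_sum, fourierCoef_sub_const h.1.continuous, if_neg hk', sub_zero]

/-- `y ≤ (s/δ)^s e^{δ y^{1/s}}`. -/
theorem l1Z_le_exp {s δ : ℝ} (hs : 1 ≤ s) (hδ : 0 < δ) (k : Fin d → ℤ) :
    l1Z k ≤ s ^ s / δ ^ s * Real.exp (δ * gexp s k) := by
  have hs0 : 0 < s := by linarith
  have hg := gexp_nonneg s k
  -- Raising y ≤ e^y, with y = δ|k|^{1/s}/s, to the power s gives the claim.
  have h1 : δ * gexp s k / s ≤ Real.exp (δ * gexp s k / s) :=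
    (by linarith : δ * gexp s k / s ≤ δ * gexp s k / s + 1).trans (Real.add_one_le_exp _)
  have h2 := Real.rpow_le_rpow (by positivity) h1 hs0.le
  rw [← Real.exp_mul, div_mul_cancel₀ _ hs0.ne', Real.div_rpow (by positivity) hs0.le,
    Real.mul_rpow hδ.le hg, gexp, ← Real.rpow_mul (l1Z_nonneg k), one_div, inv_mul_cancel₀ hs0.ne',
    Real.rpow_one, div_le_iff₀ (by positivity)] at h2
  rw [div_mul_eq_mul_div, le_div_iff₀ (by positivity), gexp, one_div]
  linarith

namespace WAlg

variable {w : Weight d}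

/-- An element of the algebra with a larger weight, as an element of that with a smaller one. -/
noncomputable def relax {w' : Weight d} (h : ∀ k, w' k ≤ w k) (a : WAlg w) : WAlg w' :=
  mk (coef a) <| (summable_norm a).of_nonneg_of_le
    (fun k => mul_nonneg (norm_nonneg _) (weight_pos w' k).le)
    fun k => mul_le_mul_of_nonneg_left (h k) (norm_nonneg _)

@[simp] theorem coef_relax {w' : Weight d} (h : ∀ k, w' k ≤ w k) (a : WAlg w) (k : Fin d → ℤ) :
    coef (relax h a) k = coef a k := coef_mk _ _ k

theorem ev_relax {w' : Weight d} (h : ∀ k, w' k ≤ w k) (a : WAlg w) (x : Fin d → ℝ) :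
    ev (relax h a) x = ev a x := ev_congr_coef (coef_relax h a) x

theorem norm_relax_le {w' : Weight d} (h : ∀ k, w' k ≤ w k) (a : WAlg w) :
    ‖relax h a‖ ≤ ‖a‖ := by
  rw [norm_eq, norm_eq]
  refine (summable_norm _).tsum_le_tsum (fun k => ?_) (summable_norm a)
  rw [coef_relax]
  exact mul_le_mul_of_nonneg_left (h k) (norm_nonneg _)

/-! ### Differentiability -/

theorem hasFDerivAt_chi (k : Fin d → ℤ) (x : Fin d → ℝ) :
    HasFDerivAt (chi k) (∑ j, (ContinuousLinearMap.proj j : (Fin d → ℝ) →L[ℝ] ℝ).smulRight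
      (Complex.I * (k j : ℂ) * chi k x)) x := by
  have h1 : HasFDerivAt (dotZ k)
      (∑ j, (k j : ℝ) • (ContinuousLinearMap.proj j : (Fin d → ℝ) →L[ℝ] ℝ)) x :=
    HasFDerivAt.fun_sum fun j _ => (hasFDerivAt_apply j x).const_mul _
  have h2 := (((Complex.ofRealCLM.hasFDerivAt (x := dotZ k x)).comp x h1).const_mul Complex.I).cexp
  refine h2.congr_fderiv ?_
  ext v
  simp [chi, Finset.mul_sum]
  refine Finset.sum_congr rfl fun j _ => ?_
  ring

theorem hasFDerivAt_ev {a : WAlg w} {a' : Fin d → WAlg w} (h : ∀ j, IsDer j a (a' j))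
    (x : Fin d → ℝ) :
    HasFDerivAt (ev a) (∑ j, (ContinuousLinearMap.proj j : (Fin d → ℝ) →L[ℝ] ℝ).smulRight
      (ev (a' j) x)) x := by
  have hder : ∀ (k : Fin d → ℤ) (x : Fin d → ℝ), HasFDerivAt (fun x => coef a k * chi k x)
      (∑ j, (ContinuousLinearMap.proj j : (Fin d → ℝ) →L[ℝ] ℝ).smulRight
        (coef (a' j) k * chi k x)) x := by
    intro k x
    refine ((hasFDerivAt_chi k x).const_mul (coef a k)).congr_fderiv ?_
    ext v
    simp only [_root_.smul_apply, _root_.sum_apply,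
      ContinuousLinearMap.smulRight_apply, h _ k, Finset.smul_sum, smul_eq_mul]
    refine Finset.sum_congr rfl fun j _ => ?_
    simp only [ContinuousLinearMap.proj_apply, Complex.real_smul]
    ring
  have hbd : ∀ (k : Fin d → ℤ) (x : Fin d → ℝ),
      ‖∑ j, (ContinuousLinearMap.proj j : (Fin d → ℝ) →L[ℝ] ℝ).smulRight
        (coef (a' j) k * chi k x)‖ ≤ ∑ j, ‖coef (a' j) k‖ := by
    intro k x
    refine (norm_sum_le _ _).trans (Finset.sum_le_sum fun j _ => ?_)
    rw [ContinuousLinearMap.norm_smulRight_apply, norm_mul, norm_chi, mul_one]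
    exact mul_le_of_le_one_left (norm_nonneg _)
      (ContinuousLinearMap.opNorm_le_bound _ zero_le_one fun v => by
        simpa using norm_le_pi_norm v j)
  have h1 := hasFDerivAt_tsum (summable_sum fun j _ => summable_coef (a' j)) hder hbd
    (summable_ev a x).of_norm x
  refine h1.congr_fderiv ?_
  exact (hasSum_sum fun j _ => (hasSum_ev (a' j) x).mapL
    (ContinuousLinearMap.smulRightL ℝ (Fin d → ℝ) ℂ
      (ContinuousLinearMap.proj j : (Fin d → ℝ) →L[ℝ] ℝ))).tsum_eq

/-- Each derivative is paid for with half of the remaining width, which stays positive after any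
finite number of derivatives. -/
theorem contDiff_ev_nat {s : ℝ} (hs : 1 ≤ s) (n : ℕ) : ∀ {r : ℝ} (hr : 0 < r)
    (a : WAlg (gev d s r hs hr.le)), ContDiff ℝ n (ev a) := by
  induction n with
  | zero => exact fun hr a => contDiff_zero.mpr (continuous_ev a)
  | succ n ih =>
    intro r hr a
    have hr2 : 0 < r / 2 := by positivity
    have hle : ∀ k, gev d s (r / 2) hs hr2.le k ≤ gev d s r hs hr.le k := fun k => by
      rw [gev_apply, gev_apply, Real.exp_le_exp]
      have := gexp_nonneg s k
      nlinarith
    have hsum : Summable fun k => l1Z k * ‖coef (relax hle a) k‖ * gev d s (r / 2) hs hr2.le k := by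
      refine ((summable_norm a).mul_left (s ^ s / (r / 2) ^ s)).of_nonneg_of_le
        (fun k => mul_nonneg (mul_nonneg (l1Z_nonneg k) (norm_nonneg _)) (weight_pos _ k).le)
        fun k => ?_
      have h1 := mul_le_mul_of_nonneg_right (l1Z_le_exp hs hr2 k)
        (mul_nonneg (norm_nonneg (coef a k)) (Real.exp_pos (r / 2 * gexp s k)).le)
      rw [coef_relax, gev_apply, gev_apply]
      have h2 : Real.exp (r * gexp s k) =
          Real.exp (r / 2 * gexp s k) * Real.exp (r / 2 * gexp s k) := by
        rw [← Real.exp_add]; ring_nf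
      rw [h2]
      linarith
    have hD := hasFDerivAt_ev (fun j => isDer_der j (relax hle a) hsum)
    have e : ev (relax hle a) = ev a := funext (ev_relax hle a)
    rw [e] at hD
    rw [Nat.cast_succ, contDiff_succ_iff_hasFDerivAt]
    refine ⟨_, ?_, hD⟩
    refine ContDiff.sum fun j _ => ?_
    exact contDiff_const.smulRight (ih hr2 _)

theorem contDiff_ev {s : ℝ} {hs : 1 ≤ s} {r : ℝ} (hr : 0 < r)
    (a : WAlg (gev d s r hs hr.le)) : ContDiff ℝ ((⊤ : ℕ∞) : WithTop ℕ∞) (ev a) :=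
  contDiff_infty.mpr fun n => contDiff_ev_nat hs n hr a

end WAlg

end GevreyRenorm

namespace GevreyRenorm

variable {d : ℕ}

open WAlg

/-! ### The `ℓ¹` norm on `ℝ^d` and changes of coordinates close to the identity -/

theorem l1_nonneg (v : Fin d → ℝ) : 0 ≤ l1 v := Finset.sum_nonneg fun _ _ => abs_nonneg _

theorem l1_add_le (v w : Fin d → ℝ) : l1 (v + w) ≤ l1 v + l1 w := by
  rw [l1, l1, l1, ← Finset.sum_add_distrib]
  exact Finset.sum_le_sum fun i _ => abs_add_le _ _

theorem l1_neg (v : Fin d → ℝ) : l1 (-v) = l1 v := by simp [l1]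

theorem abs_le_l1 (v : Fin d → ℝ) (i : Fin d) : |v i| ≤ l1 v :=
  Finset.single_le_sum (f := fun i => |v i|) (fun _ _ => abs_nonneg _) (Finset.mem_univ i)

theorem eq_zero_of_l1_nonpos {v : Fin d → ℝ} (h : l1 v ≤ 0) : v = 0 := funext fun i =>
  abs_nonpos_iff.mp ((abs_le_l1 v i).trans h)

theorem injective_id_add {D : (Fin d → ℝ) →L[ℝ] (Fin d → ℝ)} {q : ℝ} (hq : q < 1)
    (hD : ∀ v, l1 (D v) ≤ q * l1 v) :
    Function.Injective (ContinuousLinearMap.id ℝ (Fin d → ℝ) + D) := by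
  rw [injective_iff_map_eq_zero]
  intro v hv
  have h1 : v = -D v := eq_neg_of_add_eq_zero_left hv
  have h2 := hD v
  rw [← l1_neg, ← h1] at h2
  refine eq_zero_of_l1_nonpos ?_
  nlinarith [l1_nonneg v]

theorem inverse_apply_eq_iff {E : Type*} [NormedAddCommGroup E] [NormedSpace ℝ E]
    [FiniteDimensional ℝ E] {A : E →L[ℝ] E} (hA : Function.Injective A) {y v : E} :
    A.inverse y = v ↔ y = A v := by
  let e : E ≃L[ℝ] E := (LinearEquiv.ofInjectiveEndo (A : E →ₗ[ℝ] E) hA).toContinuousLinearEquiv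
  have he : A = (e : E →L[ℝ] E) := by ext v; rfl
  rw [he, ContinuousLinearMap.inverse_equiv]
  exact e.symm_apply_eq

theorem fderiv_id_add {u : (Fin d → ℝ) → (Fin d → ℝ)} {D : (Fin d → ℝ) →L[ℝ] (Fin d → ℝ)}
    {x : Fin d → ℝ} (hu : HasFDerivAt u D x) :
    fderiv ℝ (fun x => x + u x) x = ContinuousLinearMap.id ℝ (Fin d → ℝ) + D :=
  ((hasFDerivAt_id x).add hu).fderiv

/-- Removes the inverse Jacobian: with I + Du invertible, the pullback is characterised by an
identity in which only sums and products of represented functions occur. -/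
theorem pullback_id_add_eq_iff {u : (Fin d → ℝ) → (Fin d → ℝ)}
    {D : (Fin d → ℝ) → (Fin d → ℝ) →L[ℝ] (Fin d → ℝ)} (hu : ∀ x, HasFDerivAt u (D x) x) {q : ℝ}
    (hq : q < 1) (hD : ∀ x v, l1 (D x v) ≤ q * l1 v) {X : (Fin d → ℝ) → (Fin d → ℝ)}
    {x y : Fin d → ℝ} :
    pullback (fun x => x + u x) X x = y ↔ X (x + u x) = y + D x y := by
  rw [pullback, fderiv_id_add (hu x), inverse_apply_eq_iff (injective_id_add hq (hD x))]
  rfl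

/-! ### Vector fields represented by Fourier series -/

namespace WAlg

variable {w : Weight d}

theorem RealValued.isDer {a a' : WAlg w} {j : Fin d} (ha : RealValued a) (h : IsDer j a a') :
    RealValued a' := realValued_of_coef fun k => by
  rw [h, h, ha.coef_neg, map_mul, map_mul, Complex.conj_I]
  simp

theorem RealValued.ev_eq {a : WAlg w} (ha : RealValued a) (x : Fin d → ℝ) :
    ev a x = ((ev a x).re : ℂ) := Complex.ext rfl (by simp [ha x])

/-- The matrix of functions represented by `D`. -/
noncomputable def jac (D : Fin d → Fin d → WAlg w) (x : Fin d → ℝ) :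
    (Fin d → ℝ) →L[ℝ] (Fin d → ℝ) :=
  ContinuousLinearMap.pi fun i =>
    ∑ j, (ev (D i j) x).re • (ContinuousLinearMap.proj j : (Fin d → ℝ) →L[ℝ] ℝ)

theorem jac_apply (D : Fin d → Fin d → WAlg w) (x v : Fin d → ℝ) (i : Fin d) :
    jac D x v i = ∑ j, (ev (D i j) x).re * v j := by
  simp [jac]

theorem hasFDerivAt_evVec {U : Fin d → WAlg w} {D : Fin d → Fin d → WAlg w}
    (h : ∀ i j, IsDer j (U i) (D i j)) (x : Fin d → ℝ) : HasFDerivAt (evVec U) (jac D x) x := by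
  rw [hasFDerivAt_pi']
  intro i
  refine ((Complex.reCLM.hasFDerivAt (x := ev (U i) x)).comp x
    (hasFDerivAt_ev (h i) x)).congr_fderiv ?_
  ext v
  simp [jac, mul_comm]

theorem l1_jac_le {D : Fin d → Fin d → WAlg w} {K : ℝ} (hD : ∀ j, ∑ i, ‖D i j‖ ≤ K)
    (x v : Fin d → ℝ) : l1 (jac D x v) ≤ K * l1 v := by
  calc l1 (jac D x v) ≤ ∑ i, ∑ j, ‖D i j‖ * |v j| := by
        refine Finset.sum_le_sum fun i _ => ?_
        rw [jac_apply]
        refine (Finset.abs_sum_le_sum_abs _ _).trans (Finset.sum_le_sum fun j _ => ?_)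
        rw [abs_mul]
        exact mul_le_mul_of_nonneg_right
          ((Complex.abs_re_le_norm _).trans (norm_ev_le _ _)) (abs_nonneg _)
    _ = ∑ j, (∑ i, ‖D i j‖) * |v j| := by rw [Finset.sum_comm]; simp only [Finset.sum_mul]
    _ ≤ K * l1 v := by
        rw [l1, Finset.mul_sum]
        exact Finset.sum_le_sum fun j _ => mul_le_mul_of_nonneg_right (hD j) (abs_nonneg _)

theorem NPrimeLE.summable_l1Z {U : Fin d → WAlg w} {B : ℝ} (h : NPrimeLE U B) (i : Fin d) :
    Summable fun k => l1Z k * ‖coef (U i) k‖ * w k :=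
  (h.1 i).of_nonneg_of_le
    (fun k => mul_nonneg (mul_nonneg (l1Z_nonneg k) (norm_nonneg _)) (weight_pos w k).le) fun k => by
      have := mul_nonneg (norm_nonneg (coef (U i) k)) (weight_pos w k).le
      linarith

theorem NPrimeLE.sum_norm_der_le {U : Fin d → WAlg w} {B : ℝ} (h : NPrimeLE U B) (j : Fin d) :
    ∑ i, ‖der j (U i) (h.summable_l1Z i)‖ ≤ B := by
  refine le_trans (Finset.sum_le_sum fun i _ => ?_) h.2
  rw [norm_eq]
  refine (summable_norm _).tsum_le_tsum (fun k => ?_) (h.1 i)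
  rw [isDer_der j (U i) (h.summable_l1Z i) k, norm_mul, norm_mul, Complex.norm_I, one_mul,
    Complex.norm_intCast, mul_assoc]
  refine mul_le_mul_of_nonneg_right ((abs_le_l1Z k j).trans (by linarith))
    (mul_nonneg (norm_nonneg _) (weight_pos w k).le)

theorem fourierCoef_evVec {U : Fin d → WAlg w} (hU : ∀ i, RealValued (U i)) (k : Fin d → ℤ)
    (i : Fin d) : fourierCoef (evVec U) k i = coef (U i) k := by
  rw [fourierCoef_eq_fc, ← fc_ev]
  exact fc_congr (fun x => ((hU i).ev_eq x).symm) k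

section Gevrey

variable {s r : ℝ} {hs : 1 ≤ s}

theorem contDiff_evVec (hr : 0 < r) (U : Fin d → WAlg (gev d s r hs hr.le)) :
    ContDiff ℝ ((⊤ : ℕ∞) : WithTop ℕ∞) (evVec U) :=
  contDiff_pi.mpr fun i => Complex.reCLM.contDiff.comp (contDiff_ev hr (U i))

theorem isPeriodic_evVec (U : Fin d → WAlg w) : IsPeriodic (evVec U) := fun x m =>
  funext fun i => by rw [evVec, ev_periodic (U i) x m, evVec]

theorem memF_evVec (hr : 0 < r) {U : Fin d → WAlg (gev d s r hs hr.le)}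
    (hU : ∀ i, RealValued (U i)) : MemF s r (evVec U) := by
  refine ⟨contDiff_evVec hr U, isPeriodic_evVec U, ?_⟩
  refine (summable_sum (s := Finset.univ) fun i _ => summable_norm (U i)).congr fun k => ?_
  rw [termF_eq_sum]
  exact Finset.sum_congr rfl fun i _ => by rw [fourierCoef_evVec hU, gev_apply]

theorem termF'_evVec {hr : 0 ≤ r} {U : Fin d → WAlg (gev d s r hs hr)}
    (hU : ∀ i, RealValued (U i)) (k : Fin d → ℤ) : termF' s r (evVec U) k =
      ∑ i, (1 + l1Z k) * (‖coef (U i) k‖ * gev d s r hs hr k) := by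
  rw [termF'_eq_sum]
  exact Finset.sum_congr rfl fun i _ => by rw [fourierCoef_evVec hU, gev_apply]

theorem memF'_evVec (hr : 0 < r) {U : Fin d → WAlg (gev d s r hs hr.le)}
    (hU : ∀ i, RealValued (U i)) {B : ℝ} (hB : NPrimeLE U B) : MemF' s r (evVec U) := by
  refine ⟨contDiff_evVec hr U, isPeriodic_evVec U, ?_⟩
  exact (summable_sum (s := Finset.univ) fun i _ => hB.1 i).congr fun k => (termF'_evVec hU k).symm

theorem normF'_evVec_le (hr : 0 < r) {U : Fin d → WAlg (gev d s r hs hr.le)}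
    (hU : ∀ i, RealValued (U i)) {B : ℝ} (hB : NPrimeLE U B) : normF' s r (evVec U) ≤ B := by
  refine le_trans (le_of_eq ?_) hB.2
  rw [normF', ← Summable.tsum_finsetSum fun i _ => hB.1 i]
  exact tsum_congr (termF'_evVec hU)

theorem summable_fourierCoef {f : (Fin d → ℝ) → (Fin d → ℝ)} (hf : MemF s r f) (i : Fin d) :
    Summable fun k => ‖fourierCoef f k i‖ * Real.exp (r * gexp s k) :=
  hf.2.2.of_nonneg_of_le (fun k => by positivity) fun k => by
    rw [termF_eq_sum]
    exact Finset.single_le_sum (f := fun i => ‖fourierCoef f k i‖ * Real.exp (r * gexp s k))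
      (fun _ _ => by positivity) (Finset.mem_univ i)

theorem summable_fourierCoef' {f : (Fin d → ℝ) → (Fin d → ℝ)} (hf : MemF' s r f) (i : Fin d) :
    Summable fun k => (1 + l1Z k) * (‖fourierCoef f k i‖ * Real.exp (r * gexp s k)) := by
  have h0 : ∀ (k : Fin d → ℤ) i,
      0 ≤ (1 + l1Z k) * (‖fourierCoef f k i‖ * Real.exp (r * gexp s k)) := fun k i =>
    mul_nonneg (by linarith [l1Z_nonneg k]) (by positivity)
  refine hf.2.2.of_nonneg_of_le (fun k => h0 k i) fun k => ?_
  rw [termF'_eq_sum]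
  exact Finset.single_le_sum (f := fun i => (1 + l1Z k) *
    (‖fourierCoef f k i‖ * Real.exp (r * gexp s k))) (fun i _ => h0 k i) (Finset.mem_univ i)

/-- The components of a vector field as elements of the algebra. -/
noncomputable def fieldRep (hs : 1 ≤ s) (hr : 0 ≤ r) {f : (Fin d → ℝ) → (Fin d → ℝ)}
    (hf : MemF s r f) (i : Fin d) : WAlg (gev d s r hs hr) :=
  mk (fun k => fourierCoef f k i) (summable_fourierCoef hf i)

variable {hr : 0 ≤ r} {f : (Fin d → ℝ) → (Fin d → ℝ)} (hf : MemF s r f)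

@[simp] theorem coef_fieldRep (i : Fin d) (k : Fin d → ℤ) :
    coef (fieldRep hs hr hf i) k = fourierCoef f k i := coef_mk _ _ k

theorem ev_fieldRep (i : Fin d) (x : Fin d → ℝ) : ev (fieldRep hs hr hf i) x = (f x i : ℂ) := by
  have h1 : Continuous fun x => (f x i : ℂ) := by
    have := hf.1.continuous
    fun_prop
  have h2 : PeriodicFun fun x => (f x i : ℂ) := fun x m => by
    simp only [hf.2.1 x m]
  have h3 : Summable (fc fun x => (f x i : ℂ)) :=
    ((summable_coef (fieldRep hs hr hf i)).congr fun k => by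
      rw [coef_fieldRep, fourierCoef_eq_fc]).of_norm
  rw [← (hasSum_fourier h1 h2 h3 x).tsum_eq, ev]
  exact tsum_congr fun k => by rw [coef_fieldRep, fourierCoef_eq_fc]

theorem realValued_fieldRep (i : Fin d) : RealValued (fieldRep hs hr hf i) := fun x => by
  rw [ev_fieldRep, Complex.ofReal_im]

theorem evVec_fieldRep : evVec (fieldRep hs hr hf) = f := funext fun x => funext fun i => by
  rw [evVec, ev_fieldRep, Complex.ofReal_re]

theorem nPrimeLE_fieldRep (hf' : MemF' s r f) :
    NPrimeLE (fieldRep hs hr hf'.memF) (normF' s r f) := by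
  have h : ∀ i, Summable fun n => (1 + l1Z n) *
      (‖coef (fieldRep hs hr hf'.memF i) n‖ * gev d s r hs hr n) := fun i =>
    (summable_fourierCoef' hf' i).congr fun k => by rw [coef_fieldRep, gev_apply]
  refine ⟨h, le_of_eq ?_⟩
  rw [normF', ← Summable.tsum_finsetSum fun i _ => h i]
  refine tsum_congr fun k => ?_
  rw [termF'_eq_sum]
  exact Finset.sum_congr rfl fun i _ => by rw [coef_fieldRep, gev_apply]

end Gevrey

end WAlg

end GevreyRenorm

namespace GevreyRenorm

variable {d : ℕ}

open WAlg

/-! ### Elimination of the far from resonance modes of a vector field -/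

namespace WAlg

variable {w : Weight d}

theorem realValued_real_smul_one (c : ℝ) : RealValued ((c : ℂ) • (1 : WAlg w)) := fun x => by
  rw [ev_smul, ev_one, mul_one, Complex.ofReal_im]

theorem coef_smul_one (c : ℂ) (k : Fin d → ℤ) :
    coef (c • (1 : WAlg w)) k = if k = 0 then c else 0 := by
  rw [coef_smul, coef_one]
  by_cases hk : k = 0 <;> simp [hk]

/-- The symbols k_j/(k·ω), weighted by ω_j, add up to 1 on far modes; hence Du·ω recovers exactly
the far part. -/
theorem sum_smul_derFar {σ : ℝ} (hσ : 0 < σ) (ω : Fin d → ℝ) (a : WAlg w) :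
    ∑ j, (ω j : ℂ) • derFar hσ ω j a = projFar σ ω a := ext fun k => by
  rw [coef_sum, projFar, coef_mult]
  simp only [coef_smul, derFar, coef_mult, symDer, symFar]
  by_cases hk : k ∈ farModes σ ω
  · have h : (dotZ k ω : ℂ) ≠ 0 :=
      Complex.ofReal_ne_zero.mpr (abs_pos.mp (farModes_dotZ_pos hσ hk))
    simp only [Set.indicator_of_mem hk, Pi.one_apply, one_mul]
    have e : ∀ j, (ω j : ℂ) * ((k j : ℂ) / (dotZ k ω : ℂ) * coef a k) =
        (k j : ℂ) * (ω j : ℂ) * (coef a k / (dotZ k ω : ℂ)) := fun j => by ring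
    simp only [e]
    rw [← Finset.sum_mul, show ∑ j, (k j : ℂ) * (ω j : ℂ) = (dotZ k ω : ℂ) by
      rw [dotZ]; push_cast; rfl, mul_div_cancel₀ _ h]
  · simp [Set.indicator_of_notMem hk]

theorem projFar_add_projRes (σ : ℝ) (ω : Fin d → ℝ) (a : WAlg w) :
    projFar σ ω a + projRes σ ω a = a := ext fun k => by
  rw [coef_add, projFar, projRes, coef_mult, coef_mult, ← add_mul, symFar_add_symRes, one_mul]

end WAlg

namespace StepParams

variable {s ρ ν σ a : ℝ} {P : StepParams d s ρ ν σ a} {X : (Fin d → ℝ) → (Fin d → ℝ)}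
  {ω : Fin d → ℝ} {m : ℝ}

/-- The domination `h0` of the constant mode, supplied by the rotation vector, becomes smallness by
e^{-ν}, because nonzero modes have weight at least e^ρ ≥ e^ν. -/
theorem smallField_of_field (P : StepParams d s ρ ν σ a) {f : (Fin d → ℝ) → (Fin d → ℝ)}
    (hf : MemF' s ρ f) (hsmall : normF' s ρ f ≤ epsRadius d s ν σ a)
    (h0 : coefNorm f 0 ≤ ∑' k, if k = 0 then 0 else coefNorm f k) :
    P.SmallField (fun i k => fourierCoef f k i) (normF' s ρ f) where
  coefs i := summable_fourierCoef' hf i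
  herm i k := fourierCoef_neg f k i
  sum_le := by
    rw [normF', ← Summable.tsum_finsetSum fun i _ => summable_fourierCoef' hf i]
    exact le_of_eq (tsum_congr fun k => (termF'_eq_sum s ρ f k).symm)
  le_eps := hsmall
  const_le := by
    have hle : ∀ k : Fin d → ℤ, (if k = 0 then 0 else coefNorm f k) ≤
        Real.exp (-ν) * termF' s ρ f k := by
      intro k
      by_cases hk : k = 0
      · rw [if_pos hk]
        exact mul_nonneg (Real.exp_pos _).le (termF'_nonneg s ρ f k)
      rw [if_neg hk]
      have e1 : 1 ≤ Real.exp (-ν) * Real.exp (ρ * gexp s k) := by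
        rw [← Real.exp_add, Real.one_le_exp_iff]
        have h1 := P.radius1_add_le
        have h2 := P.radius1_pos
        have h3 : 1 ≤ beta d s ^ 2 := one_le_pow₀ P.one_le_beta
        have h4 := one_le_gexp P.hs hk
        have h5 : ν ≤ ρ := by nlinarith [P.hν]
        nlinarith [P.hν]
      calc coefNorm f k ≤ coefNorm f k * (Real.exp (-ν) * Real.exp (ρ * gexp s k)) :=
            le_mul_of_one_le_right (coefNorm_nonneg f k) e1
        _ = Real.exp (-ν) * termF s ρ f k := by rw [termF, gexp]; ring
        _ ≤ _ := mul_le_mul_of_nonneg_left (termF_le_termF' s ρ f k) (Real.exp_pos _).le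
    have hs2 := hf.2.2.mul_left (Real.exp (-ν))
    have hs1 : Summable fun k : Fin d → ℤ => if k = 0 then 0 else coefNorm f k :=
      hs2.of_nonneg_of_le (fun k => by split_ifs; exacts [le_rfl, coefNorm_nonneg f k]) hle
    refine le_trans h0 ((hs1.tsum_le_tsum hle hs2).trans (le_of_eq ?_))
    rw [tsum_mul_left, normF']

theorem ev_comp_field {f : (Fin d → ℝ) → (Fin d → ℝ)} (hf : MemF' s ρ f)
    {u : Fin d → WAlg P.W} (hu : P.Adm u) (i : Fin d) (x : Fin d → ℝ) :
    ev (P.comp (fun k => fourierCoef f k i) u) x = (f (x + evVec u x) i : ℂ) := by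
  rw [P.ev_comp (summable_fourierCoef' hf i) hu,
    ← ev_fieldRep (hs := P.hs) (hr := P.rho_pos.le) hf.memF, ev]
  exact tsum_congr fun k => by rw [coef_fieldRep]

/-- The index 0 is never far, so subtracting the constant ω does not affect the far part. -/
theorem normFar_eq (hX : MemF' s ρ X) (σ : ℝ) (ω : Fin d → ℝ) :
    normFar s ρ σ ω X = ∑ i, ∑' k, (farModes σ ω).indicator
      (fun k => ‖fourierCoef (fun x => X x - ω) k i‖ * Real.exp (ρ * gexp s k)) k := by
  have hs := fun i => (summable_fourierCoef (hX.sub_const ω).memF i).indicator (farModes σ ω)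
  rw [normFar, ← Summable.tsum_finsetSum fun i _ => hs i]
  refine tsum_congr fun k => ?_
  by_cases hk : k ∈ farModes σ ω
  · have hk0 : k ≠ 0 := fun h => zero_notMem_farModes (h ▸ hk)
    simp only [Set.indicator_of_mem hk, termF_eq_sum, fourierCoef_sub_const hX.1.continuous,
      if_neg hk0, sub_zero]
  · simp only [Set.indicator_of_notMem hk, Finset.sum_const_zero]

theorem gev_radius2_le (P : StepParams d s ρ ν σ a) (k : Fin d → ℤ) :
    gev d s (radius2 d s ν ρ) P.hs P.radius2_pos.le k ≤ P.W k := by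
  rw [gev_apply, gev_apply, Real.exp_le_exp]
  exact mul_le_mul_of_nonneg_right P.radius2_le (gexp_nonneg s k)

/-- A fixed point g gives the displacement U and the candidate field Z, namely ω plus the resonant
part of g. The conjugacy equation is then the fixed point equation evaluated at points. -/
theorem SmallField.exists_eliminates (hX : MemF' s ρ X)
    (hc : P.SmallField (fun i k => fourierCoef (fun x => X x - ω) k i) m) :
    ∃ u, Eliminates s ρ ν σ ω X u := by
  obtain ⟨g, hg, hfix⟩ := hc.exists_fixedPoint ω
  have hadm := hc.adm_disp (ω := ω) hg
  set U := P.disp ω g with hU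
  have hNP := nPrimeLE_invFar P.hσ ω g
  let Z : Fin d → WAlg (gev d s (radius2 d s ν ρ) P.hs P.radius2_pos.le) := fun i =>
    relax P.gev_radius2_le (projRes σ ω (g i)) + (ω i : ℂ) • 1
  have hZcoef : ∀ i k, coef (Z i) k = symRes σ ω k * coef (g i) k + if k = 0 then (ω i : ℂ) else 0 :=
    fun i k => by rw [coef_add, coef_relax, coef_smul_one, projRes, coef_mult]
  have hZreal : ∀ i, RealValued (Z i) := fun i => by
    refine RealValued.add (fun x => ?_) (realValued_real_smul_one _)
    rw [ev_relax]
    exact (hg.1 i).mult norm_symRes_le symRes_neg x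
  have hder : ∀ i j, IsDer j (U i) (derFar P.hσ ω j (g i)) := fun i j =>
    isDer_derFar P.hσ ω j (g i)
  have hR := P.dispRadius_le
  -- The column sums are at most 4σ⁻¹μ ≤ 4/1792, so I + Du is invertible.
  have hDle : ∀ j, ∑ i, ‖derFar P.hσ ω j (g i)‖ ≤ 1 / 2 := fun j => by
    have h1 : ∑ i, ‖derFar P.hσ ω j (g i)‖ ≤ σ⁻¹ * ∑ i, ‖projFar σ ω (g i)‖ := by
      rw [Finset.mul_sum]
      exact Finset.sum_le_sum fun i _ => norm_derFar_le P.hσ ω j (g i)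
    have h2 := mul_le_mul_of_nonneg_left ((sum_norm_projFar_le (ω := ω) g).trans hg.2)
      (inv_nonneg.mpr P.hσ.le)
    linarith [hc.inv_mul_mu_le']
  have hpull : pullback (fun x => x + evVec U x) X = evVec Z := by
    funext x
    rw [pullback_id_add_eq_iff (hasFDerivAt_evVec hder) (by norm_num : (1 / 2 : ℝ) < 1)
      (l1_jac_le hDle)]
    funext i
    have h1 := congrArg (fun b => ev b x) (congrFun hfix i)
    simp only [elimMap] at h1
    rw [ev_sub, ev_comp_field (hX.sub_const ω) hadm, ev_sum] at h1
    have h2 := congrArg (fun b => ev b x) (projFar_add_projRes σ ω (g i))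
    have h3 := congrArg (fun b => ev b x) (sum_smul_derFar P.hσ ω (g i))
    simp only [ev_add, ev_sum, ev_smul] at h2 h3
    obtain ⟨p, hp⟩ : ∃ p : Fin d → ℝ, ∀ j, ev (derFar P.hσ ω j (g i)) x = (p j : ℂ) := ⟨_, fun j =>
      ((hg.1 i).mult (norm_symDer_le P.hσ j) (symDer_neg j)).ev_eq x⟩
    obtain ⟨q, hq⟩ : ∃ q : Fin d → ℝ, ∀ j, ev (projRes σ ω (g j)) x = (q j : ℂ) := ⟨_, fun j =>
      ((hg.1 j).mult norm_symRes_le symRes_neg).ev_eq x⟩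
    have hZx : ∀ j, evVec Z x j = q j + ω j := fun j => by
      simp only [evVec, Z, ev_add, ev_relax, ev_smul, ev_one, mul_one, Complex.add_re,
        Complex.ofReal_re, hq]
    rw [Pi.add_apply, jac_apply, hZx]
    simp only [hZx, mul_add, Finset.sum_add_distrib, hp, Complex.ofReal_re]
    have h4 : ((X (x + evVec U x) i - ω i : ℝ) : ℂ) -
        ∑ j, ev (derFar P.hσ ω j (g i)) x * ev (projRes σ ω (g j)) x =
        ∑ j, (ω j : ℂ) * ev (derFar P.hσ ω j (g i)) x + ev (projRes σ ω (g i)) x := by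
      rw [h3, h2, ← h1]
      simp only [ev_mul]
      rfl
    simp only [hp, hq] at h4
    norm_cast at h4
    have h5 : ∑ j, p j * ω j = ∑ j, ω j * p j := Finset.sum_congr rfl fun j _ => mul_comm _ _
    rw [h5]
    linarith
  refine ⟨evVec U, memF'_evVec P.radius1_pos hadm.1 hadm.2, ?_, ?_, ?_, ?_⟩
  · intro k hk
    funext i
    rw [fourierCoef_evVec hadm.1, hU, disp, invFar, coef_mult, symInv,
      Set.indicator_of_notMem hk, zero_mul, Pi.zero_apply]
  · refine (normF'_evVec_le P.radius1_pos hadm.1 hNP).trans ?_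
    -- The displacement is bounded by 2.04σ⁻¹e^{-ν} times the far norm of X, and e^{-ν} ≤ (C_ν -
    -- 1)/4.
    have h1 := hc.sum_norm_projFar_le_of_fixed hg hfix
    rw [← normFar_eq hX] at h1
    have h2 : 0 ≤ normFar s ρ σ ω X := tsum_nonneg fun k =>
      Set.indicator_nonneg (fun k _ => termF_nonneg s ρ X k) k
    have h3 := mul_le_mul_of_nonneg_right P.C_sub_one_ge h2
    have h4 := mul_nonneg P.C_sub_one_pos.le h2
    rw [div_mul_eq_mul_div, le_div_iff₀ P.hσ, mul_right_comm, mul_assoc 2,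
      inv_mul_cancel₀ P.hσ.ne']
    linarith
  · rw [hpull]
    exact memF_evVec P.radius2_pos hZreal
  · intro k hk
    funext i
    have hk0 : k ≠ 0 := fun h => by
      subst h
      exact hk zero_notMem_farModes
    rw [hpull, fourierCoef_evVec hZreal, hZcoef, symRes, Set.indicator_of_notMem hk, if_neg hk0,
      zero_mul, add_zero, Pi.zero_apply]

/-- The properties of a vector field `Y` obtained by a change of coordinates `id + u` which
eliminates the far from resonance modes. -/
structure Eliminated (P : StepParams d s ρ ν σ a) (ω : Fin d → ℝ) (X u : (Fin d → ℝ) → (Fin d → ℝ))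
    (m : ℝ) : Prop where
  mem : MemF s (radius2 d s ν ρ) fun x => pullback (fun x => x + u x) X x - ω
  modes : ModesIn (resModes σ ω) fun x => pullback (fun x => x + u x) X x - ω
  sum_le : ∑' k, termF s (radius2 d s ν ρ) (fun x => pullback (fun x => x + u x) X x - ω) k ≤
    4 * (Real.exp (-ν) * m)
  lip : ∀ x v, l1 (fderiv ℝ u x v) ≤ 1 / 2 * l1 v

/-- The displacement entering 𝓡_n is selected by choice and need not come from the fixed point. The
estimates are therefore a priori ones, valid for every u satisfying `Eliminates`. -/
theorem SmallField.eliminated (hX : MemF' s ρ X)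
    (hc : P.SmallField (fun i k => fourierCoef (fun x => X x - ω) k i)
      (normF' s ρ fun x => X x - ω)) {u : (Fin d → ℝ) → (Fin d → ℝ)}
    (hu : Eliminates s ρ ν σ ω X u) :
    P.Eliminated ω X u (normF' s ρ fun x => X x - ω) := by
  set m := normF' s ρ fun x => X x - ω with hm
  set Y := pullback (fun x => x + u x) X with hY
  have hR := P.dispRadius_le
  have hR0 := P.dispRadius_pos
  -- the size of `u`
  have hfar : 2 * normFar s ρ σ ω X ≤ m := by
    have hXf := hX.sub_const ω
    rw [hm, normF', normFar, ← tsum_mul_left]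
    refine Summable.tsum_le_tsum (fun k => ?_) ((hX.memF.2.2.indicator _).mul_left 2) hXf.2.2
    by_cases hk : k ∈ farModes σ ω
    · have hk0 : k ≠ 0 := fun h => zero_notMem_farModes (h ▸ hk)
      have e : termF s ρ (fun x => X x - ω) k = termF s ρ X k := by
        simp only [termF_eq_sum, fourierCoef_sub_const hX.1.continuous, if_neg hk0, sub_zero]
      rw [Set.indicator_of_mem hk, termF', e]
      -- Nonzero modes have 1 + |k| ≥ 2; hence the factor 2, and half the admissible radius for u.
      exact mul_le_mul_of_nonneg_right (by linarith [one_le_l1Z hk0]) (termF_nonneg _ _ _ _)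
    · rw [Set.indicator_of_notMem hk, mul_zero]
      exact termF'_nonneg _ _ _ _
  have hsize : normF' s (radius1 d s ν ρ) u ≤ dispRadius d s ν σ a / 2 := by
    refine hu.bound.trans ?_
    have h1 := hc.le_eps
    have h2 := P.C_sub_one_pos
    rw [epsRadius_eq, div_mul_eq_mul_div, le_div_iff₀ (by positivity)] at h1
    rw [div_mul_eq_mul_div, div_le_iff₀ P.hσ]
    have h3 := mul_le_mul_of_nonneg_right hfar h2.le
    linarith
  set U : Fin d → WAlg P.W := fieldRep P.hs P.radius1_pos.le hu.mem.memF with hU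
  have hUr : ∀ i, RealValued (U i) := realValued_fieldRep hu.mem.memF
  have hUev : evVec U = u := evVec_fieldRep hu.mem.memF
  have hNP : NPrimeLE U (normF' s (radius1 d s ν ρ) u) := nPrimeLE_fieldRep hu.mem
  have hadm : P.Adm U := ⟨hUr, hNP.1, hNP.2.trans (by linarith)⟩
  set D : Fin d → Fin d → WAlg P.W := fun i j => der j (U i) (hNP.summable_l1Z i) with hD
  have hder : ∀ i j, IsDer j (U i) (D i j) := fun i j => isDer_der j (U i) (hNP.summable_l1Z i)
  have hDreal : ∀ i j, RealValued (D i j) := fun i j => (hUr i).isDer (hder i j)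
  have hDle : ∀ j, ∑ i, ‖D i j‖ ≤ dispRadius d s ν σ a / 2 := fun j =>
    (hNP.sum_norm_der_le j).trans hsize
  have hDle' : ∀ j, ∑ i, ‖D i j‖ ≤ 1 / 2 := fun j => (hDle j).trans (by linarith)
  have hfd : ∀ x, HasFDerivAt u (jac D x) x := fun x => hUev ▸ hasFDerivAt_evVec hder x
  -- the equation satisfied by `Y`
  have hYeq : ∀ x, X (x + u x) = Y x + jac D x (Y x) := fun x =>
    (pullback_id_add_eq_iff hfd (by norm_num : (1 / 2 : ℝ) < 1) (l1_jac_le hDle')).mp rfl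
  set y : Fin d → WAlg (gev d s (radius2 d s ν ρ) P.hs P.radius2_pos.le) :=
    fieldRep P.hs P.radius2_pos.le hu.mem_pullback with hy
  set z : Fin d → WAlg (gev d s (radius2 d s ν ρ) P.hs P.radius2_pos.le) := fun i =>
    y i - (ω i : ℂ) • 1 with hz
  have hzev : ∀ i x, ev (z i) x = ((Y x i - ω i : ℝ) : ℂ) := fun i x => by
    rw [hz, ev_sub, ev_fieldRep, ev_smul, ev_one, mul_one, Complex.ofReal_sub]
  have hzr : ∀ i, RealValued (z i) := fun i x => by rw [hzev, Complex.ofReal_im]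
  have hzY : evVec z = fun x => Y x - ω := funext fun x => funext fun i => by
    rw [evVec, hzev, Complex.ofReal_re, Pi.sub_apply]
  have hzres : ∀ i k, k ∉ resModes σ ω → coef (z i) k = 0 := by
    intro i k hk
    have hk0 : k ≠ 0 := fun h => by
      subst h
      exact hk zero_notMem_farModes
    rw [hz, coef_sub, coef_smul_one, if_neg hk0, sub_zero, hy, coef_fieldRep,
      hu.modes_pullback k hk, Pi.zero_apply]
  let rl := relax (w := P.W) P.gev_radius2_le
  -- The conjugacy equation z + Du·ω + Du·z = f∘(id + u), moved to the width ρ'', where Y is known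
  -- to lie.
  have heq : ∀ i, z i + ∑ j, (ω j : ℂ) • rl (D i j) + ∑ j, rl (D i j) * z j =
      rl (P.comp (fun k => fourierCoef (fun x => X x - ω) k i) U) := by
    intro i
    refine ev_injective fun x => ?_
    have h1 := congrFun (hYeq x) i
    rw [Pi.add_apply, jac_apply] at h1
    simp only [rl, ev_add, ev_sum, ev_mul, ev_smul, ev_relax, hzev]
    rw [ev_comp_field (hX.sub_const ω) hadm, hUev]
    obtain ⟨p, hp⟩ : ∃ p : Fin d → ℝ, ∀ j, ev (D i j) x = (p j : ℂ) :=
      ⟨_, fun j => (hDreal i j).ev_eq x⟩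
    simp only [hp, Complex.ofReal_re] at h1
    simp only [hp, Pi.sub_apply, h1]
    norm_cast
    have h3 : ∀ j, p j * Y x j = ω j * p j + p j * (Y x j - ω j) := fun j => by ring
    simp only [h3, Finset.sum_add_distrib]
    ring
  -- Since u has only far modes, so has Du·ω, and the resonant projection removes the one term that
  -- is not small relative to z.
  have hωD : ∀ i k, k ∈ resModes σ ω → coef (∑ j, (ω j : ℂ) • rl (D i j)) k = 0 := by
    intro i k hk
    rw [coef_sum]
    refine Finset.sum_eq_zero fun j _ => ?_
    have h1 : coef (U i) k = 0 := by
      rw [hU, coef_fieldRep, hu.modes k hk, Pi.zero_apply]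
    rw [coef_smul, coef_relax, hder i j k, h1, mul_zero, mul_zero]
  have hzeq : ∀ i, z i = projRes σ ω
      (rl (P.comp (fun k => fourierCoef (fun x => X x - ω) k i) U) - ∑ j, rl (D i j) * z j) := by
    intro i
    rw [← heq, add_sub_cancel_right]
    refine ext fun k => ?_
    rw [projRes, coef_mult, coef_add, symRes]
    by_cases hk : k ∈ resModes σ ω
    · rw [Set.indicator_of_mem hk, hωD i k hk, add_zero, Pi.one_apply, one_mul]
    · rw [Set.indicator_of_notMem hk, hzres i k hk, zero_mul]
  -- From ‖z‖ ≤ 3.72μ + (R/2)‖z‖ and R ≤ 1/56, the last term is absorbed.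
  have hznorm : ∑ i, ‖z i‖ ≤ 4 * (Real.exp (-ν) * m) := by
    have h1 := hc.sum_norm_comp_le hadm
    have h2 := sum_norm_matVec_le (A := fun i j => rl (D i j)) (K := dispRadius d s ν σ a / 2)
      (fun j => (Finset.sum_le_sum fun i _ => norm_relax_le _ _).trans (hDle j)) z
    have h3 : ∑ i, ‖z i‖ ≤ ∑ i, ‖P.comp (fun k => fourierCoef (fun x => X x - ω) k i) U‖ +
        ∑ i, ‖∑ j, rl (D i j) * z j‖ := by
      rw [← Finset.sum_add_distrib]
      refine Finset.sum_le_sum fun i _ => ?_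
      conv_lhs => rw [hzeq i]
      refine (norm_projRes_le _ _).trans ((norm_sub_le _ _).trans ?_)
      exact add_le_add_left (norm_relax_le _ _) _
    have h4 : 0 ≤ ∑ i, ‖z i‖ := Finset.sum_nonneg fun _ _ => norm_nonneg _
    have h5 := mul_le_mul_of_nonneg_right hR h4
    have h6 := hc.mu_nonneg
    linarith
  refine ⟨?_, ?_, ?_, ?_⟩
  · rw [← hzY]
    exact memF_evVec P.radius2_pos hzr
  · intro k hk
    funext i
    rw [← hzY, fourierCoef_evVec hzr, hzres i k hk, Pi.zero_apply]
  · refine le_trans (le_of_eq ?_) hznorm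
    simp only [norm_eq]
    rw [← Summable.tsum_finsetSum fun i _ => summable_norm (z i), ← hzY]
    refine tsum_congr fun k => ?_
    rw [termF_eq_sum]
    exact Finset.sum_congr rfl fun i _ => by rw [fourierCoef_evVec hzr, gev_apply]
  · intro x v
    rw [(hfd x).fderiv]
    exact l1_jac_le hDle' x v

end StepParams

end GevreyRenorm

namespace GevreyRenorm

variable {d : ℕ}

open WAlg Filter Topology

/-! ### Rotation vectors -/

/-- If the i-th component is at least c everywhere, γ_i(t) - ct is nondecreasing, so every orbit
drifts with mean speed at least c. -/
theorem HasRot.le_of_forall_le {X : (Fin d → ℝ) → (Fin d → ℝ)} {ω : Fin d → ℝ} (h : HasRot X ω)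
    {i : Fin d} {c : ℝ} (hX : ∀ x, c ≤ X x i) : c ≤ ω i := by
  obtain ⟨γ, h0, hγ, hlim⟩ := h 0
  have hder : ∀ t, HasDerivAt (fun t => γ t i - c * t) (X (γ t) i - c) t := fun t => by
    exact ((hasDerivAt_pi.mp (hγ t) i).sub ((hasDerivAt_id t).const_mul c)).congr_deriv (by
      rw [mul_one])
  have hmono : Monotone fun t => γ t i - c * t :=
    monotone_of_deriv_nonneg (fun t => (hder t).differentiableAt) fun t => by
      rw [(hder t).deriv]
      exact sub_nonneg.mpr (hX _)
  have hi := (tendsto_pi_nhds.mp hlim) i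
  refine ge_of_tendsto hi ?_
  filter_upwards [eventually_gt_atTop 0] with t ht
  have h1 := hmono ht.le
  simp only [h0, Pi.zero_apply, mul_zero, sub_zero] at h1
  rw [Pi.smul_apply, sub_zero, smul_eq_mul, ← div_eq_inv_mul, le_div_iff₀ ht]
  linarith

theorem HasRot.le_of_forall_ge {X : (Fin d → ℝ) → (Fin d → ℝ)} {ω : Fin d → ℝ} (h : HasRot X ω)
    {i : Fin d} {c : ℝ} (hX : ∀ x, X x i ≤ c) : ω i ≤ c := by
  -- The reflection x ↦ -x reduces the upper bound to the lower one.
  have h' : HasRot (fun x => -X (-x)) (-ω) := by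
    intro x
    obtain ⟨γ, h0, hγ, hlim⟩ := h (-x)
    refine ⟨fun t => -γ t, by simp [h0], fun t => (hγ t).neg.congr_deriv (by simp), ?_⟩
    refine hlim.neg.congr fun t => ?_
    rw [← smul_neg]
    congr 1
    simp only [sub_neg_eq_add, neg_add]
    rfl
  have := h'.le_of_forall_le (i := i) (c := -c) fun x => neg_le_neg (hX _)
  exact neg_le_neg_iff.mp this

/-- The constant mode of `X - Rot X` is dominated by the other modes. -/
theorem HasRot.coefNorm_zero_le {X : (Fin d → ℝ) → (Fin d → ℝ)} {ω : Fin d → ℝ} (h : HasRot X ω)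
    {s r : ℝ} (hs : 1 ≤ s) (hr : 0 ≤ r) (hX : MemF s r fun x => X x - ω) :
    coefNorm (fun x => X x - ω) 0 ≤ ∑' k, if k = 0 then 0 else coefNorm (fun x => X x - ω) k := by
  set f : (Fin d → ℝ) → (Fin d → ℝ) := fun x => X x - ω with hf
  have hsum : ∀ i, Summable fun k => ‖fourierCoef f k i‖ := fun i =>
    (summable_coef (fieldRep hs hr hX i)).congr fun k => by rw [coef_fieldRep]
  have hsum' : ∀ i, Summable fun k => if k = 0 then 0 else ‖fourierCoef f k i‖ := fun i =>
    (hsum i).of_nonneg_of_le (fun k => by split_ifs <;> positivity)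
      fun k => by split_ifs <;> simp
  have hi : ∀ i, ‖fourierCoef f 0 i‖ ≤ ∑' k, if k = 0 then 0 else ‖fourierCoef f k i‖ := by
    intro i
    set B := ∑' k, if k = 0 then 0 else ‖fourierCoef f k i‖ with hB
    have hreal : fourierCoef f 0 i = ((fourierCoef f 0 i).re : ℂ) := by
      have := fourierCoef_neg f 0 i
      rw [neg_zero] at this
      exact (Complex.conj_eq_iff_re.mp this.symm).symm
    -- The component of f stays within B of its mean, so the i-th entry of the rotation vector lies
    -- within B of ω_i + f_0. As this entry is ω_i, the mean is at most B in modulus.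
    have hosc : ∀ x, |f x i - (fourierCoef f 0 i).re| ≤ B := by
      intro x
      have h1 := hasSum_ev (fieldRep hs hr hX i) x
      rw [ev_fieldRep] at h1
      simp only [coef_fieldRep] at h1
      have h2 := h1.sub (hasSum_ite_eq (0 : Fin d → ℤ) (fourierCoef f 0 i))
      have h3 : ∀ k, ‖fourierCoef f k i * chi k x - (if k = 0 then fourierCoef f 0 i else 0)‖ ≤
          if k = 0 then 0 else ‖fourierCoef f k i‖ := by
        intro k
        split_ifs with hk
        · subst hk; simp
        · simp
      have h4 := tsum_of_norm_bounded (hsum' i).hasSum h3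
      rwa [h2.tsum_eq, hreal, ← Complex.ofReal_sub, Complex.norm_real] at h4
    have h5 := h.le_of_forall_le (i := i) (c := ω i + (fourierCoef f 0 i).re - B) fun x => by
      have := (abs_le.mp (hosc x)).1
      simp only [hf, Pi.sub_apply] at this
      linarith
    have h6 := h.le_of_forall_ge (i := i) (c := ω i + (fourierCoef f 0 i).re + B) fun x => by
      have := (abs_le.mp (hosc x)).2
      simp only [hf, Pi.sub_apply] at this
      linarith
    rw [hreal, Complex.norm_real, Real.norm_eq_abs, abs_le]
    constructor <;> linarith
  calc coefNorm f 0 ≤ ∑ i, ∑' k, (if k = 0 then 0 else ‖fourierCoef f k i‖) :=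
        Finset.sum_le_sum fun i _ => hi i
    _ = _ := by
        rw [← Summable.tsum_finsetSum fun i _ => hsum' i]
        refine tsum_congr fun k => ?_
        split_ifs <;> simp [coefNorm]

/-! ### Changes of coordinates close to the identity -/

/-- Pairing with the sign vector of u(x) - u(y) turns the ℓ¹ distance into a scalar function along
the segment, so that the mean value inequality keeps the ℓ¹ constant q. -/
theorem l1_sub_le_of_fderiv {u : (Fin d → ℝ) → (Fin d → ℝ)} (hu : Differentiable ℝ u) {q : ℝ}
    (hq : ∀ x v, l1 (fderiv ℝ u x v) ≤ q * l1 v) (x y : Fin d → ℝ) :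
    l1 (u x - u y) ≤ q * l1 (x - y) := by
  let e : Fin d → ℝ := fun i => SignType.sign ((u x - u y) i)
  have he : ∀ i (v : ℝ), |e i * v| ≤ |v| := fun i v => by
    rw [abs_mul]
    refine mul_le_of_le_one_left (abs_nonneg v) ?_
    simp only [e]
    rcases lt_trichotomy ((u x - u y) i) 0 with h | h | h
    · rw [sign_neg h]; simp
    · rw [h]; simp
    · rw [sign_pos h]; simp
  have hder : ∀ θ : ℝ, HasDerivAt (fun θ : ℝ => ∑ i, e i * u (y + θ • (x - y)) i)
      (∑ i, e i * fderiv ℝ u (y + θ • (x - y)) (x - y) i) θ := by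
    intro θ
    have h1 : HasDerivAt (fun θ : ℝ => y + θ • (x - y)) (x - y) θ := by
      simpa using ((hasDerivAt_id θ).smul_const (x - y)).const_add y
    have h2 := (hu (y + θ • (x - y))).hasFDerivAt.comp_hasDerivAt θ h1
    exact HasDerivAt.fun_sum fun i _ => (hasDerivAt_pi.mp h2 i).const_mul (e i)
  have h := norm_image_sub_le_of_norm_deriv_le_segment_01'
    (f := fun θ : ℝ => ∑ i, e i * u (y + θ • (x - y)) i) (C := q * l1 (x - y))
    (fun θ _ => (hder θ).hasDerivWithinAt) fun θ _ => by
      refine le_trans ?_ (hq (y + θ • (x - y)) (x - y))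
      exact (Finset.abs_sum_le_sum_abs _ _).trans (Finset.sum_le_sum fun i _ => he i _)
  refine le_trans (le_of_eq ?_) ((le_abs_self _).trans h)
  simp only [one_smul, zero_smul, add_zero, add_sub_cancel]
  rw [← Finset.sum_sub_distrib, l1]
  refine Finset.sum_congr rfl fun i _ => ?_
  rw [← mul_sub, ← Pi.sub_apply]
  exact (sign_mul_self _).symm

theorem l1_le_card_mul_norm (v : Fin d → ℝ) : l1 v ≤ d * ‖v‖ := by
  refine (Finset.sum_le_card_nsmul _ _ ‖v‖ fun i _ => norm_le_pi_norm v i).trans (le_of_eq ?_)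
  simp

theorem norm_le_l1 (v : Fin d → ℝ) : ‖v‖ ≤ l1 v :=
  (pi_norm_le_iff_of_nonneg (l1_nonneg v)).mpr (abs_le_l1 v)

/-- The rotation vector is invariant under changes of coordinates close to the identity. -/
theorem HasRot.pullback_id_add {X u : (Fin d → ℝ) → (Fin d → ℝ)} {ω : Fin d → ℝ} (h : HasRot X ω)
    (hu : Differentiable ℝ u) {q : ℝ} (hq : q < 1)
    (hDu : ∀ x v, l1 (fderiv ℝ u x v) ≤ q * l1 v) {B : ℝ} (hB : ∀ x, ‖u x‖ ≤ B) :
    HasRot (pullback (fun x => x + u x) X) ω := by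
  have hlip := l1_sub_le_of_fderiv hu hDu
  -- A solution of x + u(x) = y is a fixed point of x ↦ y - u(x), a contraction in the ℓ¹ norm.
  have hsurj : ∀ y, ∃ x, x + u x = y := by
    intro y
    have hc : ∀ x z, ‖(WithLp.toLp 1 (y - u x) : PiLp 1 fun _ : Fin d => ℝ) -
        WithLp.toLp 1 (y - u z)‖ = l1 (u x - u z) := by
      intro x z
      rw [PiLp.norm_eq_of_L1, ← l1_neg]
      refine Finset.sum_congr rfl fun i _ => ?_
      rw [Real.norm_eq_abs]
      congr 1
      simp
    have hf : ContractingWith (max q 0).toNNReal fun x : PiLp 1 (fun _ : Fin d => ℝ) =>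
        (WithLp.toLp 1 (y - u (WithLp.ofLp x)) : PiLp 1 fun _ : Fin d => ℝ) := by
      refine ⟨by simpa using hq, LipschitzWith.of_dist_le_mul fun x z => ?_⟩
      rw [dist_eq_norm, dist_eq_norm, hc, Real.coe_toNNReal _ (le_max_right _ _)]
      refine (hlip _ _).trans (mul_le_mul (le_max_left _ _) (le_of_eq ?_) (l1_nonneg _)
        (le_max_right _ _))
      rw [PiLp.norm_eq_of_L1]
      rfl
    have hfix := congrArg WithLp.ofLp hf.fixedPoint_isFixedPt
    exact ⟨_, (eq_sub_iff_add_eq.mp hfix.symm)⟩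
  choose κ hκ using hsurj
  have hinv : ∀ x y, l1 (x - y) * (1 - q) ≤ l1 (x + u x - (y + u y)) := by
    intro x y
    have h1 := l1_add_le (x + u x - (y + u y)) (-(u x - u y))
    rw [l1_neg, show x + u x - (y + u y) + -(u x - u y) = x - y by abel] at h1
    linarith [hlip x y]
  have hκψ : ∀ x, κ (x + u x) = x := fun x => by
    have h1 := hinv (κ (x + u x)) x
    rw [hκ, sub_self] at h1
    have h2 : l1 (0 : Fin d → ℝ) = 0 := by simp [l1]
    rw [h2] at h1
    refine sub_eq_zero.mp (eq_zero_of_l1_nonpos ?_)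
    by_contra h3
    have := mul_pos (not_le.mp h3) (sub_pos.mpr hq)
    linarith
  have hκc : Continuous κ := by
    have hq' : 0 ≤ d / (1 - q) := div_nonneg (Nat.cast_nonneg d) (by linarith)
    refine (LipschitzWith.of_dist_le_mul (K := (d / (1 - q)).toNNReal) fun x y => ?_).continuous
    rw [Real.coe_toNNReal _ hq', dist_eq_norm, dist_eq_norm, div_mul_eq_mul_div,
      le_div_iff₀ (by linarith)]
    have h1 := hinv (κ x) (κ y)
    rw [hκ, hκ] at h1
    refine le_trans ?_ (h1.trans (l1_le_card_mul_norm _))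
    exact mul_le_mul_of_nonneg_right (norm_le_l1 _) (by linarith)
  intro x
  obtain ⟨γ, h0, hγ, hlim⟩ := h (x + u x)
  refine ⟨fun t => κ (γ t), by simp only [h0, hκψ], fun t => ?_, ?_⟩
  · have hinj := injective_id_add hq (hDu (κ (γ t)))
    let e : (Fin d → ℝ) ≃L[ℝ] (Fin d → ℝ) := (LinearEquiv.ofInjectiveEndo
      ((ContinuousLinearMap.id ℝ (Fin d → ℝ) + fderiv ℝ u (κ (γ t)) :
        (Fin d → ℝ) →L[ℝ] (Fin d → ℝ)) : (Fin d → ℝ) →ₗ[ℝ] (Fin d → ℝ))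
      hinj).toContinuousLinearEquiv
    have he : (e : (Fin d → ℝ) →L[ℝ] (Fin d → ℝ)) =
        ContinuousLinearMap.id ℝ (Fin d → ℝ) + fderiv ℝ u (κ (γ t)) := by ext v; rfl
    have hψ : HasFDerivAt (fun x => x + u x) (e : (Fin d → ℝ) →L[ℝ] (Fin d → ℝ)) (κ (γ t)) := by
      rw [he]
      exact (hasFDerivAt_id _).add (hu _).hasFDerivAt
    have h1 := (HasFDerivAt.of_local_left_inverse hκc.continuousAt hψ
      (Eventually.of_forall hκ)).comp_hasDerivAt t (hγ t)
    refine h1.congr_deriv ?_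
    rw [pullback, hψ.fderiv, ContinuousLinearMap.inverse_equiv, hκ]
  -- Corresponding orbits differ by values of the bounded function u, which vanish after division by
  -- t.
  · have hκγ : ∀ t, t⁻¹ • (κ (γ t) - x) = t⁻¹ • (γ t - (x + u x)) + t⁻¹ • (u x - u (κ (γ t))) := by
      intro t
      rw [← smul_add]
      congr 1
      have := hκ (γ t)
      rw [← this, hκψ]
      abel
    have hzero : Tendsto (fun t : ℝ => t⁻¹ • (u x - u (κ (γ t)))) atTop (𝓝 0) := by
      refine squeeze_zero_norm' (a := fun t : ℝ => t⁻¹ * (B + B)) ?_ ?_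
      · filter_upwards [eventually_gt_atTop 0] with t ht
        rw [norm_smul, Real.norm_of_nonneg (inv_pos.mpr ht).le]
        exact mul_le_mul_of_nonneg_left ((norm_sub_le _ _).trans (add_le_add (hB _) (hB _)))
          (inv_pos.mpr ht).le
      · simpa using tendsto_inv_atTop_zero.mul_const (B + B)
    simpa only [hκγ, add_zero] using hlim.add hzero

end GevreyRenorm

namespace GevreyRenorm

variable {d : ℕ}

open WAlg Filter Topology

/-! ### Linear changes of coordinates -/

/-- The real matrix of an element of `SL(d, ℤ)`. -/
noncomputable def realMat (T : Matrix.SpecialLinearGroup (Fin d) ℤ) : Matrix (Fin d) (Fin d) ℝ :=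
  T.1.map (Int.cast : ℤ → ℝ)

theorem realMat_mul (S T : Matrix.SpecialLinearGroup (Fin d) ℤ) :
    realMat (S * T) = realMat S * realMat T := by
  rw [realMat, Matrix.SpecialLinearGroup.coe_mul]
  exact Matrix.map_mul (f := Int.castRingHom ℝ)

theorem realMat_one : realMat (1 : Matrix.SpecialLinearGroup (Fin d) ℤ) = 1 := by
  rw [realMat, Matrix.SpecialLinearGroup.coe_one]
  exact Matrix.map_one _ Int.cast_zero Int.cast_one

theorem realMat_mulVec_inv (T : Matrix.SpecialLinearGroup (Fin d) ℤ) (x : Fin d → ℝ) :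
    (realMat T).mulVec ((realMat T⁻¹).mulVec x) = x := by
  rw [Matrix.mulVec_mulVec, ← realMat_mul, mul_inv_cancel, realMat_one, Matrix.one_mulVec]

theorem realMat_inv_mulVec (T : Matrix.SpecialLinearGroup (Fin d) ℤ) (x : Fin d → ℝ) :
    (realMat T⁻¹).mulVec ((realMat T).mulVec x) = x := by
  rw [Matrix.mulVec_mulVec, ← realMat_mul, inv_mul_cancel, realMat_one, Matrix.one_mulVec]

/-- Multiplication by a matrix as a continuous linear map. -/
noncomputable def mulVecCLM (A : Matrix (Fin d) (Fin d) ℝ) : (Fin d → ℝ) →L[ℝ] (Fin d → ℝ) :=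
  LinearMap.toContinuousLinearMap A.mulVecLin

@[simp] theorem mulVecCLM_apply (A : Matrix (Fin d) (Fin d) ℝ) (x : Fin d → ℝ) :
    mulVecCLM A x = A.mulVec x := rfl

theorem opT_apply (η : ℝ) (T : Matrix.SpecialLinearGroup (Fin d) ℤ)
    (Y : (Fin d → ℝ) → (Fin d → ℝ)) (x : Fin d → ℝ) :
    opT η T Y x = η • (realMat T).mulVec (Y ((realMat T⁻¹).mulVec x)) := by
  have h1 : fderiv ℝ (fun y => (realMat T⁻¹).mulVec y) x = mulVecCLM (realMat T⁻¹) :=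
    (mulVecCLM (realMat T⁻¹)).hasFDerivAt.fderiv
  have hinj : Function.Injective (mulVecCLM (realMat T⁻¹)) :=
    Function.LeftInverse.injective (g := (realMat T).mulVec) (realMat_mulVec_inv T)
  rw [opT]
  congr 1
  change (fderiv ℝ (fun y => (realMat T⁻¹).mulVec y) x).inverse
    (Y ((realMat T⁻¹).mulVec x)) = _
  rw [h1, inverse_apply_eq_iff hinj, mulVecCLM_apply, realMat_inv_mulVec]

theorem HasRot.opT {Y : (Fin d → ℝ) → (Fin d → ℝ)} {ω : Fin d → ℝ} (h : HasRot Y ω) {η : ℝ}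
    (hη : 0 < η) (T : Matrix.SpecialLinearGroup (Fin d) ℤ) :
    HasRot (opT η T Y) (η • (realMat T).mulVec ω) := by
  intro x
  obtain ⟨γ, h0, hγ, hlim⟩ := h ((realMat T⁻¹).mulVec x)
  refine ⟨fun t => (realMat T).mulVec (γ (η * t)), ?_, fun t => ?_, ?_⟩
  · simp only [mul_zero, h0, realMat_mulVec_inv]
  · have h1 : HasDerivAt (fun t => η * t) η t := by simpa using (hasDerivAt_id t).const_mul η
    have h2 := (mulVecCLM (realMat T)).hasFDerivAt.comp_hasDerivAt t ((hγ (η * t)).scomp t h1)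
    refine h2.congr_deriv ?_
    rw [map_smul, mulVecCLM_apply, opT_apply, realMat_inv_mulVec]
  · have h1 : Tendsto (fun t : ℝ => η * t) atTop atTop := tendsto_id.const_mul_atTop hη
    have h2 := (((mulVecCLM (realMat T)).continuous.tendsto ω).comp (hlim.comp h1)).const_smul η
    refine h2.congr' ?_
    filter_upwards with t
    simp only [Function.comp]
    rw [map_smul, map_sub, mulVecCLM_apply, mulVecCLM_apply, realMat_mulVec_inv, smul_smul, mul_inv,
      ← mul_assoc, mul_inv_cancel₀ hη.ne', one_mul]

theorem transpose_mulVec_cancel {S T : Matrix.SpecialLinearGroup (Fin d) ℤ} (h : T * S = 1)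
    (l : Fin d → ℤ) : S.1.transpose.mulVec (T.1.transpose.mulVec l) = l := by
  have h1 : T.1 * S.1 = 1 := by rw [← Matrix.SpecialLinearGroup.coe_mul, h]; rfl
  rw [Matrix.mulVec_mulVec, ← Matrix.transpose_mul, h1, Matrix.transpose_one, Matrix.one_mulVec]

/-- The action of `T^⊤` on Fourier indices. -/
def transposeEquiv (T : Matrix.SpecialLinearGroup (Fin d) ℤ) : (Fin d → ℤ) ≃ (Fin d → ℤ) where
  toFun l := T.1.transpose.mulVec l
  invFun k := (T⁻¹).1.transpose.mulVec k
  left_inv := transpose_mulVec_cancel (mul_inv_cancel T)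
  right_inv := transpose_mulVec_cancel (inv_mul_cancel T)

theorem transposeEquiv_zero (T : Matrix.SpecialLinearGroup (Fin d) ℤ) :
    transposeEquiv T 0 = 0 := by
  change T.1.transpose.mulVec 0 = 0
  exact Matrix.mulVec_zero _

theorem transposeEquiv_eq_zero (T : Matrix.SpecialLinearGroup (Fin d) ℤ) {l : Fin d → ℤ} :
    transposeEquiv T l = 0 ↔ l = 0 :=
  (transposeEquiv T).injective.eq_iff' (transposeEquiv_zero T)

theorem dotZ_mulVec (T : Matrix.SpecialLinearGroup (Fin d) ℤ) (k : Fin d → ℤ) (x : Fin d → ℝ) :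
    dotZ k ((realMat T).mulVec x) = dotZ (T.1.transpose.mulVec k) x := by
  simp only [dotZ, Matrix.mulVec, dotProduct, realMat, Matrix.map_apply, Matrix.transpose_apply]
  push_cast
  simp only [Finset.mul_sum, Finset.sum_mul]
  rw [Finset.sum_comm]
  exact Finset.sum_congr rfl fun i _ => Finset.sum_congr rfl fun j _ => by ring

theorem chi_transposeEquiv (T : Matrix.SpecialLinearGroup (Fin d) ℤ) (l : Fin d → ℤ)
    (x : Fin d → ℝ) : chi (transposeEquiv T l) ((realMat T⁻¹).mulVec x) = chi l x := by
  rw [chi, dotZ_mulVec, show (T⁻¹).1.transpose.mulVec (transposeEquiv T l) = l from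
    (transposeEquiv T).left_inv l, chi]

theorem sum_abs_le_matNorm (T : Matrix (Fin d) (Fin d) ℤ) (j : Fin d) :
    ∑ i, |(T i j : ℝ)| ≤ matNorm T :=
  le_ciSup (f := fun j => ∑ i, |(T i j : ℝ)|) (Set.finite_range _).bddAbove j

theorem matNorm_nonneg (T : Matrix (Fin d) (Fin d) ℤ) : 0 ≤ matNorm T :=
  Real.iSup_nonneg fun _ => Finset.sum_nonneg fun _ _ => abs_nonneg _

/-! ### Effect of a linear change of coordinates on Fourier norms -/

section LinearChange

variable {s r : ℝ} {z : (Fin d → ℝ) → (Fin d → ℝ)} (η : ℝ)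
  (T : Matrix.SpecialLinearGroup (Fin d) ℤ)

/-- The absolutely convergent series of z is reindexed by T^⊤ and its coefficients are read off by
uniqueness; no change of variables in the integral is needed. -/
theorem fourierCoef_linearChange (hs : 1 ≤ s) (hr : 0 ≤ r) (hz : MemF s r z) (l : Fin d → ℤ)
    (i : Fin d) :
    fourierCoef (fun x => η • (realMat T).mulVec (z ((realMat T⁻¹).mulVec x))) l i =
      ∑ j, ((η * (T.1 i j : ℝ) : ℝ) : ℂ) * fourierCoef z (transposeEquiv T l) j := by
  set κ := transposeEquiv T with hκ
  have hsum : ∀ j, Summable fun l => ‖fourierCoef z (κ l) j‖ := fun j =>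
    (κ.summable_iff (f := fun k => ‖fourierCoef z k j‖)).mpr
      ((summable_coef (fieldRep hs hr hz j)).congr fun k => by rw [coef_fieldRep])
  have hval : ∀ x j, HasSum (fun l => fourierCoef z (κ l) j * chi l x)
      (z ((realMat T⁻¹).mulVec x) j : ℂ) := by
    intro x j
    have h1 := hasSum_ev (fieldRep hs hr hz j) ((realMat T⁻¹).mulVec x)
    rw [ev_fieldRep] at h1
    have h2 := κ.hasSum_iff.mpr h1
    refine h2.congr_fun fun l => ?_
    rw [Function.comp, coef_fieldRep, chi_transposeEquiv]
  set c : (Fin d → ℤ) → ℂ := fun l =>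
    ∑ j, ((η * (T.1 i j : ℝ) : ℝ) : ℂ) * fourierCoef z (κ l) j with hc
  have hcs : Summable fun l => ‖c l‖ := by
    refine (summable_sum (s := Finset.univ) fun j _ =>
      (hsum j).mul_left ‖((η * (T.1 i j : ℝ) : ℝ) : ℂ)‖).of_nonneg_of_le
      (fun _ => norm_nonneg _) fun l => ?_
    refine (norm_sum_le _ _).trans (Finset.sum_le_sum fun j _ => ?_)
    rw [norm_mul]
  rw [fourierCoef_eq_fc]
  refine Eq.trans (fc_congr (fun x => ?_) l) (fc_tsum hcs l)
  have h3 := hasSum_sum (s := Finset.univ) fun j _ =>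
    (hval x j).mul_left ((η * (T.1 i j : ℝ) : ℝ) : ℂ)
  have h4 : (((η • (realMat T).mulVec (z ((realMat T⁻¹).mulVec x))) i : ℝ) : ℂ) =
      ∑ j, ((η * (T.1 i j : ℝ) : ℝ) : ℂ) * (z ((realMat T⁻¹).mulVec x) j : ℂ) := by
    rw [Pi.smul_apply, Matrix.mulVec, dotProduct, smul_eq_mul, Finset.mul_sum]
    push_cast
    refine Finset.sum_congr rfl fun j _ => ?_
    rw [realMat, Matrix.map_apply]
    push_cast
    ring
  rw [h4, ← h3.tsum_eq]
  refine tsum_congr fun l => ?_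
  rw [hc, Finset.sum_mul]
  exact Finset.sum_congr rfl fun j _ => by ring

theorem coefNorm_linearChange_le (hs : 1 ≤ s) (hr : 0 ≤ r) (hz : MemF s r z) (l : Fin d → ℤ) :
    coefNorm (fun x => η • (realMat T).mulVec (z ((realMat T⁻¹).mulVec x))) l ≤
      |η| * matNorm T.1 * coefNorm z (transposeEquiv T l) := by
  calc coefNorm (fun x => η • (realMat T).mulVec (z ((realMat T⁻¹).mulVec x))) l
      ≤ ∑ i, ∑ j, |η| * |(T.1 i j : ℝ)| * ‖fourierCoef z (transposeEquiv T l) j‖ := by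
        refine Finset.sum_le_sum fun i _ => ?_
        rw [fourierCoef_linearChange η T hs hr hz]
        refine (norm_sum_le _ _).trans (Finset.sum_le_sum fun j _ => ?_)
        rw [norm_mul, Complex.norm_real, Real.norm_eq_abs, abs_mul]
    _ = ∑ j, |η| * (∑ i, |(T.1 i j : ℝ)|) * ‖fourierCoef z (transposeEquiv T l) j‖ := by
        rw [Finset.sum_comm]
        simp only [Finset.mul_sum, Finset.sum_mul]
    _ ≤ ∑ j, |η| * matNorm T.1 * ‖fourierCoef z (transposeEquiv T l) j‖ :=
        Finset.sum_le_sum fun j _ => mul_le_mul_of_nonneg_right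
          (mul_le_mul_of_nonneg_left (sum_abs_le_matNorm T.1 j) (abs_nonneg _)) (norm_nonneg _)
    _ = _ := by rw [← Finset.mul_sum, coefNorm]

theorem contDiff_linearChange (hz : ContDiff ℝ ((⊤ : ℕ∞) : WithTop ℕ∞) z) :
    ContDiff ℝ ((⊤ : ℕ∞) : WithTop ℕ∞)
      fun x => η • (realMat T).mulVec (z ((realMat T⁻¹).mulVec x)) :=
  ((mulVecCLM (realMat T)).contDiff.comp
    (hz.comp (mulVecCLM (realMat T⁻¹)).contDiff)).const_smul η

theorem isPeriodic_linearChange (hz : IsPeriodic z) :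
    IsPeriodic fun x => η • (realMat T).mulVec (z ((realMat T⁻¹).mulVec x)) := by
  intro x n
  have h : (realMat T⁻¹).mulVec (fun i => x i + 2 * Real.pi * (n i : ℝ)) =
      fun i => (realMat T⁻¹).mulVec x i + 2 * Real.pi * (((T⁻¹).1.mulVec n) i : ℝ) := by
    funext i
    simp only [Matrix.mulVec, dotProduct, realMat, Matrix.map_apply]
    push_cast
    simp only [mul_add, Finset.sum_add_distrib, Finset.mul_sum]
    congr 1
    exact Finset.sum_congr rfl fun j _ => by ring
  simp only [h]
  rw [hz]

variable {η T}

/-- The weight gained by a linear change of coordinates which contracts the indices in `I`. -/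
theorem termF'_linearChange_le {r' δ φ A : ℝ} {I : Set (Fin d → ℤ)} (hs : 1 ≤ s) (hr : 0 ≤ r)
    (hz : MemF s r z) (hI : ModesIn I z) (hr' : 0 ≤ r') (hδ : 0 < δ) (hφ : 1 ≤ φ) (hA0 : 0 ≤ A)
    (hA : ∀ k ∈ I, k ≠ 0 → l1Z ((transposeEquiv T).symm k) ≤ A * l1Z k)
    (hrA : (r' + δ + Real.log φ) * A ^ (1 / s) ≤ r) {l : Fin d → ℤ} (hl : l ≠ 0) :
    termF' s r' (fun x => η • (realMat T).mulVec (z ((realMat T⁻¹).mulVec x))) l ≤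
      |η| * matNorm T.1 * (1 + s ^ s / δ ^ s) / φ * termF s r z (transposeEquiv T l) := by
  set κ := transposeEquiv T with hκ
  have hcoef := coefNorm_linearChange_le η T hs hr hz l
  rw [← hκ] at hcoef
  set f := fun x => η • (realMat T).mulVec (z ((realMat T⁻¹).mulVec x)) with hf
  by_cases hk : κ l ∈ I
  · have hk0 : κ l ≠ 0 := fun h => hl ((transposeEquiv_eq_zero T).mp h)
    have h1 : l1Z l ≤ A * l1Z (κ l) := by simpa [hκ] using hA (κ l) hk hk0
    have hp : 0 ≤ 1 / s := by positivity
    have h2 : gexp s l ≤ A ^ (1 / s) * gexp s (κ l) := by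
      rw [gexp, gexp, ← Real.mul_rpow hA0 (l1Z_nonneg _)]
      exact Real.rpow_le_rpow (l1Z_nonneg _) h1 hp
    have hlog : 0 ≤ Real.log φ := Real.log_nonneg hφ
    have hφ0 : 0 < φ := by linarith
    have h3 : (r' + δ + Real.log φ) * gexp s l ≤ r * gexp s (κ l) := by
      refine (mul_le_mul_of_nonneg_left h2 (by positivity)).trans ?_
      rw [← mul_assoc]
      exact mul_le_mul_of_nonneg_right hrA (gexp_nonneg s _)
    have hg1 := one_le_gexp hs hl
    -- The share δ of the width pays for the weight 1 + |l| of the primed norm.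
    have h4 : 1 + l1Z l ≤ (1 + s ^ s / δ ^ s) * Real.exp (δ * gexp s l) := by
      have e1 := l1Z_le_exp hs hδ l
      have e2 : 1 ≤ Real.exp (δ * gexp s l) :=
        Real.one_le_exp (mul_nonneg hδ.le (gexp_nonneg s l))
      linarith
    -- The share log φ gains a factor φ, because |l|^{1/s} ≥ 1; this is why l = 0 is excluded.
    have h5 : φ ≤ Real.exp (Real.log φ * gexp s l) := by
      rw [← Real.log_le_iff_le_exp hφ0]
      exact le_mul_of_one_le_right hlog hg1
    have hss : 0 ≤ s ^ s / δ ^ s := by positivity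
    have h6 : φ * ((1 + l1Z l) * Real.exp (r' * gexp s l)) ≤
        (1 + s ^ s / δ ^ s) * Real.exp (r * gexp s (κ l)) := by
      calc φ * ((1 + l1Z l) * Real.exp (r' * gexp s l))
          ≤ Real.exp (Real.log φ * gexp s l) *
            (((1 + s ^ s / δ ^ s) * Real.exp (δ * gexp s l)) * Real.exp (r' * gexp s l)) := by
            have := l1Z_nonneg l
            gcongr
        _ = (1 + s ^ s / δ ^ s) * Real.exp ((r' + δ + Real.log φ) * gexp s l) := by
            rw [add_mul (r' + δ), add_mul r', Real.exp_add, Real.exp_add]; ring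
        _ ≤ _ := by gcongr
    have hK : 0 ≤ |η| * matNorm T.1 := mul_nonneg (abs_nonneg _) (matNorm_nonneg _)
    rw [div_mul_eq_mul_div, le_div_iff₀ hφ0]
    calc termF' s r' f l * φ = coefNorm f l * (φ * ((1 + l1Z l) * Real.exp (r' * gexp s l))) := by
          rw [termF', termF, gexp]; ring
      _ ≤ (|η| * matNorm T.1 * coefNorm z (κ l)) *
          ((1 + s ^ s / δ ^ s) * Real.exp (r * gexp s (κ l))) :=
          mul_le_mul hcoef h6 (by have := l1Z_nonneg l; positivity)
            (mul_nonneg hK (coefNorm_nonneg _ _))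
      _ = _ := by rw [termF, gexp]; ring
  · have h0 : coefNorm z (κ l) = 0 := by
      rw [coefNorm, hI _ hk]; simp
    have h1 : coefNorm f l = 0 :=
      le_antisymm (by rwa [h0, mul_zero] at hcoef) (coefNorm_nonneg f l)
    rw [termF', termF, termF, h0, h1]
    simp

/-- The nonzero modes gain 1/φ; the constant mode gains nothing by itself. If it is dominated by the
others, it at most doubles the bound, hence the factor 2. -/
theorem linearChange_bound {r' δ φ A : ℝ} {I : Set (Fin d → ℤ)} (hs : 1 ≤ s) (hr : 0 ≤ r)
    (hz : MemF s r z) (hI : ModesIn I z) (hr' : 0 ≤ r') (hδ : 0 < δ) (hφ : 1 ≤ φ) (hA0 : 0 ≤ A)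
    (hA : ∀ k ∈ I, k ≠ 0 → l1Z ((transposeEquiv T).symm k) ≤ A * l1Z k)
    (hrA : (r' + δ + Real.log φ) * A ^ (1 / s) ≤ r) :
    MemF' s r' (fun x => η • (realMat T).mulVec (z ((realMat T⁻¹).mulVec x))) ∧
    (coefNorm (fun x => η • (realMat T).mulVec (z ((realMat T⁻¹).mulVec x))) 0 ≤
        (∑' k, if k = 0 then 0 else
          coefNorm (fun x => η • (realMat T).mulVec (z ((realMat T⁻¹).mulVec x))) k) →
      normF' s r' (fun x => η • (realMat T).mulVec (z ((realMat T⁻¹).mulVec x))) ≤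
        2 * (|η| * matNorm T.1 * (1 + s ^ s / δ ^ s) / φ * ∑' k, termF s r z k)) := by
  set f := fun x => η • (realMat T).mulVec (z ((realMat T⁻¹).mulVec x)) with hf
  set K := |η| * matNorm T.1 * (1 + s ^ s / δ ^ s) / φ with hKdef
  have hK : 0 ≤ K := by
    have h1 := matNorm_nonneg T.1
    positivity
  have hle : ∀ l, (if l = 0 then 0 else termF' s r' f l) ≤
      K * termF s r z (transposeEquiv T l) := by
    intro l
    split_ifs with hl
    · exact mul_nonneg hK (termF_nonneg _ _ _ _)
    · exact termF'_linearChange_le hs hr hz hI hr' hδ hφ hA0 hA hrA hl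
  have hsum : Summable fun l => K * termF s r z (transposeEquiv T l) :=
    (((transposeEquiv T).summable_iff (f := termF s r z)).mpr hz.2.2).mul_left K
  have hsum' : Summable fun l => if l = 0 then 0 else termF' s r' f l :=
    hsum.of_nonneg_of_le (fun l => by split_ifs; exacts [le_rfl, termF'_nonneg _ _ _ _]) hle
  have hS : ∑' l, (if l = 0 then 0 else termF' s r' f l) ≤ K * ∑' k, termF s r z k := by
    refine (hsum'.tsum_le_tsum hle hsum).trans (le_of_eq ?_)
    rw [tsum_mul_left, (transposeEquiv T).tsum_eq (termF s r z)]
  have hsplit : ∀ l, termF' s r' f l =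
      (if l = 0 then 0 else termF' s r' f l) + if l = 0 then termF' s r' f 0 else 0 := by
    intro l
    split_ifs with hl
    · rw [hl, zero_add]
    · rw [add_zero]
  have hsingle := hasSum_ite_eq (0 : Fin d → ℤ) (termF' s r' f 0)
  have hmem : Summable (termF' s r' f) :=
    (hsum'.add hsingle.summable).congr fun l => (hsplit l).symm
  refine ⟨⟨contDiff_linearChange η T hz.1, isPeriodic_linearChange η T hz.2.1, hmem⟩, fun h0 => ?_⟩
  have h1 : termF' s r' f 0 = coefNorm f 0 := by
    have := gexp_zero (d := d) hs
    rw [gexp] at this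
    rw [termF', termF, this]
    simp
  have hle2 : ∀ k, (if k = 0 then 0 else coefNorm f k) ≤
      if k = 0 then 0 else termF' s r' f k := by
    intro k
    split_ifs with hk
    · exact le_rfl
    · refine le_trans ?_ (termF_le_termF' s r' f k)
      exact le_mul_of_one_le_right (coefNorm_nonneg f k)
        (Real.one_le_exp (mul_nonneg hr' (gexp_nonneg s k)))
  have h2 : ∑' k, (if k = 0 then 0 else coefNorm f k) ≤ K * ∑' k, termF s r z k := by
    refine le_trans (Summable.tsum_le_tsum hle2 ?_ hsum') hS
    exact hsum'.of_nonneg_of_le (fun l => by split_ifs; exacts [le_rfl, coefNorm_nonneg _ _]) hle2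
  have h3 : normF' s r' f = ∑' l, (if l = 0 then 0 else termF' s r' f l) + termF' s r' f 0 := by
    rw [normF', tsum_congr hsplit, hsum'.tsum_add hsingle.summable, hsingle.tsum_eq]
  rw [h3, h1]
  linarith

end LinearChange

end GevreyRenorm

namespace GevreyRenorm

open WAlg Filter Topology

/-! ### The renormalization scheme -/

/-- Needed so that the supremum defining A_n is over a nonempty set. A large multiple of ω_i is
corrected by the nearest multiple of ω_j: then |k·ω| stays at most |ω_j| while |k| ≥ n is
arbitrarily large. -/
theorem exists_resModes_ne_zero {m : ℕ} (hm : 1 ≤ m) {σ : ℝ} (hσ : 0 < σ)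
    (ω : Fin (m + 1) → ℝ) : ∃ k ∈ resModes σ ω, k ≠ 0 := by
  let i : Fin (m + 1) := 0
  let j : Fin (m + 1) := Fin.last m
  have hij : i ≠ j := by
    simp only [i, j, ne_eq, Fin.ext_iff, Fin.val_zero, Fin.val_last]
    omega
  by_cases hj : ω j = 0
  · refine ⟨Pi.single j 1, ?_, by simp⟩
    have : dotZ (Pi.single j 1) ω = 0 := by
      rw [dotZ, Finset.sum_eq_single j]
      · simp [hj]
      · intro b _ hb; simp [hb]
      · simp
    simp only [resModes, farModes, Set.mem_compl_iff, Set.mem_ofPred_eq, this, abs_zero, not_lt]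
    exact mul_nonneg hσ.le (l1Z_nonneg _)
  · obtain ⟨n, hn⟩ := exists_nat_gt (|ω j| / σ)
    have hn0 : 0 < n := Nat.cast_pos.mp ((div_nonneg (abs_nonneg _) hσ.le).trans_lt hn)
    set q : ℤ := -round (n * ω i / ω j) with hq
    set k : Fin (m + 1) → ℤ := Pi.single i (n : ℤ) + Pi.single j q with hk
    have hki : k i = n := by simp [hk, hij]
    refine ⟨k, ?_, fun h => ?_⟩
    · have hdot : dotZ k ω = n * ω i + q * ω j := by
        rw [hk, dotZ_add_left, dotZ, dotZ, Finset.sum_eq_single i, Finset.sum_eq_single j]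
        · simp
        · intro b _ hb; simp [hb]
        · simp
        · intro b _ hb; simp [hb]
        · simp
      have h1 : |dotZ k ω| ≤ |ω j| := by
        have e : dotZ k ω = ω j * (n * ω i / ω j - round (n * ω i / ω j)) := by
          rw [hdot, hq]
          push_cast
          field_simp
          ring
        rw [e, abs_mul]
        have := abs_sub_round (n * ω i / ω j)
        exact mul_le_of_le_one_right (abs_nonneg _) (by linarith)
      have h2 : (n : ℝ) ≤ l1Z k := by
        have := abs_le_l1Z k i
        rw [hki] at this
        simpa using this
      simp only [resModes, farModes, Set.mem_compl_iff, Set.mem_ofPred_eq, not_lt]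
      rw [div_lt_iff₀ hσ] at hn
      nlinarith
    · have := congrFun h i
      rw [hki, Pi.zero_apply] at this
      omega

theorem l1Z_mulVec_le {d : ℕ} (M : Matrix (Fin d) (Fin d) ℤ) (k : Fin d → ℤ) :
    l1Z (M.mulVec k) ≤ matNorm M * l1Z k := by
  calc l1Z (M.mulVec k) ≤ ∑ i, ∑ j, |(M i j : ℝ)| * |(k j : ℝ)| := by
        refine Finset.sum_le_sum fun i _ => ?_
        rw [Matrix.mulVec, dotProduct]
        push_cast
        refine (Finset.abs_sum_le_sum_abs _ _).trans (le_of_eq ?_)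
        exact Finset.sum_congr rfl fun j _ => abs_mul _ _
    _ = ∑ j, (∑ i, |(M i j : ℝ)|) * |(k j : ℝ)| := by
        rw [Finset.sum_comm]; simp only [Finset.sum_mul]
    _ ≤ matNorm M * l1Z k := by
        rw [l1Z, Finset.mul_sum]
        exact Finset.sum_le_sum fun j _ =>
          mul_le_mul_of_nonneg_right (sum_abs_le_matNorm M j) (abs_nonneg _)

namespace Scheme

variable {m : ℕ} (S : Scheme m)

theorem lam_pos (n : ℕ) : 0 < S.lam n := Real.exp_pos _

theorem eta_pos (n : ℕ) : 0 < S.eta n := div_pos (S.lam_pos n) (S.lam_pos _)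

theorem omega_eq (n : ℕ) : S.omega n = S.lam n • (realMat (S.P n)).mulVec (freq S.α) := by
  funext i
  have h1 : (S.M n).1 = (realMat (S.P n) * M0mat S.α) * Matrix.diagonal (flowDiag m (S.t n)) := by
    rw [M, Matrix.SpecialLinearGroup.coe_mul, Matrix.SpecialLinearGroup.coe_mul]
    rfl
  rw [omega, h1, Matrix.mul_diagonal, Pi.smul_apply, smul_eq_mul, mul_comm, lam, flowDiag,
    Fin.snoc_last]
  congr 1
  rw [Matrix.mul_apply, Matrix.mulVec, dotProduct]
  refine Finset.sum_congr rfl fun j _ => ?_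
  rw [M0mat, Matrix.updateCol_self]

theorem omega_zero {F : Set (Matrix.SpecialLinearGroup (Fin (m + 1)) ℝ)} (h : S.IsMCF F) :
    S.omega 0 = freq S.α := by
  rw [omega_eq, lam, h.t_zero, h.P_zero, realMat_one, Matrix.one_mulVec, mul_zero, Real.exp_zero,
    one_smul]

theorem omega_succ (n : ℕ) :
    S.omega (n + 1) = S.eta (n + 1) • (realMat (S.T (n + 1))).mulVec (S.omega n) := by
  rw [omega_eq, omega_eq, Matrix.mulVec_smul, smul_smul, Matrix.mulVec_mulVec, T, ← realMat_mul,
    Nat.add_sub_cancel, inv_mul_cancel_right, eta, Nat.add_sub_cancel,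
    div_mul_cancel₀ _ (S.lam_pos n).ne']

/-- The supremum of an unbounded set of reals would take the default value 0; the operator norm
bounds all the ratios. -/
theorem bddAbove_A (n : ℕ) : BddAbove
    ((fun k => l1Z ((S.T n)⁻¹.1.transpose.mulVec k) / l1Z k) ''
      {k | k ∈ resModes (S.σ (n - 1)) (S.omega (n - 1)) ∧ k ≠ 0}) := by
  refine ⟨matNorm (S.T n)⁻¹.1.transpose, ?_⟩
  rintro _ ⟨k, ⟨-, hk⟩, rfl⟩
  have h1 := one_le_l1Z hk
  exact (div_le_iff₀ (by linarith)).mpr (l1Z_mulVec_le _ _)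

theorem l1Z_transpose_le (n : ℕ) {k : Fin (m + 1) → ℤ}
    (hk : k ∈ resModes (S.σ n) (S.omega n)) (hk0 : k ≠ 0) :
    l1Z ((transposeEquiv (S.T (n + 1))).symm k) ≤ S.A (n + 1) * l1Z k := by
  have h1 := one_le_l1Z hk0
  rw [← div_le_iff₀ (by linarith)]
  exact le_csSup (S.bddAbove_A (n + 1)) ⟨k, ⟨hk, hk0⟩, rfl⟩

/-- Excludes the default value 0 of an empty supremum, for which the recursion for ρ_n would divide
by zero. -/
theorem A_pos (hm : 1 ≤ m) (n : ℕ) (hσ : 0 < S.σ n) : 0 < S.A (n + 1) := by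
  obtain ⟨k, hk, hk0⟩ := exists_resModes_ne_zero hm hσ (S.omega n)
  have h1 := S.l1Z_transpose_le n hk hk0
  have h2 : (transposeEquiv (S.T (n + 1))).symm k ≠ 0 := fun h => hk0 (by
    rw [Equiv.symm_apply_eq, transposeEquiv_zero] at h
    exact h)
  have h3 := one_le_l1Z h2
  have h4 := one_le_l1Z hk0
  by_contra h5
  nlinarith

theorem one_le_phi (n : ℕ) : 1 ≤ S.phi n := le_max_right _ _

/-- The hypotheses on the parameters of a renormalization scheme. -/
structure Admissible : Prop where
  hm : 1 ≤ m
  hs : 1 ≤ S.s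
  hν : 0 < S.ν
  hδ : 0 < S.δ
  hσ : ∀ n, 0 < S.σ n ∧ S.σ n < l1 (S.omega n)
  hθ : ∀ n, 1 ≤ n → 0 < S.θ n ∧ S.θ n ≤ 1

variable {S}

namespace Admissible

variable (h : S.Admissible)
include h

theorem b_pos : 0 < S.b := by
  have h1 := le_beta (d := m + 1) h.hs (by omega)
  have h2 := h.hs
  rw [b]
  linarith

theorem A_rpow_pos (n : ℕ) : 0 < S.A (n + 1) ^ (1 / S.s) :=
  Real.rpow_pos_of_pos (S.A_pos h.hm n (h.hσ n).1) _

theorem term_nonneg (n : ℕ) :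
    0 ≤ S.δ + S.ν * (1 + S.b + S.b ^ 2) / (S.b ^ 2 * S.A (n + 1) ^ (1 / S.s)) +
      Real.log (S.phi (n + 1)) := by
  have h1 := h.b_pos
  have h2 := h.A_rpow_pos n
  have h3 := Real.log_nonneg (S.one_le_phi (n + 1))
  have h4 := h.hν
  have h5 := h.hδ
  positivity

omit h in
theorem B_succ (n : ℕ) : S.B (n + 1) = S.B n + S.b ^ (2 * (n + 1)) *
    (∏ j ∈ Finset.Icc 1 (n + 1), S.A j ^ (1 / S.s)) *
    (S.δ + S.ν * (1 + S.b + S.b ^ 2) / (S.b ^ 2 * S.A (n + 1) ^ (1 / S.s)) +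
      Real.log (S.phi (n + 1))) := by
  rw [B, Finset.sum_Icc_succ_top (by omega), ← B]

theorem prod_pos (n : ℕ) : 0 < S.b ^ (2 * n) * ∏ j ∈ Finset.Icc 1 n, S.A j ^ (1 / S.s) := by
  refine mul_pos (pow_pos h.b_pos _) (Finset.prod_pos fun j hj => ?_)
  obtain ⟨i, rfl⟩ := Nat.exists_eq_add_of_le' (Finset.mem_Icc.mp hj).1
  exact h.A_rpow_pos i

theorem monotone_B : Monotone S.B := monotone_nat_of_le_succ fun n => by
  rw [B_succ]
  exact le_add_of_nonneg_right (mul_nonneg (h.prod_pos (n + 1)).le (h.term_nonneg n))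

/-- Multiplied by the accumulated expansion β^{2n}∏A_j^{1/s}, the affine recursion for the widths
telescopes, and the total loss is 𝓑_n. -/
theorem prod_mul_rho (n : ℕ) :
    (S.b ^ (2 * n) * ∏ j ∈ Finset.Icc 1 n, S.A j ^ (1 / S.s)) * S.rho n = S.ρ - S.B n := by
  induction n with
  | zero => simp [rho, B]
  | succ n ih =>
    have h1 := h.b_pos
    have h2 := h.A_rpow_pos n
    rw [B_succ, ← sub_sub, ← ih, rho, Finset.prod_Icc_succ_top (by omega)]
    field_simp
    ring

/-- As 𝓑 is nondecreasing, each 𝓑_n is at most its limit, which lies below ρ. -/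
theorem rho_pos {L : ℝ} (hL : Tendsto S.B atTop (𝓝 L)) (hρ : L < S.ρ) (n : ℕ) : 0 < S.rho n := by
  have h1 := h.monotone_B.ge_of_tendsto hL n
  have h2 := h.prod_mul_rho n
  have h3 : 0 < (S.b ^ (2 * n) * ∏ j ∈ Finset.Icc 1 n, S.A j ^ (1 / S.s)) * S.rho n := by
    rw [h2]; linarith
  exact pos_of_mul_pos_right h3 (h.prod_pos n).le

/-- `ρ''` is the width from which the linear change of coordinates leads to `ρ_{n+1}`. -/
theorem width_eq (n : ℕ) :
    (S.rho (n + 1) + S.δ + Real.log (S.phi (n + 1))) * S.A (n + 1) ^ (1 / S.s) =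
      (S.rho n - S.ν * (1 + S.b + S.b ^ 2)) / S.b ^ 2 := by
  have h1 := h.b_pos
  have h2 := h.A_rpow_pos n
  rw [rho]
  field_simp
  ring

theorem stepParams {L : ℝ} (hL : Tendsto S.B atTop (𝓝 L)) (hρ : L < S.ρ) (n : ℕ) :
    StepParams (m + 1) S.s (S.rho n) S.ν (S.σ n) (l1 (S.omega n)) where
  hd := by have := h.hm; omega
  hs := h.hs
  hν := h.hν
  hσ := (h.hσ n).1
  hσa := (h.hσ n).2
  -- The condition on ρ_n is read off from the next width: ρ_{n+1} > 0 makes ρ'' at step n positive,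
  -- which means ρ_n > ν(1 + β + β²).
  hρ := by
    have h1 := h.rho_pos hL hρ (n + 1)
    have h2 := Real.log_nonneg (S.one_le_phi (n + 1))
    have h3 := mul_pos (by linarith [h.hδ] : 0 < S.rho (n + 1) + S.δ + Real.log (S.phi (n + 1)))
      (h.A_rpow_pos n)
    rw [h.width_eq] at h3
    have h4 := (div_pos_iff_of_pos_right (pow_pos h.b_pos 2)).mp h3
    exact sub_pos.mp h4

end Admissible

/-- The properties of the renormalized vector fields which are propagated by the scheme. -/
structure Good (n : ℕ) (X : (Fin (m + 1) → ℝ) → (Fin (m + 1) → ℝ)) : Prop where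
  mem : MemF' S.s (S.rho n) X
  small : normF' S.s (S.rho n) (fun x => X x - S.omega n) < S.eps n
  rot : HasRot X (S.omega n)

theorem Admissible.step (h : S.Admissible) {L : ℝ} (hL : Tendsto S.B atTop (𝓝 L)) (hρ : L < S.ρ)
    {n : ℕ} {X : (Fin (m + 1) → ℝ) → (Fin (m + 1) → ℝ)} (hX : S.Good n X) :
    S.InDomain (n + 1) X ∧ S.Good (n + 1) (S.R (n + 1) X) ∧
      normF' S.s (S.rho (n + 1)) (fun x => S.R (n + 1) X x - S.omega (n + 1)) <
        S.eps (n + 1) * S.θ (n + 1) := by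
  have P := h.stepParams hL hρ n
  have P' := h.stepParams hL hρ (n + 1)
  have hXω := hX.mem.sub_const (S.omega n)
  have hc := P.smallField_of_field hXω hX.small.le
    (hX.rot.coefNorm_zero_le P.hs P.rho_pos.le hXω.memF)
  have hex : ∃ u, Eliminates S.s (S.rho n) S.ν (S.σ n) (S.omega n) X u :=
    hc.exists_eliminates hX.mem
  have hdom : S.InDomain (n + 1) X := by
    refine ⟨?_, ⟨hX.mem, hX.small⟩, hex⟩
    have h1 := h.b_pos
    rw [Nat.add_sub_cancel, lt_div_iff₀ (by positivity)]
    exact P.hρ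
  refine ⟨hdom, ?_⟩
  set u := elimU S.s (S.rho n) S.ν (S.σ n) (S.omega n) X with hu
  have helim : Eliminates S.s (S.rho n) S.ν (S.σ n) (S.omega n) X u := by
    rw [hu, elimU, dif_pos hex]
    exact hex.choose_spec
  have hel := hc.eliminated hX.mem helim
  set Y := pullback (fun x => x + u x) X with hY
  have hRX : S.R (n + 1) X = opT (S.eta (n + 1)) (S.T (n + 1)) Y := rfl
  -- A displacement with summable coefficients is bounded, as required for the invariance of the
  -- rotation vector.
  have hubdd : ∃ B, ∀ x, ‖u x‖ ≤ B := by
    refine ⟨∑ i, ‖fieldRep P.hs P.radius1_pos.le helim.mem.memF i‖, fun x => ?_⟩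
    refine (pi_norm_le_iff_of_nonneg (Finset.sum_nonneg fun _ _ => norm_nonneg _)).mpr fun i => ?_
    have h1 := norm_ev_le (fieldRep P.hs P.radius1_pos.le helim.mem.memF i) x
    rw [ev_fieldRep, Complex.norm_real] at h1
    exact h1.trans (Finset.single_le_sum
      (f := fun i => ‖fieldRep P.hs P.radius1_pos.le helim.mem.memF i‖)
      (fun _ _ => norm_nonneg _) (Finset.mem_univ i))
  obtain ⟨B, hB⟩ := hubdd
  have hudiff : Differentiable ℝ u := helim.mem.1.differentiable (by simp)
  have hYrot : HasRot Y (S.omega n) :=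
    hX.rot.pullback_id_add hudiff (by norm_num) hel.lip hB
  have hrot : HasRot (S.R (n + 1) X) (S.omega (n + 1)) := by
    rw [hRX, omega_succ]
    exact hYrot.opT (S.eta_pos _) _
  -- Because ω_{n+1} = η T ω_n, the new deviation is the linear change applied to the old one, which
  -- has only resonant modes.
  have hdiff : (fun x => S.R (n + 1) X x - S.omega (n + 1)) = fun x => S.eta (n + 1) •
      (realMat (S.T (n + 1))).mulVec ((fun x => Y x - S.omega n)
        ((realMat (S.T (n + 1))⁻¹).mulVec x)) := by
    funext x
    rw [hRX, opT_apply, omega_succ, ← smul_sub, ← Matrix.mulVec_sub]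
  have hbound := linearChange_bound (η := S.eta (n + 1)) (T := S.T (n + 1)) P.hs P.radius2_pos.le
    hel.mem hel.modes (r' := S.rho (n + 1)) P'.rho_pos.le h.hδ (S.one_le_phi (n + 1))
    (S.A_pos h.hm n (h.hσ n).1).le (fun k hk hk0 => S.l1Z_transpose_le n hk hk0)
    (by rw [h.width_eq, P.radius2_eq, b])
  rw [← hdiff] at hbound
  have hmem : MemF' S.s (S.rho (n + 1)) (S.R (n + 1) X) := by
    have := hbound.1.sub_const (-S.omega (n + 1))
    simpa using this
  have hnorm := hbound.2 (hrot.coefNorm_zero_le P.hs P'.rho_pos.le hbound.1.memF)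
  have hθ := h.hθ (n + 1) (by omega)
  have hε : 0 < S.eps n := P.eps_pos
  have hε' : 0 < S.eps (n + 1) := P'.eps_pos
  have hlt : normF' S.s (S.rho (n + 1)) (fun x => S.R (n + 1) X x - S.omega (n + 1)) <
      S.eps (n + 1) * S.θ (n + 1) := by
    refine hnorm.trans_lt ?_
    set K := |S.eta (n + 1)| * matNorm (S.T (n + 1)).1 * (1 + S.s ^ S.s / S.δ ^ S.s) with hK
    set q := normF' S.s (S.rho n) fun x => X x - S.omega n with hq
    have hK0 : 0 ≤ K := by
      have h1 := matNorm_nonneg (S.T (n + 1)).1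
      have h2 := P.s_pos
      have h3 := h.hδ
      positivity
    have hφ := S.one_le_phi (n + 1)
    have hφ' : 7 * ((m + 1 : ℝ) + 1) * |S.eta (n + 1)| * matNorm (S.T (n + 1)).1 *
        (1 + S.s ^ S.s / S.δ ^ S.s) * (S.eps n / (S.eps (n + 1) * S.θ (n + 1))) ≤
        S.phi (n + 1) := le_max_left _ _
    have hεθ : 0 < S.eps (n + 1) * S.θ (n + 1) := mul_pos hε' hθ.1
    have h1 : 7 * ((m + 1 : ℝ) + 1) * K * S.eps n ≤
        S.phi (n + 1) * (S.eps (n + 1) * S.θ (n + 1)) := by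
      rw [← div_le_iff₀ hεθ]
      refine le_trans (le_of_eq ?_) hφ'
      rw [hK]; ring
    -- Since d ≥ 2, the constant 7(d+1) in φ is at least 21, whereas 2 · 4 = 8 is needed: a factor 2
    -- from the constant mode and 4 from the elimination.
    have hm1 : (1 : ℝ) ≤ m := by exact_mod_cast h.hm
    have h2 : 21 * (K * S.eps n) ≤ S.phi (n + 1) * (S.eps (n + 1) * S.θ (n + 1)) := by
      refine le_trans ?_ h1
      have := mul_nonneg hK0 hε.le
      nlinarith
    have hq0 : 0 ≤ q := hc.nonneg
    have h3 : ∑' k, termF S.s (radius2 (m + 1) S.s S.ν (S.rho n)) (fun x => Y x - S.omega n) k ≤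
        4 * q := by
      refine hel.sum_le.trans ?_
      have : Real.exp (-S.ν) ≤ 1 := Real.exp_le_one_iff.mpr (by linarith [h.hν])
      nlinarith
    have h4 : 2 * (K / S.phi (n + 1) * (4 * q)) < S.eps (n + 1) * S.θ (n + 1) := by
      rw [show 2 * (K / S.phi (n + 1) * (4 * q)) = 8 * (K * q) / S.phi (n + 1) by ring,
        div_lt_iff₀ (by linarith)]
      -- The gap between 8 and 21, with the positivity of φεθ, gives the strict inequality even when
      -- K q vanishes.
      have h5 : K * q ≤ K * S.eps n := mul_le_mul_of_nonneg_left hX.small.le hK0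
      have h6 : 0 < S.phi (n + 1) * (S.eps (n + 1) * S.θ (n + 1)) := mul_pos (by linarith) hεθ
      linarith
    refine lt_of_le_of_lt ?_ h4
    have h7 : 0 ≤ K / S.phi (n + 1) := div_nonneg hK0 (by linarith)
    have := mul_le_mul_of_nonneg_left h3 h7
    linarith
  refine ⟨⟨hmem, hlt.trans_le ?_, hrot⟩, hlt⟩
  exact mul_le_of_le_one_right hε'.le hθ.2

end Scheme

end GevreyRenorm

theorem mainTheorem4 {m : ℕ} (hm : 1 ≤ m) (S : GevreyRenorm.Scheme m)
    (hs : 1 ≤ S.s) (hν : 0 < S.ν) (hδ : 0 < S.δ)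
    (hω : GevreyRenorm.RatIndep (GevreyRenorm.freq S.α))
    (F : Set (Matrix.SpecialLinearGroup (Fin (m + 1)) ℝ))
    (hF : GevreyRenorm.IsFundDomain F) (hMCF : S.IsMCF F)
    (hσ : ∀ n, 0 < S.σ n ∧ S.σ n < GevreyRenorm.l1 (S.omega n))
    (hθ : ∀ n, 1 ≤ n → 0 < S.θ n ∧ S.θ n ≤ 1)
    (X : (Fin (m + 1) → ℝ) → (Fin (m + 1) → ℝ))
    (hX : GevreyRenorm.MemF' S.s S.ρ X)
    (hrot : GevreyRenorm.HasRot X (GevreyRenorm.freq S.α))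
    (hclose : GevreyRenorm.normF' S.s S.ρ (fun x => X x - GevreyRenorm.freq S.α) < S.eps 0)
    (L : ℝ) (hL : Filter.Tendsto S.B Filter.atTop (nhds L)) (hρ : L < S.ρ) :
    S.InfinitelyRenormalizable X ∧
      ∀ n, 1 ≤ n → GevreyRenorm.MemF' S.s (S.rho n) (S.renorm X n) ∧
        GevreyRenorm.normF' S.s (S.rho n) (fun x => S.renorm X n x - S.omega n) <
          S.eps n * S.θ n := by
  have h : S.Admissible := ⟨hm, hs, hν, hδ, hσ, hθ⟩
  have hgood : ∀ n, S.Good n (S.renorm X n) := by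
    intro n
    induction n with
    | zero =>
      -- At t_0 = 0 and P_0 = I the vector ω_0 is ω itself, so the hypotheses on X are the initial
      -- case of the induction.
      rw [← S.omega_zero hMCF] at hrot hclose
      exact ⟨hX, hclose, hrot⟩
    | succ n ih => exact (h.step hL hρ ih).2.1
  constructor
  · intro n hn
    obtain ⟨i, rfl⟩ := Nat.exists_eq_add_of_le' hn
    exact (h.step hL hρ (hgood i)).1
  · intro n hn
    obtain ⟨i, rfl⟩ := Nat.exists_eq_add_of_le' hn
    exact ⟨(hgood (i + 1)).mem, (h.step hL hρ (hgood i)).2.2⟩
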